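/- **Theorem 5.1.** *Domain.* Let $(\gamma)$ be a continuous, non-increasing curve in the first quadrant of the $(s,t)$-plane from $(a,0)$ to $(0,b)$ ($a,b>0$) that meets the axes only at its end points, parametrized by arc length as $\mu\mapsto(L_1(\mu),L_2(\mu))$, $0\le\mu\le\ell$. Let $\mathbf P=\{P_0=(a,0),P_1,\dots,P_N,P_{N+1}=(0,b)\}$ be finitely many points (vertices), in this order on $(\gamma)$, such that $(\gamma)$ is $C^2$ up to the end points on each arc between consecutive vertices. Let $G$ be the closed region bounded by the axes and $(\gamma)$, let $G_R$ be the set of points of $G$ none of whose coordinates equals the corresponding coordinate of a vertex, and let $(n_1,n_2)=(L_2',-L_1')$ be the outward unit normal. For $(s,t)\in G$ put $W(s,t)=[0,s]\times[0,t]$, $E(s,t)=\{(\sigma,\tau)\in G:\sigma\ge s,\tau\ge t\}$, $\gamma(s,t)=(\gamma)\cap E(s,t)$. *Problem.* Let $U=\{u\in\mathbb R^m:\underline u^j\le u^j\le\bar u^j\}$. An admissible control is a Borel function $u:G\to U$ that is continuous on each of finitely many open sets whose closures have union $G$. Its state $x:G\to\mathbb R^n$ is the solution, in integral form, of $$x_{st}=f(s,t,x,x_s,x_t,u),\qquad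 x(s,0)=x_1(s),\quad x(0,t)=x_2(t),$$ that is, $x(s,t)=x_1(s)+x_2(t)-x_1(0)+\iint_{W(s,t)}f\,dA$, $x_s(s,t)=x_1'(s)+\int_0^t f(s,\tau,\dots)\,d\tau$, $x_t(s,t)=x_2'(t)+\int_0^s f(\sigma,t,\dots)\,d\sigma$ at every point of $G$, with $x,x_s,x_t$ Borel and bounded. The cost is $$J=\iint_G\Phi(s,t,x,x_s,x_t,u)\,dA+\int_{(\gamma)}\Phi_1(s,t,x,x_\mu)\,d\mu+\sum_{P\in\mathbf P}\Phi_0(P,x(P)),\qquad x_\mu=-n_2x_s+n_1x_t .$$ Here $f(s,t,x,p,q,u)\in\mathbb R^n$ and $\Phi(s,t,x,p,q,u)\in\mathbb R$ are jointly continuous on $G\times(\mathbb R^n)^3\times U$ and differentiable in $(x,p,q)$ with jointly continuous derivative; $f$ is Lipschitz in $(x,p,q)$ uniformly in $(s,t,u)$; $\Phi_1(s,t,x,\eta)$ is jointly continuous on $(\gamma)\times(\mathbb R^n)^2$ and differentiable in $(x,\eta)$ with jointly continuous derivative; $\Phi_0(P,\cdot)$ is $C^1$ for each vertex $P$; $x_1,x_2$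 are $C^1$ on $[0,a]$, $[0,b]$ and $x_1(0)=x_2(0)$. *Co-state.* Let $u^*$ be an optimal admissible control (its cost is at most that of every admissible control), with state $x^*$. Along $(x^*,x^*_s,x^*_t,u^*)$, let $R(s,t,\sigma,\tau)$, $(s,t)\in G$, $(\sigma,\tau)\in W(s,t)$, be the matrix Riemann function of the linearized problem, that is, the bounded Borel solution, in integrated form, of $$R_{st}=f_xR+f_pR_s+f_qR_t,\quad R_s(s,\tau,\sigma,\tau)=f_q(s,\tau)R(s,\tau,\sigma,\tau),\quad R_t(\sigma,t,\sigma,\tau)=f_p(\sigma,t)R(\sigma,t,\sigma,\tau),\quad R(\sigma,\tau,\sigma,\tau)=I,$$ with $R_s,R_t$ bounded and Borel. Assume that along this trajectory $\Phi_p$ is absolutely continuous in $s$ for almost every $t$, $\Phi_q$ is absolutely continuous in $t$ for almost every $s$ (in both cases on the corresponding sections of $G$), their total derivatives $\frac{D}{Ds}\Phi_p$, $\frac{D}{Dt}\Phi_q$ are integrable on $G$, and $\Phi_{1,\eta}$ agrees on each open arc of $(\gamma)$ between consecutive vertices with a function that is absolutely continuous on the closed arc. The co-state is the row vector $$\begin{aligned}\psi^*(s,t)={}&\iint_{E(s,t)}\Big(\Phi_x-\tfrac{D}{Ds}\Phi_p-\tfrac{D}{Dt}\Phi_q\Big)R(\sigma,\tau,s,t)\,dA(\sigma,\tau)\\&+\int_{\gamma(s,t)}\Big(n_1\Phi_p+n_2\Phi_q+\Phi_{1,x}-\tfrac{D}{D\mu}\Phi_{1,\eta}\Big)R(\sigma,\tau,s,t)\,d\mu(\sigma,\tau)\\&+\sum_{1\le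 r\le N,\ (s,t)\in W(P_r)}\big(\Phi_{0,x}(P_r,x^*(P_r))-V_r(\Phi_{1,\eta})\big)R(P_r,s,t),\end{aligned}$$ where $V_r(\varphi)=\varphi(P_r+)-\varphi(P_r-)$ is the jump at $P_r$ in the direction of increasing $\mu$. Let $H(s,t,x,p,q,\psi,u)=\Phi(s,t,x,p,q,u)+\psi f(s,t,x,p,q,u)$. *Claim.* Assume that $H(s,t,x^*(s,t),x^*_s(s,t),x^*_t(s,t),\psi^*(s,t),u)$ is differentiable with respect to $u\in U$, uniformly in $(s,t)\in G_R$ and $u\in U$, with a derivative that is bounded and continuous in $(s,t,u)\in G_R\times U$. Then at every point $(s,t)\in G_R$ at which $u^*$ is continuous (relative to $G$), $$H(s,t,x^*,x^*_s,x^*_t,\psi^*,u^*(s,t))\le H(s,t,x^*,x^*_s,x^*_t,\psi^*,u_1)\qquad\text{for all }u_1\in U .$$ -/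

import Mathlib

open MeasureTheory Set

noncomputable section

namespace GoursatControl

/-- `k`-dimensional Euclidean space. -/
abbrev Vec (k : ℕ) := EuclideanSpace ℝ (Fin k)

/-- Row vectors. The co-state and the gradients in `x`, `x_s`, `x_t` take values here. -/
abbrev Covec (k : ℕ) := Vec k →L[ℝ] ℝ

/-- `n × n` matrices, acting on columns. -/
abbrev Mat (k : ℕ) := Vec k →L[ℝ] Vec k

/-- The rectangle `W(s,t) = [0,s] × [0,t]`. -/
def W (z : ℝ × ℝ) : Set (ℝ × ℝ) := Icc 0 z.1 ×ˢ Icc 0 z.2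

/-! ### The domain -/

/-- The curve `γ`: a continuous, piecewise `C²`, non-increasing curve from `(a,0)` to `(0,b)`,
parametrized by arc length `μ ∈ [0,ℓ]` as `μ ↦ (L₁ μ, L₂ μ)`, meeting the axes only at its
end points, and carrying the vertices `P_0 = (a,0), P_1, …, P_N, P_{N+1} = (0,b)` at the parameter
values `0 = vert 0 < vert 1 < … < vert (N+1) = ℓ`. Between consecutive vertices the
curve is `C²` up to the end points, so the vertices include all jump points of the normal field. -/
structure Curve (N : ℕ) where
  a : ℝ
  b : ℝ
  ℓ : ℝ
  L₁ : ℝ → ℝ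
  L₂ : ℝ → ℝ
  vert : Fin (N + 2) → ℝ
  a_pos : 0 < a
  b_pos : 0 < b
  vert_strictMono : StrictMono vert
  vert_zero : vert 0 = 0
  vert_last : vert (Fin.last (N + 1)) = ℓ
  start_eq : L₁ 0 = a ∧ L₂ 0 = 0
  end_eq : L₁ ℓ = 0 ∧ L₂ ℓ = b
  antitone_L₁ : AntitoneOn L₁ (Icc 0 ℓ)
  monotone_L₂ : MonotoneOn L₂ (Icc 0 ℓ)
  pos : ∀ m ∈ Ioo 0 ℓ, 0 < L₁ m ∧ 0 < L₂ m
  contDiffOn_L₁ : ∀ r : Fin (N + 1), ContDiffOn ℝ 2 L₁ (Icc (vert r.castSucc) (vert r.succ))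
  contDiffOn_L₂ : ∀ r : Fin (N + 1), ContDiffOn ℝ 2 L₂ (Icc (vert r.castSucc) (vert r.succ))
  unit_speed : ∀ r : Fin (N + 1), ∀ m ∈ Ioo (vert r.castSucc) (vert r.succ),
    deriv L₁ m ^ 2 + deriv L₂ m ^ 2 = 1

namespace Curve

variable {N : ℕ} (c : Curve N)

/-- The point of `γ` with arc length parameter `m`. -/
def pt (m : ℝ) : ℝ × ℝ := (c.L₁ m, c.L₂ m)

/-- The vertex `P_r`. -/
def P (r : Fin (N + 2)) : ℝ × ℝ := c.pt (c.vert r)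

/-- The curve as a set of points. -/
def range : Set (ℝ × ℝ) := c.pt '' Icc 0 c.ℓ

/-- The closed region in the first quadrant bounded by the axes and the curve. -/
def G : Set (ℝ × ℝ) :=
  {z | 0 ≤ z.1 ∧ 0 ≤ z.2 ∧ ∃ m ∈ Icc 0 c.ℓ, z.1 ≤ c.L₁ m ∧ z.2 ≤ c.L₂ m}

/-- The regular part of `G`: no coordinate agrees with that of a vertex. -/
def GR : Set (ℝ × ℝ) := {z ∈ c.G | ∀ r, z.1 ≠ (c.P r).1 ∧ z.2 ≠ (c.P r).2}

/-- `E(s,t)`: the points of `G` to the upper right of `(s,t)`. -/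
def E (z : ℝ × ℝ) : Set (ℝ × ℝ) := {w ∈ c.G | z ∈ W w}

/-- First component of the outward unit normal (the tangent is `(L₁', L₂') = (-n₂, n₁)`). -/
def n₁ (m : ℝ) : ℝ := deriv c.L₂ m

/-- Second component of the outward unit normal. -/
def n₂ (m : ℝ) : ℝ := -deriv c.L₁ m

/-- The tangential derivative `-n₂ φ_s + n₁ φ_t` along the curve, from the two partial
derivatives `p = φ_s`, `q = φ_t`. -/
def tangential {n : ℕ} (p q : ℝ × ℝ → Vec n) (m : ℝ) : Vec n :=
  -c.n₂ m • p (c.pt m) + c.n₁ m • q (c.pt m)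

end Curve

/-! ### The control problem -/

/-- The data of the control problem: the right-hand side `f (s,t) x p q u`, the
running cost `Φ (s,t) x p q u`, the curve cost `Φ₁ (s,t) x η`, the vertex cost `Φ₀ P x`,
the data `x₁`, `x₂` on the axes and the bounds on the components of the control. -/
structure Data (n m N : ℕ) where
  c : Curve N
  f : ℝ × ℝ → Vec n → Vec n → Vec n → Vec m → Vec n
  Φ : ℝ × ℝ → Vec n → Vec n → Vec n → Vec m → ℝ
  Φ₁ : ℝ × ℝ → Vec n → Vec n → ℝ
  Φ₀ : ℝ × ℝ → Vec n → ℝ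
  x₁ : ℝ → Vec n
  x₂ : ℝ → Vec n
  lo : Fin m → ℝ
  hi : Fin m → ℝ

namespace Data

variable {n m N : ℕ} (d : Data n m N)

/-- The set of admissible control values. -/
def U : Set (Vec m) := {v | ∀ j, d.lo j ≤ v j ∧ v j ≤ d.hi j}

/-- `C¹` dependence of `g z x p q u` on `(x,p,q)`, jointly continuously in all the variables. -/
structure IsC1 {F : Type*} [NormedAddCommGroup F] [NormedSpace ℝ F]
    (g : ℝ × ℝ → Vec n → Vec n → Vec n → Vec m → F) : Prop where
  continuousOn : ContinuousOn
    (fun w : (ℝ × ℝ) × (Vec n × Vec n × Vec n) × Vec m =>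
      g w.1 w.2.1.1 w.2.1.2.1 w.2.1.2.2 w.2.2) (d.c.G ×ˢ univ ×ˢ d.U)
  differentiable : ∀ z ∈ d.c.G, ∀ u ∈ d.U,
    Differentiable ℝ (fun y : Vec n × Vec n × Vec n => g z y.1 y.2.1 y.2.2 u)
  continuousOn_fderiv : ContinuousOn
    (fun w : (ℝ × ℝ) × (Vec n × Vec n × Vec n) × Vec m =>
      fderiv ℝ (fun y : Vec n × Vec n × Vec n => g w.1 y.1 y.2.1 y.2.2 w.2.2) w.2.1)
    (d.c.G ×ˢ univ ×ˢ d.U)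

/-- The standing smoothness assumptions on the data. -/
structure Regular : Prop where
  f_C1 : d.IsC1 d.f
  f_lipschitz : ∃ K : ℝ, ∀ z ∈ d.c.G, ∀ u ∈ d.U, ∀ x p q x' p' q' : Vec n,
    ‖d.f z x p q u - d.f z x' p' q' u‖ ≤ K * (‖x - x'‖ + ‖p - p'‖ + ‖q - q'‖)
  Φ_C1 : d.IsC1 d.Φ
  Φ₁_continuousOn : ContinuousOn (fun w : (ℝ × ℝ) × (Vec n × Vec n) => d.Φ₁ w.1 w.2.1 w.2.2)
    (d.c.range ×ˢ univ)
  Φ₁_differentiable : ∀ z ∈ d.c.range,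
    Differentiable ℝ (fun y : Vec n × Vec n => d.Φ₁ z y.1 y.2)
  Φ₁_continuousOn_fderiv : ContinuousOn
    (fun w : (ℝ × ℝ) × (Vec n × Vec n) =>
      fderiv ℝ (fun y : Vec n × Vec n => d.Φ₁ w.1 y.1 y.2) w.2) (d.c.range ×ˢ univ)
  Φ₀_C1 : ∀ r, ContDiff ℝ 1 (d.Φ₀ (d.c.P r))
  x₁_C1 : ContDiffOn ℝ 1 d.x₁ (Icc 0 d.c.a)
  x₂_C1 : ContDiffOn ℝ 1 d.x₂ (Icc 0 d.c.b)
  compatible : d.x₁ 0 = d.x₂ 0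

/-- Admissible controls: (Borel) measurable, with values in `U`, and piecewise continuous on `G`,
that is, continuous on each of finitely many open sets whose closures have union `G`. -/
structure Admissible (u : ℝ × ℝ → Vec m) : Prop where
  measurable : Measurable fun z : d.c.G => u z
  mem_U : ∀ z ∈ d.c.G, u z ∈ d.U
  piecewise : ∃ S : Set (Set (ℝ × ℝ)), S.Finite ∧ (∀ O ∈ S, IsOpen O ∧ ContinuousOn u O) ∧
    ⋃ O ∈ S, closure O = d.c.G

/-- A controlled state: a control `u`, a state `x` and the partial derivatives `p = x_s`, `q = x_t`. -/
structure ControlledState (n m : ℕ) where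
  u : ℝ × ℝ → Vec m
  x : ℝ × ℝ → Vec n
  p : ℝ × ℝ → Vec n
  q : ℝ × ℝ → Vec n

/-- A function of `(s,t)`, `x`, `p`, `q`, `u` evaluated along `π`. -/
def along {F : Type*} (g : ℝ × ℝ → Vec n → Vec n → Vec n → Vec m → F) (π : ControlledState n m)
    (z : ℝ × ℝ) : F := g z (π.x z) (π.p z) (π.q z) (π.u z)

/-- `x` is the state trajectory of the control `u`, with partial derivatives `p = x_s`, `q = x_t`:
the Goursat-Darboux problem `x_st = f(s,t,x,x_s,x_t,u)`, `x(s,0) = x₁(s)`, `x(0,t) = x₂(t)` in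
integral form, together with the equations for `x_s` and `x_t` obtained by differentiation. -/
structure IsTrajectory (π : ControlledState n m) : Prop where
  measurable_x : Measurable fun z : d.c.G => π.x z
  measurable_p : Measurable fun z : d.c.G => π.p z
  measurable_q : Measurable fun z : d.c.G => π.q z
  bounded : ∃ C : ℝ, ∀ z ∈ d.c.G, ‖π.x z‖ ≤ C ∧ ‖π.p z‖ ≤ C ∧ ‖π.q z‖ ≤ C
  x_eq : ∀ z ∈ d.c.G, π.x z = d.x₁ z.1 + d.x₂ z.2 - d.x₁ 0 + ∫ w in W z, along d.f π w
  p_eq : ∀ z ∈ d.c.G, π.p z =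
    derivWithin d.x₁ (Icc 0 d.c.a) z.1 + ∫ τ in (0 : ℝ)..z.2, along d.f π (z.1, τ)
  q_eq : ∀ z ∈ d.c.G, π.q z =
    derivWithin d.x₂ (Icc 0 d.c.b) z.2 + ∫ σ in (0 : ℝ)..z.1, along d.f π (σ, z.2)

/-- The cost functional `J`. -/
def J (π : ControlledState n m) : ℝ :=
  (∫ z in d.c.G, along d.Φ π z) +
  (∫ μ in (0 : ℝ)..d.c.ℓ, d.Φ₁ (d.c.pt μ) (π.x (d.c.pt μ)) (d.c.tangential π.p π.q μ)) +
  ∑ r, d.Φ₀ (d.c.P r) (π.x (d.c.P r))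

/-- The controlled state `π` is optimal: its control is admissible, its state is the corresponding
trajectory, and its cost is minimal among all admissible controls. -/
structure IsOptimal (π : ControlledState n m) : Prop where
  admissible : d.Admissible π.u
  trajectory : d.IsTrajectory π
  minimal : ∀ ρ : ControlledState n m, d.Admissible ρ.u → d.IsTrajectory ρ → d.J π ≤ d.J ρ

/-! ### Linearization, Riemann function, co-state -/

section partials

variable {F : Type*} [NormedAddCommGroup F] [NormedSpace ℝ F]

/-- Partial derivative with respect to `x`. -/
def dx (g : ℝ × ℝ → Vec n → Vec n → Vec n → Vec m → F) (z : ℝ × ℝ) (x p q : Vec n)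
    (u : Vec m) : Vec n →L[ℝ] F := fderiv ℝ (fun ξ => g z ξ p q u) x

/-- Partial derivative with respect to `p`, the slot of `x_s`. -/
def dp (g : ℝ × ℝ → Vec n → Vec n → Vec n → Vec m → F) (z : ℝ × ℝ) (x p q : Vec n)
    (u : Vec m) : Vec n →L[ℝ] F := fderiv ℝ (fun ξ => g z x ξ q u) p

/-- Partial derivative with respect to `q`, the slot of `x_t`. -/
def dq (g : ℝ × ℝ → Vec n → Vec n → Vec n → Vec m → F) (z : ℝ × ℝ) (x p q : Vec n)
    (u : Vec m) : Vec n →L[ℝ] F := fderiv ℝ (fun ξ => g z x p ξ u) q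

end partials

/-- `f_x R + f_p R_s + f_q R_t`, with the derivatives of `f` taken along `π` at the point `z`. -/
def linRHS (π : ControlledState n m) (R Rs Rt : ℝ × ℝ → ℝ × ℝ → Mat n) (z w : ℝ × ℝ) : Mat n :=
  along (dx d.f) π z ∘L R z w + along (dp d.f) π z ∘L Rs z w + along (dq d.f) π z ∘L Rt z w

/-- `R z w = R(s,t,σ,τ)`, for `z = (s,t) ∈ G` and `w = (σ,τ) ∈ W(s,t)`, is the matrix-valued Riemann
function of the Goursat-Darboux problem linearized along `π`, with `Rs = ∂R/∂s`, `Rt = ∂R/∂t`.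
It solves, for `s > σ`, `t > τ`, the equation `R_st = f_x R + f_p R_s + f_q R_t`, with
`R_s = f_q R` on `t = τ`, `R_t = f_p R` on `s = σ`, and `R = 1` at `(s,t) = (σ,τ)`. As the coefficients
are only piecewise continuous, this is stated in integrated form. -/
structure IsRiemann (π : ControlledState n m) (R Rs Rt : ℝ × ℝ → ℝ × ℝ → Mat n) : Prop where
  measurable_R : Measurable
    fun v : {v : (ℝ × ℝ) × (ℝ × ℝ) // v.1 ∈ d.c.G ∧ v.2 ∈ W v.1} => R v.1.1 v.1.2
  measurable_Rs : Measurable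
    fun v : {v : (ℝ × ℝ) × (ℝ × ℝ) // v.1 ∈ d.c.G ∧ v.2 ∈ W v.1} => Rs v.1.1 v.1.2
  measurable_Rt : Measurable
    fun v : {v : (ℝ × ℝ) × (ℝ × ℝ) // v.1 ∈ d.c.G ∧ v.2 ∈ W v.1} => Rt v.1.1 v.1.2
  bounded : ∃ C : ℝ, ∀ z ∈ d.c.G, ∀ w ∈ W z, ‖R z w‖ ≤ C ∧ ‖Rs z w‖ ≤ C ∧ ‖Rt z w‖ ≤ C
  R_eq : ∀ z ∈ d.c.G, ∀ w ∈ W z, R z w = ContinuousLinearMap.id ℝ (Vec n) +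
    (∫ σ in w.1..z.1, along (dq d.f) π (σ, w.2) ∘L R (σ, w.2) w) +
    (∫ τ in w.2..z.2, along (dp d.f) π (w.1, τ) ∘L R (w.1, τ) w) +
    ∫ v in Icc w.1 z.1 ×ˢ Icc w.2 z.2, d.linRHS π R Rs Rt v w
  Rs_eq : ∀ z ∈ d.c.G, ∀ w ∈ W z, Rs z w =
    along (dq d.f) π (z.1, w.2) ∘L R (z.1, w.2) w +
    ∫ τ in w.2..z.2, d.linRHS π R Rs Rt (z.1, τ) w
  Rt_eq : ∀ z ∈ d.c.G, ∀ w ∈ W z, Rt z w =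
    along (dp d.f) π (w.1, z.2) ∘L R (w.1, z.2) w +
    ∫ σ in w.1..z.1, d.linRHS π R Rs Rt (σ, z.2) w

/-- `∂Φ₁/∂x` along the curve. -/
def Φ₁x (π : ControlledState n m) (μ : ℝ) : Covec n :=
  fderiv ℝ (fun ξ => d.Φ₁ (d.c.pt μ) ξ (d.c.tangential π.p π.q μ)) (π.x (d.c.pt μ))

/-- `∂Φ₁/∂η` along the curve, where `η` is the slot of the tangential derivative. -/
def Φ₁η (π : ControlledState n m) (μ : ℝ) : Covec n :=
  fderiv ℝ (fun η => d.Φ₁ (d.c.pt μ) (π.x (d.c.pt μ)) η) (d.c.tangential π.p π.q μ)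

/-- The total derivatives in the definition of the co-state make sense: `Φ_p` along `π` is
absolutely continuous in `s`, `Φ_q` along `π` is absolutely continuous in `t`
(on almost every section of `G`), with total derivatives integrable over `G`, and `Φ_{1,η}` along `π`
is absolutely continuous on each arc of the curve between consecutive vertices. -/
structure CostateRegular (π : ControlledState n m) : Prop where
  ac_s : ∀ᵐ t : ℝ, ∀ s : ℝ, (s, t) ∈ d.c.G →
    AbsolutelyContinuousOnInterval (fun σ => along (dp d.Φ) π (σ, t)) 0 s
  integrable_s : IntegrableOn
    (fun z : ℝ × ℝ => deriv (fun σ => along (dp d.Φ) π (σ, z.2)) z.1) d.c.G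
  ac_t : ∀ᵐ s : ℝ, ∀ t : ℝ, (s, t) ∈ d.c.G →
    AbsolutelyContinuousOnInterval (fun τ => along (dq d.Φ) π (s, τ)) 0 t
  integrable_t : IntegrableOn
    (fun z : ℝ × ℝ => deriv (fun τ => along (dq d.Φ) π (z.1, τ)) z.2) d.c.G
  ac_μ : ∀ r : Fin (N + 1), ∃ g : ℝ → Covec n,
    AbsolutelyContinuousOnInterval g (d.c.vert r.castSucc) (d.c.vert r.succ) ∧
    EqOn (d.Φ₁η π) g (Ioo (d.c.vert r.castSucc) (d.c.vert r.succ))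

/-- The area density `Φ_x - (D/Ds) Φ_p - (D/Dt) Φ_q` of the co-state. -/
def F (π : ControlledState n m) (z : ℝ × ℝ) : Covec n :=
  along (dx d.Φ) π z - deriv (fun σ => along (dp d.Φ) π (σ, z.2)) z.1
    - deriv (fun τ => along (dq d.Φ) π (z.1, τ)) z.2

/-- The curve density `n₁ Φ_p + n₂ Φ_q + Φ_{1,x} - (D/Dμ) Φ_{1,η}` of the co-state. -/
def F₁ (π : ControlledState n m) (μ : ℝ) : Covec n :=
  d.c.n₁ μ • along (dp d.Φ) π (d.c.pt μ) + d.c.n₂ μ • along (dq d.Φ) π (d.c.pt μ)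
    + d.Φ₁x π μ - deriv (d.Φ₁η π) μ

/-- The vertex weight `Φ_{0,x}(P_r, x(P_r)) - V_r(Φ_{1,η})`, where `V_r(φ)` is the jump
`φ(P_r+) - φ(P_r-)` at `P_r` in the direction of increasing arc length. -/
def F₀ (π : ControlledState n m) (r : Fin (N + 2)) : Covec n :=
  fderiv ℝ (d.Φ₀ (d.c.P r)) (π.x (d.c.P r))
    - (Function.rightLim (d.Φ₁η π) (d.c.vert r) - Function.leftLim (d.Φ₁η π) (d.c.vert r))

open Classical in
/-- The co-state `ψ` of `π`, in terms of the Riemann function `R`. The sum is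
over the vertices `P_1, …, P_N` that are not end points of the curve. -/
def costate (π : ControlledState n m) (R : ℝ × ℝ → ℝ × ℝ → Mat n) (w : ℝ × ℝ) : Covec n :=
  (∫ z in d.c.E w, d.F π z ∘L R z w) +
  (∫ μ in (0 : ℝ)..d.c.ℓ,
    if w ∈ W (d.c.pt μ) then d.F₁ π μ ∘L R (d.c.pt μ) w else 0) +
  ∑ r : Fin N, if w ∈ W (d.c.P r.succ.castSucc) then
    d.F₀ π r.succ.castSucc ∘L R (d.c.P r.succ.castSucc) w else 0

/-- The Hamiltonian `H = Φ + ψ f`. -/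
def H (z : ℝ × ℝ) (x p q : Vec n) (ψ : Covec n) (u : Vec m) : ℝ :=
  d.Φ z x p q u + ψ (d.f z x p q u)

/-- The function `h z u`, for `z ∈ A` and `u ∈ U`, is differentiable in `u` uniformly, with a
derivative `Dh` that is bounded and continuous on `A × U`. -/
def UniformlyDifferentiable (A : Set (ℝ × ℝ)) (h : ℝ × ℝ → Vec m → ℝ) : Prop :=
  ∃ Dh : ℝ × ℝ → Vec m → (Vec m →L[ℝ] ℝ),
    (∀ ε > 0, ∃ δ > 0, ∀ z ∈ A, ∀ u ∈ d.U, ∀ v ∈ d.U, ‖v - u‖ < δ →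
      |h z v - h z u - Dh z u (v - u)| ≤ ε * ‖v - u‖) ∧
    ContinuousOn (fun y : (ℝ × ℝ) × Vec m => Dh y.1 y.2) (A ×ˢ d.U) ∧
    ∃ C : ℝ, ∀ z ∈ A, ∀ u ∈ d.U, ‖Dh z u‖ ≤ C

end Data

end GoursatControl

end

set_option linter.unusedSectionVars false
set_option linter.unusedVariables false

namespace GoursatControl

noncomputable section

open Filter Topology

/-! ### Staircase domains and the Goursat integral operators -/

/-! The proof is a needle variation. Suppose that the inequality fails at a regular point z. Replace
the optimal control by the constant value `u₁` on a small open square Q of side ε whose upper right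
corner is z. The new control is admissible and has a trajectory, and the claim is that the cost
changes by at most ∫_Q (H(u₁) - H(u*)) + o(ε²). The integrand is continuous at z relative to the
regular part, and negative there, so the cost drops by at least a multiple of ε², against
optimality.

The unknown used throughout is not the state but its mixed derivative k, extended by zero outside G.
The three integral operators `int₁₂ k`, `int₂ k`, `int₁ k` recover the contributions of k to x, x_s
and x_t. In the sup norm weighted by exp(c(s+t)) the integral bounds contain a factor 1/c, so
existence, uniqueness and comparison for the nonlinear and linear Goursat problems all reduce to one
contraction (`exists_fixed_density`, `le_of_supersolution`, `density_eq_zero`).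

Size of the variation (`exists_needle_estimate`): k is O(1) on the square, O(ε) on the two strips
through it and O(ε²) elsewhere. Hence the variations of x_s and x_t are only O(ε) uniformly, but
∫‖k‖ = O(ε²), so that x itself varies by O(ε²) everywhere and all variations are O(ε²) in the mean.
A Taylor remainder bounded by a small multiple of the variations therefore integrates to o(ε²), over
G, over the curve and at the vertices. On Q, where the control differs, the extra error is O(ε) on a
set of area ε².

First order part of the cost (`linearized_cost`): with X = `int₁₂ k`, integration by parts in s, in
t and along the curve removes the derivatives from X. What is left is X tested against the area
density `F`, the curve density `F₁` and the vertex weights `F₀`. X vanishes on the axes, which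
removes the other boundary terms and the two end vertices.

Duality (`integral_costate`): k equals its linearization plus a source, namely the jump of f on Q
plus a Taylor remainder. By variation of constants (`IsRiemann.int₁₂_eq`), X is the integral of the
Riemann function against the source; this holds because the field built from the Riemann function
solves the same linear problem, which has one solution. Fubini then turns the tested X into ∫ ψ ·
source, and the jump of Φ plus ψ times the jump of f is the difference of Hamiltonians
(`eventually_cost_expansion`).

Continuity of that difference near z does not require continuity of the co-state: by the uniform
differentiability of H it is a uniform limit of Riemann sums of the derivative in u, which is
jointly continuous (`UniformlyDifferentiable.continuousOn_sub`). -/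

/-- A measurable region of the first quadrant, contained in `[0,a] × [0,b]`, which contains with
each point `z` the rectangle `W z`. -/
structure IsStaircase (G : Set (ℝ × ℝ)) (a b : ℝ) : Prop where
  measurableSet : MeasurableSet G
  nonneg : ∀ z ∈ G, 0 ≤ z.1 ∧ 0 ≤ z.2
  le : ∀ z ∈ G, z.1 ≤ a ∧ z.2 ≤ b
  lower : ∀ z ∈ G, W z ⊆ G

variable {V : Type*} [NormedAddCommGroup V] [NormedSpace ℝ V]

/-- The double integral over `W z`. -/
def int₁₂ (k : ℝ × ℝ → V) (z : ℝ × ℝ) : V := ∫ w in W z, k w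

/-- The integral along the vertical segment below `z`. -/
def int₂ (k : ℝ × ℝ → V) (z : ℝ × ℝ) : V := ∫ τ in Icc 0 z.2, k (z.1, τ)

/-- The integral along the horizontal segment to the left of `z`. -/
def int₁ (k : ℝ × ℝ → V) (z : ℝ × ℝ) : V := ∫ σ in Icc 0 z.1, k (σ, z.2)

/-- A bounded strongly measurable function that vanishes outside `G`. -/
structure IsDensity (G : Set (ℝ × ℝ)) (k : ℝ × ℝ → V) : Prop where
  sm : StronglyMeasurable k
  zero : ∀ z ∉ G, k z = 0
  bdd : ∃ C, 0 ≤ C ∧ ∀ z, ‖k z‖ ≤ C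

theorem measurableSet_W (z : ℝ × ℝ) : MeasurableSet (W z) := measurableSet_Icc.prod measurableSet_Icc

theorem measurableSet_mem_W : MeasurableSet {p : (ℝ × ℝ) × (ℝ × ℝ) | p.2 ∈ W p.1} := by
  have e : {p : (ℝ × ℝ) × (ℝ × ℝ) | p.2 ∈ W p.1} =
      ({p | 0 ≤ p.2.1} ∩ {p | p.2.1 ≤ p.1.1}) ∩ ({p | 0 ≤ p.2.2} ∩ {p | p.2.2 ≤ p.1.2}) := rfl
  rw [e]
  exact ((measurableSet_le (by fun_prop) (by fun_prop)).inter
    (measurableSet_le (by fun_prop) (by fun_prop))).inter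
    ((measurableSet_le (by fun_prop) (by fun_prop)).inter
    (measurableSet_le (by fun_prop) (by fun_prop)))

namespace IsStaircase

variable {G : Set (ℝ × ℝ)} {a b : ℝ}

theorem vert_mem (hG : IsStaircase G a b) {z : ℝ × ℝ} (hz : z ∈ G) {τ : ℝ}
    (hτ : τ ∈ Icc 0 z.2) : (z.1, τ) ∈ G :=
  hG.lower z hz ⟨⟨(hG.nonneg z hz).1, le_rfl⟩, hτ⟩

theorem horiz_mem (hG : IsStaircase G a b) {z : ℝ × ℝ} (hz : z ∈ G) {σ : ℝ}
    (hσ : σ ∈ Icc 0 z.1) : (σ, z.2) ∈ G :=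
  hG.lower z hz ⟨hσ, ⟨(hG.nonneg z hz).2, le_rfl⟩⟩

theorem subset (hG : IsStaircase G a b) : G ⊆ Icc 0 a ×ˢ Icc 0 b := fun z hz =>
  ⟨⟨(hG.nonneg z hz).1, (hG.le z hz).1⟩, ⟨(hG.nonneg z hz).2, (hG.le z hz).2⟩⟩

theorem volume_lt_top (hG : IsStaircase G a b) : volume G < ⊤ := by
  refine (measure_mono hG.subset).trans_lt ?_
  exact (isCompact_Icc.prod isCompact_Icc).measure_lt_top

/-- Reflection in the diagonal exchanges `int₁` and `int₂`; with it, many facts about horizontal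
integrals follow from the vertical case. -/
theorem swap (hG : IsStaircase G a b) : IsStaircase (Prod.swap ⁻¹' G) b a where
  measurableSet := measurable_swap hG.measurableSet
  nonneg z hz := (hG.nonneg z.swap hz).symm
  le z hz := (hG.le z.swap hz).symm
  lower z hz w hw := hG.lower z.swap hz ⟨hw.2, hw.1⟩

end IsStaircase

namespace IsDensity

variable {G : Set (ℝ × ℝ)} {a b : ℝ} {k k' : ℝ × ℝ → V}

theorem swap (hk : IsDensity G k) : IsDensity (Prod.swap ⁻¹' G) (k ∘ Prod.swap) where
  sm := hk.sm.comp_measurable measurable_swap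
  zero z hz := hk.zero _ hz
  bdd := let ⟨C, h0, hC⟩ := hk.bdd; ⟨C, h0, fun z => hC _⟩

theorem zero_density : IsDensity G (fun _ => (0 : V)) :=
  ⟨stronglyMeasurable_const, fun _ _ => rfl, 0, le_rfl, fun _ => by simp⟩

theorem add (hk : IsDensity G k) (hk' : IsDensity G k') : IsDensity G (fun z => k z + k' z) := by
  obtain ⟨C, h0, hC⟩ := hk.bdd
  obtain ⟨C', h0', hC'⟩ := hk'.bdd
  exact ⟨hk.sm.add hk'.sm, fun z hz => by simp [hk.zero z hz, hk'.zero z hz], C + C', by positivity,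
    fun z => (norm_add_le _ _).trans (add_le_add (hC z) (hC' z))⟩

theorem sub (hk : IsDensity G k) (hk' : IsDensity G k') : IsDensity G (fun z => k z - k' z) := by
  obtain ⟨C, h0, hC⟩ := hk.bdd
  obtain ⟨C', h0', hC'⟩ := hk'.bdd
  exact ⟨hk.sm.sub hk'.sm, fun z hz => by simp [hk.zero z hz, hk'.zero z hz], C + C', by positivity,
    fun z => (norm_sub_le _ _).trans (add_le_add (hC z) (hC' z))⟩

theorem norm (hk : IsDensity G k) : IsDensity G (fun z => ‖k z‖) := by
  obtain ⟨C, h0, hC⟩ := hk.bdd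
  exact ⟨hk.sm.norm, fun z hz => by simp [hk.zero z hz], C, h0, fun z => by simpa using hC z⟩

theorem of_indicator (hG : MeasurableSet G) (hk : StronglyMeasurable k)
    (hb : ∃ C, ∀ z ∈ G, ‖k z‖ ≤ C) : IsDensity G (G.indicator k) := by
  obtain ⟨C, hC⟩ := hb
  refine ⟨hk.indicator hG, fun z hz => indicator_of_notMem hz _, |C|, abs_nonneg _, fun z => ?_⟩
  by_cases hz : z ∈ G
  · rw [indicator_of_mem hz]; exact (hC z hz).trans (le_abs_self _)
  · rw [indicator_of_notMem hz]; simp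

theorem integrable (hG : IsStaircase G a b) (hk : IsDensity G k) : Integrable k := by
  obtain ⟨C, h0, hC⟩ := hk.bdd
  have : IntegrableOn k G :=
    Measure.integrableOn_of_bounded hG.volume_lt_top.ne hk.sm.aestronglyMeasurable
      (ae_of_all _ hC)
  refine (integrableOn_iff_integrable_of_support_subset fun z hz => ?_).1 this
  by_contra h
  exact hz (hk.zero z h)

theorem section_sm (hk : IsDensity G k) (s : ℝ) : StronglyMeasurable fun τ => k (s, τ) :=
  hk.sm.comp_measurable measurable_prodMk_left

theorem integrable_section (hG : IsStaircase G a b) (hk : IsDensity G k) (s : ℝ) :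
    Integrable fun τ => k (s, τ) := by
  obtain ⟨C, h0, hC⟩ := hk.bdd
  have : IntegrableOn (fun τ => k (s, τ)) (Icc 0 b) :=
    Measure.integrableOn_of_bounded measure_Icc_lt_top.ne (hk.section_sm s).aestronglyMeasurable
      (ae_of_all _ fun τ => hC _)
  refine (integrableOn_iff_integrable_of_support_subset fun τ hτ => ?_).1 this
  by_contra h
  exact hτ (hk.zero _ fun h' => h (hG.subset h').2)

theorem integrable_section' (hG : IsStaircase G a b) (hk : IsDensity G k) (t : ℝ) :
    Integrable fun σ => k (σ, t) :=
  hk.swap.integrable_section hG.swap t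

/-- The moving domain of integration is written as an indicator on the product space, so that
measurability in the parameter follows from the theorem for a fixed measure. -/
theorem sm_int₂ (hk : IsDensity G k) : StronglyMeasurable (int₂ k) := by
  have : int₂ k = fun z : ℝ × ℝ => ∫ τ,
      {p : (ℝ × ℝ) × ℝ | p.2 ∈ Icc 0 p.1.2}.indicator (fun p => k (p.1.1, p.2)) (z, τ) := by
    ext z
    rw [int₂, ← integral_indicator measurableSet_Icc]
    rfl
  rw [this]
  refine StronglyMeasurable.integral_prod_right' (f := {p : (ℝ × ℝ) × ℝ | p.2 ∈ Icc 0 p.1.2}.indicator (fun p => k (p.1.1, p.2))) ?_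
  refine StronglyMeasurable.indicator (hk.sm.comp_measurable (by fun_prop)) ?_
  exact (measurableSet_le measurable_const measurable_snd).inter
    (measurableSet_le measurable_snd (by fun_prop))

theorem sm_int₁ (hk : IsDensity G k) : StronglyMeasurable (int₁ k) :=
  hk.swap.sm_int₂.comp_measurable measurable_swap

theorem sm_int₁₂ (hk : IsDensity G k) : StronglyMeasurable (int₁₂ k) := by
  have : int₁₂ k = fun z : ℝ × ℝ => ∫ w,
      {p : (ℝ × ℝ) × (ℝ × ℝ) | p.2 ∈ W p.1}.indicator (fun p => k p.2) (z, w) := by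
    ext z
    rw [int₁₂, ← integral_indicator (measurableSet_W z)]
    rfl
  rw [this]
  refine StronglyMeasurable.integral_prod_right' (f := {p : (ℝ × ℝ) × (ℝ × ℝ) | p.2 ∈ W p.1}.indicator (fun p => k p.2)) ?_
  refine StronglyMeasurable.indicator (hk.sm.comp_measurable (by fun_prop)) ?_
  exact measurableSet_mem_W

theorem int₁₂_eq (hG : IsStaircase G a b) (hk : IsDensity G k) (z : ℝ × ℝ) :
    int₁₂ k z = int₁ (int₂ k) z := by
  rw [int₁₂, W, Measure.volume_eq_prod, setIntegral_prod]
  · rfl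
  · exact (hk.integrable hG).integrableOn

theorem int₁₂_eq' (hG : IsStaircase G a b) (hk : IsDensity G k) (z : ℝ × ℝ) :
    int₁₂ k z = int₂ (int₁ k) z := by
  have h := hk.swap.int₁₂_eq hG.swap z.swap
  have e : int₁₂ (k ∘ Prod.swap) z.swap = int₁₂ k z := by
    rw [int₁₂, int₁₂, Measure.volume_eq_prod]
    exact setIntegral_prod_swap (μ := volume) (ν := volume) (Icc 0 z.1) (Icc 0 z.2) k
  rw [← e, h]
  rfl

end IsDensity

/-! ### Exponentially weighted estimates -/

/-- The weight `exp (c (s + t))`. -/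
def wt (c : ℝ) (z : ℝ × ℝ) : ℝ := Real.exp (c * (z.1 + z.2))

theorem wt_pos (c : ℝ) (z : ℝ × ℝ) : 0 < wt c z := Real.exp_pos _

theorem wt_mono {c : ℝ} (hc : 0 ≤ c) {z w : ℝ × ℝ} (h₁ : w.1 ≤ z.1) (h₂ : w.2 ≤ z.2) :
    wt c w ≤ wt c z := Real.exp_le_exp.2 (by gcongr)

theorem continuous_wt (c : ℝ) : Continuous (wt c) := by unfold wt; fun_prop

/-- The primitive of exp(c(s+τ)) in τ is itself divided by c, and the lower end contributes with a
favourable sign. This factor 1/c is the source of every contraction below. -/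
theorem int₂_wt_le {c : ℝ} (hc : 0 < c) {z : ℝ × ℝ} (hz : 0 ≤ z.2) :
    int₂ (wt c) z ≤ wt c z / c := by
  rw [int₂, integral_Icc_eq_integral_Ioc, ← intervalIntegral.integral_of_le hz]
  have : ∫ τ in (0:ℝ)..z.2, wt c (z.1, τ) = wt c (z.1, z.2) / c - wt c (z.1, 0) / c := by
    refine intervalIntegral.integral_eq_sub_of_hasDerivAt (f := fun τ => wt c (z.1, τ) / c)
      (fun τ _ => ?_) ?_
    · have h : HasDerivAt (fun τ : ℝ => c * (z.1 + τ)) (c * 1) τ :=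
        ((hasDerivAt_id τ).const_add z.1).const_mul c
      have := h.exp.div_const c
      simpa [wt, hc.ne'] using this
    · exact ((continuous_wt c).comp (by fun_prop)).intervalIntegrable _ _
  rw [this]
  have := wt_pos c (z.1, 0)
  have : 0 < wt c (z.1, 0) / c := by positivity
  simp only [Prod.mk.eta]
  linarith

variable {G : Set (ℝ × ℝ)} {a b : ℝ}

theorem norm_int₂_le_of_wt (hG : IsStaircase G a b) {k : ℝ × ℝ → V} {c M : ℝ} (hc : 0 < c)
    (hM : 0 ≤ M) (h : ∀ z ∈ G, ‖k z‖ ≤ M * wt c z) {z : ℝ × ℝ} (hz : z ∈ G) :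
    ‖int₂ k z‖ ≤ M / c * wt c z := by
  have h1 : ‖int₂ k z‖ ≤ ∫ τ in Icc 0 z.2, M * wt c (z.1, τ) := by
    refine norm_integral_le_of_norm_le ?_ ?_
    · exact (((continuous_wt c).comp (by fun_prop)).const_smul M).integrableOn_Icc
    · exact (ae_restrict_mem measurableSet_Icc).mono fun τ hτ => h _ (hG.vert_mem hz hτ)
  rw [integral_const_mul] at h1
  calc ‖int₂ k z‖ ≤ M * int₂ (wt c) z := h1
    _ ≤ M * (wt c z / c) := by gcongr; exact int₂_wt_le hc (hG.nonneg z hz).2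
    _ = _ := by ring

theorem norm_int₁_le_of_wt (hG : IsStaircase G a b) {k : ℝ × ℝ → V} {c M : ℝ} (hc : 0 < c)
    (hM : 0 ≤ M) (h : ∀ z ∈ G, ‖k z‖ ≤ M * wt c z) {z : ℝ × ℝ} (hz : z ∈ G) :
    ‖int₁ k z‖ ≤ M / c * wt c z := by
  have := norm_int₂_le_of_wt hG.swap (k := k ∘ Prod.swap) hc hM (fun w hw => ?_) (z := z.swap) hz
  · simpa [wt, add_comm] using! this
  · simpa [wt, add_comm] using! h _ hw

/-- Two integrations would give 1/c². For c ≥ 1 this is weakened to 1/c, so that the three operators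
share one bound. -/
theorem norm_int₁₂_le_of_wt (hG : IsStaircase G a b) {k : ℝ × ℝ → V} (hk : IsDensity G k)
    {c M : ℝ} (hc : 1 ≤ c)
    (hM : 0 ≤ M) (h : ∀ z ∈ G, ‖k z‖ ≤ M * wt c z) {z : ℝ × ℝ} (hz : z ∈ G) :
    ‖int₁₂ k z‖ ≤ M / c * wt c z := by
  have hc0 : 0 < c := by linarith
  rw [hk.int₁₂_eq hG]
  have := norm_int₁_le_of_wt hG hc0 (div_nonneg hM hc0.le)
    (fun w hw => norm_int₂_le_of_wt hG hc0 hM h hw) hz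
  refine this.trans ?_
  have := wt_pos c z
  gcongr
  exact div_le_self (by positivity) hc

theorem norm_int₂_le (hG : IsStaircase G a b) {k : ℝ × ℝ → V} {C : ℝ} (hC0 : 0 ≤ C)
    (hC : ∀ z ∈ G, ‖k z‖ ≤ C) {z : ℝ × ℝ} (hz : z ∈ G) : ‖int₂ k z‖ ≤ C * b := by
  have h := norm_setIntegral_le_of_norm_le_const (μ := volume) (s := Icc 0 z.2)
    (f := fun τ => k (z.1, τ)) measure_Icc_lt_top (fun τ hτ => hC _ (hG.vert_mem hz hτ))
  refine h.trans ?_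
  gcongr
  simp [(hG.nonneg z hz).2, (hG.le z hz).2]

theorem norm_int₁_le (hG : IsStaircase G a b) {k : ℝ × ℝ → V} {C : ℝ} (hC0 : 0 ≤ C)
    (hC : ∀ z ∈ G, ‖k z‖ ≤ C) {z : ℝ × ℝ} (hz : z ∈ G) : ‖int₁ k z‖ ≤ C * a :=
  norm_int₂_le hG.swap (k := k ∘ Prod.swap) hC0 (fun w hw => hC _ hw) (z := z.swap) hz

/-- The L¹ norm of the density controls the state uniformly; this is why the state varies by O(ε²)
while its derivatives vary only by O(ε). -/
theorem norm_int₁₂_le (hG : IsStaircase G a b) {k : ℝ × ℝ → V} (hk : IsDensity G k) (z : ℝ × ℝ) :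
    ‖int₁₂ k z‖ ≤ ∫ w, ‖k w‖ :=
  (norm_integral_le_integral_norm _).trans
    (setIntegral_le_integral (hk.integrable hG).norm (ae_of_all _ fun _ => norm_nonneg _))

theorem IsDensity.bdd_ops (hG : IsStaircase G a b) {k : ℝ × ℝ → V} (hk : IsDensity G k) :
    ∃ C, 0 ≤ C ∧ ∀ z ∈ G, ‖int₁₂ k z‖ ≤ C ∧ ‖int₂ k z‖ ≤ C ∧ ‖int₁ k z‖ ≤ C := by
  obtain ⟨C, h0, hC⟩ := hk.bdd
  refine ⟨max (∫ w, ‖k w‖) (max (C * b) (C * a)), ?_, fun z hz => ⟨?_, ?_, ?_⟩⟩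
  · exact le_max_of_le_left (integral_nonneg fun _ => norm_nonneg _)
  · exact le_max_of_le_left (norm_int₁₂_le hG hk z)
  · exact le_max_of_le_right (le_max_of_le_left (norm_int₂_le hG h0 (fun z _ => hC z) hz))
  · exact le_max_of_le_right (le_max_of_le_right (norm_int₁_le hG h0 (fun z _ => hC z) hz))

theorem int₁₂_sub (hG : IsStaircase G a b) {k k' : ℝ × ℝ → V} (hk : IsDensity G k)
    (hk' : IsDensity G k') (z : ℝ × ℝ) :
    int₁₂ (fun w => k w - k' w) z = int₁₂ k z - int₁₂ k' z :=
  integral_sub (hk.integrable hG).integrableOn (hk'.integrable hG).integrableOn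

theorem int₂_sub (hG : IsStaircase G a b) {k k' : ℝ × ℝ → V} (hk : IsDensity G k)
    (hk' : IsDensity G k') (z : ℝ × ℝ) :
    int₂ (fun w => k w - k' w) z = int₂ k z - int₂ k' z :=
  integral_sub (hk.integrable_section hG _).integrableOn (hk'.integrable_section hG _).integrableOn

theorem int₁_sub (hG : IsStaircase G a b) {k k' : ℝ × ℝ → V} (hk : IsDensity G k)
    (hk' : IsDensity G k') (z : ℝ × ℝ) :
    int₁ (fun w => k w - k' w) z = int₁ k z - int₁ k' z :=
  integral_sub (hk.integrable_section' hG _).integrableOn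
    (hk'.integrable_section' hG _).integrableOn

/-! ### Fixed points -/

/-- A map on densities which is a contraction for an exponential weight has a fixed point. -/
theorem exists_fixed_density [CompleteSpace V] (hG : IsStaircase G a b) {c : ℝ} (hc : 0 ≤ c)
    (T : (ℝ × ℝ → V) → ℝ × ℝ → V) (hT : ∀ k, IsDensity G k → IsDensity G (T k))
    (hcontr : ∀ k k', IsDensity G k → IsDensity G k' → ∀ M, 0 ≤ M →
      (∀ z ∈ G, ‖k z - k' z‖ ≤ M * wt c z) → ∀ z ∈ G, ‖T k z - T k' z‖ ≤ M / 2 * wt c z) :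
    ∃ k, IsDensity G k ∧ T k = k := by
  -- Picard iteration from zero, with limits taken at every point rather than in a function space:
  -- the limit remains strongly measurable, and the fixed point equation holds everywhere, not only
  -- almost everywhere, as the pointwise equations for x_s and x_t require.
  let κ : ℕ → ℝ × ℝ → V := fun j => T^[j] (fun _ => 0)
  have hκ : ∀ j, IsDensity G (κ j) := by
    intro j
    induction j with
    | zero => exact IsDensity.zero_density
    | succ j ih => simp only [κ, Function.iterate_succ', Function.comp] at ih ⊢; exact hT _ ih
  have hκs : ∀ j, κ (j + 1) = T (κ j) := fun j => by
    simp only [κ, Function.iterate_succ', Function.comp]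
  obtain ⟨C, h0, hC⟩ := (hκ 1).bdd
  have hw1 : ∀ z ∈ G, 1 ≤ wt c z := fun z hz => by
    rw [wt, Real.one_le_exp_iff]
    exact mul_nonneg hc (add_nonneg (hG.nonneg z hz).1 (hG.nonneg z hz).2)
  have step : ∀ j, ∀ z ∈ G, ‖κ (j + 1) z - κ j z‖ ≤ C / 2 ^ j * wt c z := by
    intro j
    induction j with
    | zero =>
      intro z hz
      have : κ 0 z = 0 := rfl
      rw [this, sub_zero, pow_zero, div_one]
      exact (hC z).trans (le_mul_of_one_le_right h0 (hw1 z hz))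
    | succ j ih =>
      intro z hz
      have := hcontr _ _ (hκ (j + 1)) (hκ j) _ (by positivity) ih z hz
      rw [hκs (j + 1), hκs j] at *
      refine this.trans (le_of_eq ?_)
      rw [pow_succ]; field_simp
  have hdist : ∀ z ∈ G, ∀ j, dist (κ j z) (κ (j + 1) z) ≤ (2 * C * wt c z) / 2 / 2 ^ j := by
    intro z hz j
    rw [dist_comm, dist_eq_norm]
    refine (step j z hz).trans (le_of_eq ?_)
    field_simp
  have hlim : ∀ z, ∃ l, Tendsto (fun j => κ j z) atTop (𝓝 l) := by
    intro z
    by_cases hz : z ∈ G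
    · exact cauchySeq_tendsto_of_complete (cauchySeq_of_le_geometric_two (hdist z hz))
    · exact ⟨0, by simp only [fun j => (hκ j).zero z hz]; exact tendsto_const_nhds⟩
  choose k hk using hlim
  have hkz : ∀ z ∉ G, k z = 0 := fun z hz => by
    refine tendsto_nhds_unique (hk z) ?_
    simp only [fun j => (hκ j).zero z hz]
    exact tendsto_const_nhds
  have hclose : ∀ j, ∀ z ∈ G, ‖κ j z - k z‖ ≤ 2 * C / 2 ^ j * wt c z := by
    intro j z hz
    have := dist_le_of_le_geometric_two_of_tendsto (hdist z hz) (hk z) j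
    rw [dist_eq_norm] at this
    refine this.trans (le_of_eq ?_)
    field_simp
  have hwb : ∀ z ∈ G, wt c z ≤ wt c (a, b) := fun z hz =>
    wt_mono hc (hG.le z hz).1 (hG.le z hz).2
  have hkd : IsDensity G k := by
    refine ⟨stronglyMeasurable_of_tendsto atTop (fun j => (hκ j).sm) (tendsto_pi_nhds.2 hk), hkz,
      2 * C * wt c (a, b), mul_nonneg (by positivity) (wt_pos _ _).le, fun z => ?_⟩
    by_cases hz : z ∈ G
    · have := hclose 0 z hz
      have h00 : κ 0 z = 0 := rfl
      rw [h00, zero_sub, norm_neg, pow_zero, div_one] at this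
      exact this.trans (by gcongr; exact hwb z hz)
    · rw [hkz z hz, norm_zero]
      exact mul_nonneg (by positivity) (wt_pos _ _).le
  -- Both sides are limits of the iterates: the shifted sequence tends to k, and by the contraction
  -- estimate it also tends to T k.
  refine ⟨k, hkd, funext fun z => ?_⟩
  by_cases hz : z ∈ G
  swap
  · rw [hkz z hz, (hT k hkd).zero z hz]
  refine tendsto_nhds_unique (f := fun j => κ (j + 1) z) (l := atTop) ?_
    ((tendsto_add_atTop_iff_nat 1).2 (hk z))
  rw [tendsto_iff_norm_sub_tendsto_zero]
  have hz0 : Tendsto (fun j : ℕ => 2 * C / 2 ^ j / 2 * wt c z) atTop (𝓝 0) := by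
    have h := (tendsto_pow_atTop_nhds_zero_of_lt_one (r := (1 / 2 : ℝ)) (by norm_num)
      (by norm_num)).const_mul (C * wt c z)
    rw [mul_zero] at h
    refine h.congr fun j => ?_
    rw [one_div, inv_pow]; field_simp
  refine squeeze_zero (fun _ => norm_nonneg _) (fun j => ?_) hz0
  rw [hκs]
  exact hcontr _ _ (hκ j) hkd _ (by positivity) (hclose j) z hz

end

end GoursatControl

namespace GoursatControl

noncomputable section

open Filter Topology

variable {V : Type*} [NormedAddCommGroup V] [NormedSpace ℝ V] {G G' : Set (ℝ × ℝ)} {a b a' b' : ℝ}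

/-! ### Monotonicity, comparison and uniqueness for Goursat integral inequalities -/

theorem norm_int₂_le_int₂_norm (k : ℝ × ℝ → V) (z : ℝ × ℝ) : ‖int₂ k z‖ ≤ int₂ (fun w => ‖k w‖) z :=
  norm_integral_le_integral_norm _

theorem norm_int₁_le_int₁_norm (k : ℝ × ℝ → V) (z : ℝ × ℝ) : ‖int₁ k z‖ ≤ int₁ (fun w => ‖k w‖) z :=
  norm_integral_le_integral_norm _

theorem norm_int₁₂_le_int₁₂_norm (k : ℝ × ℝ → V) (z : ℝ × ℝ) :
    ‖int₁₂ k z‖ ≤ int₁₂ (fun w => ‖k w‖) z :=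
  norm_integral_le_integral_norm _

theorem int₂_mono (hG : IsStaircase G a b) (hG' : IsStaircase G' a' b') {k k' : ℝ × ℝ → ℝ}
    (hk : IsDensity G k) (hk' : IsDensity G' k') (h : ∀ w, k w ≤ k' w) (z : ℝ × ℝ) :
    int₂ k z ≤ int₂ k' z :=
  integral_mono (hk.integrable_section hG _).integrableOn (hk'.integrable_section hG' _).integrableOn
    fun _ => h _

theorem int₁_mono (hG : IsStaircase G a b) (hG' : IsStaircase G' a' b') {k k' : ℝ × ℝ → ℝ}
    (hk : IsDensity G k) (hk' : IsDensity G' k') (h : ∀ w, k w ≤ k' w) (z : ℝ × ℝ) :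
    int₁ k z ≤ int₁ k' z :=
  integral_mono (hk.integrable_section' hG _).integrableOn
    (hk'.integrable_section' hG' _).integrableOn fun _ => h _

theorem int₁₂_mono (hG : IsStaircase G a b) (hG' : IsStaircase G' a' b') {k k' : ℝ × ℝ → ℝ}
    (hk : IsDensity G k) (hk' : IsDensity G' k') (h : ∀ w, k w ≤ k' w) (z : ℝ × ℝ) :
    int₁₂ k z ≤ int₁₂ k' z :=
  integral_mono (hk.integrable hG).integrableOn (hk'.integrable hG').integrableOn fun _ => h _

theorem IsDensity.mono {k : ℝ × ℝ → V} (hk : IsDensity G k) (h : G ⊆ G') : IsDensity G' k :=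
  ⟨hk.sm, fun z hz => hk.zero z fun h' => hz (h h'), hk.bdd⟩

/-- Comparison with a supersolution for the Goursat integral inequality. -/
theorem le_of_supersolution (hG : IsStaircase G a b) (hG' : IsStaircase G' a' b') (hGG : G ⊆ G')
    {k : ℝ × ℝ → V} (hk : IsDensity G k) {K : ℝ} (hK : 0 ≤ K) {g κ : ℝ × ℝ → ℝ}
    (hκ : IsDensity G' κ) (hκ0 : ∀ z, 0 ≤ κ z)
    (hle : ∀ z ∈ G, ‖k z‖ ≤ K * (‖int₁₂ k z‖ + ‖int₂ k z‖ + ‖int₁ k z‖) + g z)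
    (hsup : ∀ z ∈ G, K * (int₁₂ κ z + int₂ κ z + int₁ κ z) + g z ≤ κ z) (z : ℝ × ℝ) :
    ‖k z‖ ≤ κ z := by
  -- The excess over the supersolution satisfies the homogeneous inequality v ≤ K (sum of the three
  -- integrals of v) on G. It vanishes off G because k does and κ ≥ 0, although κ may live on the
  -- larger region G'.
  let v : ℝ × ℝ → ℝ := fun z => max (‖k z‖ - κ z) 0
  have hv : IsDensity G v := by
    obtain ⟨C, h0, hC⟩ := hk.bdd
    refine ⟨(hk.sm.norm.sub hκ.sm).sup stronglyMeasurable_const, fun z hz => ?_, C, h0, fun z => ?_⟩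
    · simp only [v, hk.zero z hz, norm_zero, zero_sub]
      exact max_eq_right (neg_nonpos.2 (hκ0 z))
    · rw [Real.norm_of_nonneg (le_max_right _ _)]
      exact max_le (by linarith [hC z, hκ0 z]) h0
  have hkn := hk.norm.mono hGG
  have hlev : ∀ z, ‖k z‖ - κ z ≤ v z := fun z => le_max_left _ _
  have h2 : ∀ z, ‖int₂ k z‖ ≤ int₂ κ z + int₂ v z := fun z => by
    have := int₂_mono hG' hG (hkn.sub hκ) hv hlev z
    rw [int₂_sub hG' hkn hκ] at this
    linarith [norm_int₂_le_int₂_norm k z]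
  have h1 : ∀ z, ‖int₁ k z‖ ≤ int₁ κ z + int₁ v z := fun z => by
    have := int₁_mono hG' hG (hkn.sub hκ) hv hlev z
    rw [int₁_sub hG' hkn hκ] at this
    linarith [norm_int₁_le_int₁_norm k z]
  have h12 : ∀ z, ‖int₁₂ k z‖ ≤ int₁₂ κ z + int₁₂ v z := fun z => by
    have := int₁₂_mono hG' hG (hkn.sub hκ) hv hlev z
    rw [int₁₂_sub hG' hkn hκ] at this
    linarith [norm_int₁₂_le_int₁₂_norm k z]
  -- Three operators, each with gain 1/c, give the factor 3K/c ≤ 1/2; iterating the inequality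
  -- halves the weighted bound each time and forces the excess to be zero.
  let c := max 1 (6 * K)
  have hc1 : 1 ≤ c := le_max_left _ _
  have hcK : 6 * K ≤ c := le_max_right _ _
  have hc0 : 0 < c := by linarith
  obtain ⟨C, hC0, hC⟩ := hv.bdd
  have key : ∀ j : ℕ, ∀ z ∈ G, ‖v z‖ ≤ C / 2 ^ j * wt c z := by
    intro j
    induction j with
    | zero =>
      intro z hz
      rw [pow_zero, div_one]
      refine (hC z).trans (le_mul_of_one_le_right hC0 ?_)
      rw [wt, Real.one_le_exp_iff]
      exact mul_nonneg hc0.le (add_nonneg (hG.nonneg z hz).1 (hG.nonneg z hz).2)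
    | succ j ih =>
      intro z hz
      have hM : 0 ≤ C / 2 ^ j := by positivity
      have e2 := (le_abs_self _).trans (norm_int₂_le_of_wt hG hc0 hM ih hz)
      have e1 := (le_abs_self _).trans (norm_int₁_le_of_wt hG hc0 hM ih hz)
      have e12 := (le_abs_self _).trans (norm_int₁₂_le_of_wt hG hv hc1 hM ih hz)
      have hw := wt_pos c z
      set X := C / 2 ^ j / c * wt c z with hX
      have hX0 : 0 ≤ X := by positivity
      have hb : K * (int₁₂ v z + int₂ v z + int₁ v z) ≤ C / 2 ^ (j + 1) * wt c z := by
        have : K * (int₁₂ v z + int₂ v z + int₁ v z) ≤ K * (3 * X) := by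
          gcongr; linarith
        have h6 : K * (3 * X) ≤ c / 6 * (3 * X) := by gcongr; linarith
        have : c / 6 * (3 * X) = C / 2 ^ (j + 1) * wt c z := by
          rw [hX, pow_succ]; field_simp; ring
        linarith
      rw [Real.norm_of_nonneg (le_max_right _ _)]
      refine max_le ?_ (by positivity)
      have hmul : K * (‖int₁₂ k z‖ + ‖int₂ k z‖ + ‖int₁ k z‖) ≤
          K * ((int₁₂ κ z + int₂ κ z + int₁ κ z) + (int₁₂ v z + int₂ v z + int₁ v z)) := by
        exact mul_le_mul_of_nonneg_left (by linarith [h2 z, h1 z, h12 z]) hK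
      rw [mul_add] at hmul
      linarith [hle z hz, hsup z hz]
  by_cases hz : z ∈ G
  · have hlim : Tendsto (fun j : ℕ => C / 2 ^ j * wt c z) atTop (𝓝 0) := by
      have h := (tendsto_pow_atTop_nhds_zero_of_lt_one (r := (1 / 2 : ℝ)) (by norm_num)
        (by norm_num)).const_mul (C * wt c z)
      rw [mul_zero] at h
      refine h.congr fun j => ?_
      rw [one_div, inv_pow]; field_simp
    have := ge_of_tendsto' hlim fun j => (le_abs_self _).trans (key j z hz)
    linarith [hlev z]
  · rw [hk.zero z hz, norm_zero]; exact hκ0 z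

/-- Uniqueness for the linear Goursat problem. -/
theorem density_eq_zero (hG : IsStaircase G a b) {k : ℝ × ℝ → V} (hk : IsDensity G k) {K : ℝ}
    (hK : 0 ≤ K) (hle : ∀ z ∈ G, ‖k z‖ ≤ K * (‖int₁₂ k z‖ + ‖int₂ k z‖ + ‖int₁ k z‖))
    (z : ℝ × ℝ) : k z = 0 := by
  rw [← norm_le_zero_iff]
  refine le_of_supersolution hG hG subset_rfl hk hK (g := fun _ => 0) (κ := fun _ => 0)
    IsDensity.zero_density (fun _ => le_rfl) (fun z hz => by simpa using hle z hz) (fun z hz => ?_) z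
  simp [int₁, int₂, int₁₂]

/-! ### Estimates for a source concentrated on a small square -/

/-- On T the weight is replaced by its value at the upper end, giving the measure ε of T; against
the constant y the weight is integrated exactly, giving 1/c. These two gains are all that the needle
estimates use. -/
theorem integral_strip_le {c : ℝ} (hc : 0 < c) {T : Set ℝ} (hT : MeasurableSet T) {ε : ℝ}
    (hε : 0 ≤ ε) (hTε : volume T ≤ ENNReal.ofReal ε) {x y s t : ℝ} (hx : 0 ≤ x) (hy : 0 ≤ y)
    (ht : 0 ≤ t) :
    ∫ τ in Icc 0 t, wt c (s, τ) * (x * T.indicator (fun _ => 1) τ + y) ≤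
      wt c (s, t) * (x * ε + y / c) := by
  have hcont : Continuous fun τ => wt c (s, τ) := (continuous_wt c).comp (by fun_prop)
  have hTfin : volume T ≠ ⊤ := (hTε.trans_lt ENNReal.ofReal_lt_top).ne
  have hind : Integrable (T.indicator (fun _ : ℝ => (1 : ℝ))) :=
    (integrable_indicator_iff hT).2 (integrableOn_const hTfin)
  have hi1 : IntegrableOn (fun τ => wt c (s, t) * (x * T.indicator (fun _ => 1) τ)) (Icc 0 t) :=
    ((hind.const_mul x).const_mul _).integrableOn
  have hi2 : IntegrableOn (fun τ => y * wt c (s, τ)) (Icc 0 t) :=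
    (hcont.const_smul y).integrableOn_Icc
  have hle : ∀ τ ∈ Icc 0 t, wt c (s, τ) * (x * T.indicator (fun _ => 1) τ + y) ≤
      wt c (s, t) * (x * T.indicator (fun _ => 1) τ) + y * wt c (s, τ) := by
    intro τ hτ
    have : wt c (s, τ) ≤ wt c (s, t) := wt_mono hc.le le_rfl hτ.2
    have h1 : 0 ≤ x * T.indicator (fun _ => (1 : ℝ)) τ :=
      mul_nonneg hx (indicator_nonneg (fun _ _ => zero_le_one) _)
    nlinarith
  have hlhs : IntegrableOn (fun τ => wt c (s, τ) * (x * T.indicator (fun _ => 1) τ + y))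
      (Icc 0 t) := by
    refine Integrable.mono' (hi1.add hi2) ?_ ?_
    · exact (hcont.measurable.mul (((measurable_const.indicator hT).const_mul x).add_const
        y)).aestronglyMeasurable
    · refine (ae_restrict_mem measurableSet_Icc).mono fun τ hτ => ?_
      rw [Real.norm_of_nonneg]
      · exact hle τ hτ
      · exact mul_nonneg (wt_pos _ _).le (add_nonneg
          (mul_nonneg hx (indicator_nonneg (fun _ _ => zero_le_one) _)) hy)
  refine (setIntegral_mono_on hlhs (hi1.add hi2) measurableSet_Icc hle).trans ?_
  have hadd : ∫ τ in Icc 0 t, (wt c (s, t) * (x * T.indicator (fun _ => 1) τ) + y * wt c (s, τ)) =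
      wt c (s, t) * (x * ∫ τ in Icc 0 t, T.indicator (fun _ => (1 : ℝ)) τ) +
        y * int₂ (wt c) (s, t) := by
    have := integral_add hi1 hi2
    simpa only [integral_const_mul, int₂] using this
  refine hadd.le.trans ?_
  have h1 : ∫ τ in Icc 0 t, T.indicator (fun _ => (1 : ℝ)) τ ≤ ε := by
    refine (setIntegral_le_integral hind (ae_of_all _ fun τ =>
      indicator_nonneg (fun _ _ => zero_le_one) _)).trans ?_
    rw [integral_indicator hT, setIntegral_const, smul_eq_mul, mul_one]
    exact ENNReal.toReal_le_of_le_ofReal hε hTε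
  have h2 := int₂_wt_le hc (z := (s, t)) ht
  have hw := wt_pos c (s, t)
  calc _ ≤ wt c (s, t) * (x * ε) + y * (wt c (s, t) / c) := by gcongr
    _ = _ := by ring

/-- The supersolution used for sources concentrated on the square `S × T`. -/
def needleBound (c A B D ε : ℝ) (S T : Set ℝ) (z : ℝ × ℝ) : ℝ :=
  wt c z * ((A * S.indicator (fun _ => 1) z.1 + B * ε) * T.indicator (fun _ => 1) z.2 +
    (B * ε * S.indicator (fun _ => 1) z.1 + D * ε ^ 2))

theorem needleBound_swap (c A B D ε : ℝ) (S T : Set ℝ) (z : ℝ × ℝ) :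
    needleBound c A B D ε S T z.swap = needleBound c A B D ε T S z := by
  simp only [needleBound, wt, Prod.fst_swap, Prod.snd_swap]
  rw [add_comm z.2 z.1]; ring

section needle

variable {c A B D ε : ℝ} {S T : Set ℝ}

theorem isDensity_needleBound (hc : 0 < c) (hS : MeasurableSet S) (hT : MeasurableSet T)
    (hA : 0 ≤ A) (hB : 0 ≤ B) (hD : 0 ≤ D) (hε : 0 ≤ ε) (a b : ℝ) :
    IsDensity (W (a, b)) ((W (a, b)).indicator (needleBound c A B D ε S T)) := by
  refine IsDensity.of_indicator (measurableSet_W _) ?_ ?_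
  · refine Measurable.stronglyMeasurable ?_
    have h1 : Measurable fun z : ℝ × ℝ => S.indicator (fun _ => (1 : ℝ)) z.1 :=
      (measurable_const.indicator hS).comp measurable_fst
    have h2 : Measurable fun z : ℝ × ℝ => T.indicator (fun _ => (1 : ℝ)) z.2 :=
      (measurable_const.indicator hT).comp measurable_snd
    exact (continuous_wt c).measurable.mul ((((h1.const_mul A).add_const _).mul h2).add
      ((h1.const_mul _).add_const _))
  · refine ⟨wt c (a, b) * ((A * 1 + B * ε) * 1 + (B * ε * 1 + D * ε ^ 2)), fun z hz => ?_⟩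
    have i0 : ∀ (S : Set ℝ) x, 0 ≤ S.indicator (fun _ => (1 : ℝ)) x := fun S x =>
      indicator_nonneg (fun _ _ => zero_le_one) _
    have i1 : ∀ (S : Set ℝ) x, S.indicator (fun _ => (1 : ℝ)) x ≤ 1 := fun S x =>
      indicator_le_self' (fun _ _ => zero_le_one) _
    have hS0 := i0 S z.1
    have hT0 := i0 T z.2
    have hw := (wt_pos c z).le
    rw [needleBound, Real.norm_of_nonneg (by positivity)]
    have := i1 S z.1
    have := i1 T z.2
    have := wt_mono hc.le hz.1.2 hz.2.2
    have := (wt_pos c (a, b)).le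
    gcongr

/-- `needleBound` is grouped as x · 1_T + y with x and y independent of the second variable, so the
strip estimate applies on each vertical line: terms carrying 1_T gain ε, the others gain 1/c. -/
theorem int₂_needleBound_le (hc : 0 < c) (hS : MeasurableSet S) (hT : MeasurableSet T)
    (hA : 0 ≤ A) (hB : 0 ≤ B) (hD : 0 ≤ D) (hε : 0 ≤ ε)
    (hTε : volume T ≤ ENNReal.ofReal ε) {z : ℝ × ℝ} (hz : z ∈ W (a, b)) :
    int₂ ((W (a, b)).indicator (needleBound c A B D ε S T)) z ≤
      wt c z * ((A + B / c) * ε * S.indicator (fun _ => 1) z.1 + (B + D / c) * ε ^ 2) := by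
  have i0 : 0 ≤ S.indicator (fun _ => (1 : ℝ)) z.1 := indicator_nonneg (fun _ _ => zero_le_one) _
  have h := integral_strip_le hc hT hε hTε (s := z.1) (t := z.2)
    (x := A * S.indicator (fun _ => 1) z.1 + B * ε)
    (y := B * ε * S.indicator (fun _ => 1) z.1 + D * ε ^ 2)
    (by positivity) (by positivity) hz.2.1
  refine le_trans (le_of_eq ?_) (h.trans (le_of_eq ?_))
  · refine setIntegral_congr_fun measurableSet_Icc fun τ hτ => ?_
    have : (z.1, τ) ∈ W (a, b) := ⟨hz.1, hτ.1, hτ.2.trans hz.2.2⟩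
    simp only [indicator_of_mem this, needleBound]
  · ring

theorem int₁_needleBound_le (hc : 0 < c) (hS : MeasurableSet S) (hT : MeasurableSet T)
    (hA : 0 ≤ A) (hB : 0 ≤ B) (hD : 0 ≤ D) (hε : 0 ≤ ε)
    (hSε : volume S ≤ ENNReal.ofReal ε) {z : ℝ × ℝ} (hz : z ∈ W (a, b)) :
    int₁ ((W (a, b)).indicator (needleBound c A B D ε S T)) z ≤
      wt c z * ((A + B / c) * ε * T.indicator (fun _ => 1) z.2 + (B + D / c) * ε ^ 2) := by
  have h := int₂_needleBound_le hc hT hS hA hB hD hε hSε (z := z.swap) (a := b) (b := a)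
    ⟨hz.2, hz.1⟩
  have hw : wt c z.swap = wt c z := by simp [wt, add_comm]
  rw [hw] at h
  refine le_trans (le_of_eq ?_) h
  refine setIntegral_congr_fun measurableSet_Icc fun σ hσ => ?_
  have h1 : (σ, z.2) ∈ W (a, b) := ⟨⟨hσ.1, hσ.2.trans hz.1.2⟩, hz.2⟩
  have h2 : (z.2, σ) ∈ W (b, a) := ⟨h1.2, h1.1⟩
  simp only [indicator_of_mem h1, Prod.fst_swap, indicator_of_mem h2]
  exact (needleBound_swap c A B D ε T S (σ, z.2)).symm

theorem isStaircase_W {a b : ℝ} (ha : 0 ≤ a) (hb : 0 ≤ b) : IsStaircase (W (a, b)) a b where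
  measurableSet := measurableSet_W _
  nonneg z hz := ⟨hz.1.1, hz.2.1⟩
  le z hz := ⟨hz.1.2, hz.2.2⟩
  lower z hz w hw := ⟨⟨hw.1.1, hw.1.2.trans hz.1.2⟩, ⟨hw.2.1, hw.2.2.trans hz.2.2⟩⟩

/-- The strip estimate is applied once more, now in the horizontal direction, to the bound for
`int₂`. Every term has then collected ε². -/
theorem int₁₂_needleBound_le (hc : 0 < c) (hS : MeasurableSet S) (hT : MeasurableSet T)
    (hA : 0 ≤ A) (hB : 0 ≤ B) (hD : 0 ≤ D) (hε : 0 ≤ ε)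
    (hSε : volume S ≤ ENNReal.ofReal ε) (hTε : volume T ≤ ENNReal.ofReal ε)
    {z : ℝ × ℝ} (hz : z ∈ W (a, b)) :
    int₁₂ ((W (a, b)).indicator (needleBound c A B D ε S T)) z ≤
      wt c z * (((A + B / c) + (B + D / c) / c) * ε ^ 2) := by
  have hG := isStaircase_W (hz.1.1.trans hz.1.2) (hz.2.1.trans hz.2.2)
  have hd := isDensity_needleBound hc hS hT hA hB hD hε a b
  rw [hd.int₁₂_eq hG]
  have h := integral_strip_le hc hS hε hSε (s := z.2) (t := z.1)
    (x := (A + B / c) * ε) (y := (B + D / c) * ε ^ 2)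
    (by positivity) (by positivity) hz.1.1
  have hw : ∀ σ, wt c (z.2, σ) = wt c (σ, z.2) := fun σ => by simp [wt, add_comm]
  simp only [hw] at h
  refine le_trans ?_ (h.trans (le_of_eq ?_))
  · have hi1 : IntegrableOn (fun σ => int₂ ((W (a, b)).indicator (needleBound c A B D ε S T))
        (σ, z.2)) (Icc 0 z.1) := by
      obtain ⟨C, hC0, hC⟩ := hd.bdd_ops hG
      refine Measure.integrableOn_of_bounded (M := C) measure_Icc_lt_top.ne
        (hd.sm_int₂.comp_measurable measurable_prodMk_right).aestronglyMeasurable ?_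
      refine (ae_restrict_mem measurableSet_Icc).mono fun σ hσ => (hC _ ?_).2.1
      exact ⟨⟨hσ.1, hσ.2.trans hz.1.2⟩, hz.2⟩
    refine setIntegral_mono_on hi1 ?_ measurableSet_Icc fun σ hσ => ?_
    · have hm : Measurable fun σ => wt c (σ, z.2) *
          ((A + B / c) * ε * S.indicator (fun _ => 1) σ + (B + D / c) * ε ^ 2) :=
        ((continuous_wt c).measurable.comp (by fun_prop)).mul
          (((measurable_const.indicator hS).const_mul _).add_const _)
      refine Measure.integrableOn_of_bounded
        (M := wt c z * ((A + B / c) * ε * 1 + (B + D / c) * ε ^ 2)) measure_Icc_lt_top.ne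
        hm.aestronglyMeasurable ?_
      refine (ae_restrict_mem measurableSet_Icc).mono fun σ hσ => ?_
      have i0 : 0 ≤ S.indicator (fun _ => (1 : ℝ)) σ := indicator_nonneg (fun _ _ => zero_le_one) _
      have i1 : S.indicator (fun _ => (1 : ℝ)) σ ≤ 1 :=
        indicator_le_self' (fun _ _ => zero_le_one) _
      have := (wt_pos c (σ, z.2)).le
      have := wt_mono hc.le (z := z) (w := (σ, z.2)) hσ.2 le_rfl
      have := (wt_pos c z).le
      rw [Real.norm_of_nonneg (by positivity)]
      gcongr
    · exact int₂_needleBound_le hc hS hT hA hB hD hε hTε ⟨⟨hσ.1, hσ.2.trans hz.1.2⟩, hz.2⟩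
  · simp only [Prod.mk.eta]; ring

end needle

/-- A solution of the Goursat integral inequality with a bounded source on a square of side `ε`
has size `O(ε)`, and its mixed derivative has integral `O(ε²)`. -/
theorem exists_needle_estimate (ha : 0 ≤ a) (hb : 0 ≤ b) (hG : IsStaircase G a b) {K C : ℝ}
    (hK : 0 ≤ K) (hC : 0 ≤ C) :
    ∃ C', 0 ≤ C' ∧ ∀ ε, 0 ≤ ε → ε ≤ 1 → ∀ S T : Set ℝ, MeasurableSet S → MeasurableSet T →
      volume S ≤ ENNReal.ofReal ε → volume T ≤ ENNReal.ofReal ε →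
      ∀ k : ℝ × ℝ → V, IsDensity G k →
      (∀ z ∈ G, ‖k z‖ ≤ K * (‖int₁₂ k z‖ + ‖int₂ k z‖ + ‖int₁ k z‖) +
        (S ×ˢ T).indicator (fun _ => C) z) →
      (∀ z ∈ G, ‖int₁₂ k z‖ ≤ C' * ε ∧ ‖int₂ k z‖ ≤ C' * ε ∧ ‖int₁ k z‖ ≤ C' * ε) ∧
      ∫ z, ‖k z‖ ≤ C' * ε ^ 2 := by
  set c := max 1 (6 * K) with hcdef
  have hc1 : 1 ≤ c := le_max_left _ _
  have hcK : 6 * K ≤ c := le_max_right _ _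
  have hc0 : 0 < c := by linarith
  -- B and D are chosen so that `needleBound` is a supersolution. Half of B absorbs what the source
  -- C on the square sends into the strips, half of D what square and strips send elsewhere; the
  -- other halves absorb the feedback, which is small because K/c ≤ 1/6.
  set B := 2 * K * C with hBdef
  have hB : 0 ≤ B := by positivity
  set D := 2 * K * (4 * B + C) with hDdef
  have hD : 0 ≤ D := by positivity
  have hw1 : ∀ z ∈ G, 1 ≤ wt c z := fun z hz => by
    rw [wt, Real.one_le_exp_iff]
    exact mul_nonneg hc0.le (add_nonneg (hG.nonneg z hz).1 (hG.nonneg z hz).2)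
  have hwab := wt_pos c (a, b)
  have hKc : K / c ≤ 1 / 6 := by rw [div_le_iff₀ hc0]; linarith
  refine ⟨wt c (a, b) * ((C + B / c) + (B + D / c)), by positivity, ?_⟩
  intro ε hε0 hε1 S T hS hT hSε hTε k hk hle
  set κ := (W (a, b)).indicator (needleBound c C B D ε S T) with hκdef
  have hκ : IsDensity (W (a, b)) κ := isDensity_needleBound hc0 hS hT hC hB hD hε0 a b
  have hGW : G ⊆ W (a, b) := hG.subset
  have hW := isStaircase_W ha hb
  have i0 : ∀ (S : Set ℝ) x, 0 ≤ S.indicator (fun _ => (1 : ℝ)) x := fun S x =>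
    indicator_nonneg (fun _ _ => zero_le_one) _
  have i1 : ∀ (S : Set ℝ) x, S.indicator (fun _ => (1 : ℝ)) x ≤ 1 := fun S x =>
    indicator_le_self' (fun _ _ => zero_le_one) _
  have hκ0 : ∀ z, 0 ≤ κ z := fun z => by
    refine indicator_nonneg (fun z _ => ?_) z
    have := i0 S z.1
    have := i0 T z.2
    have := (wt_pos c z).le
    rw [needleBound]; positivity
  have e2 := fun z (hz : z ∈ G) => int₂_needleBound_le hc0 hS hT hC hB hD hε0 hTε (hGW hz)
  have e1 := fun z (hz : z ∈ G) => int₁_needleBound_le hc0 hS hT hC hB hD hε0 hSε (hGW hz)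
  have e12 := fun z (hz : z ∈ W (a, b)) =>
    int₁₂_needleBound_le hc0 hS hT hC hB hD hε0 hSε hTε hz
  have hkκ : ∀ z, ‖k z‖ ≤ κ z := by
    refine le_of_supersolution hG hW hGW hk hK hκ hκ0 hle fun z hz => ?_
    have E2 := e2 z hz
    have E1 := e1 z hz
    have E12 := e12 z (hGW hz)
    rw [← hκdef] at E1 E2 E12
    have hind : (S ×ˢ T).indicator (fun _ => C) z =
        C * S.indicator (fun _ => 1) z.1 * T.indicator (fun _ => 1) z.2 := by
      by_cases h1 : z.1 ∈ S <;> by_cases h2 : z.2 ∈ T <;> simp [indicator, h1, h2]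
    rw [hind, hκdef, indicator_of_mem (hGW hz), needleBound]
    have hS0 := i0 S z.1
    have hT0 := i0 T z.2
    set x := S.indicator (fun _ => (1 : ℝ)) z.1
    set y := T.indicator (fun _ => (1 : ℝ)) z.2
    have hw := wt_pos c z
    have hsum : K * (int₁₂ κ z + int₂ κ z + int₁ κ z) ≤ wt c z *
        (K * (((C + B / c) + (B + D / c) / c) * ε ^ 2 + ((C + B / c) * ε * x + (B + D / c) * ε ^ 2) +
          ((C + B / c) * ε * y + (B + D / c) * ε ^ 2))) := by
      calc _ ≤ K * (wt c z * (((C + B / c) + (B + D / c) / c) * ε ^ 2) +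
            wt c z * ((C + B / c) * ε * x + (B + D / c) * ε ^ 2) +
            wt c z * ((C + B / c) * ε * y + (B + D / c) * ε ^ 2)) := by gcongr
        _ = _ := by ring
    have hCQ : C * x * y ≤ wt c z * (C * x * y) :=
      le_mul_of_one_le_left (by positivity) (hw1 z hz)
    have hBineq : K * (C + B / c) ≤ B := by
      have : K * (C + B / c) = K * C + (K / c) * B := by ring
      rw [this]
      have : K / c * B ≤ 1 / 6 * B := by gcongr
      have : K * C = B / 2 := by rw [hBdef]; ring
      linarith
    have hDineq : K * (((C + B / c) + (B + D / c) / c) + 2 * (B + D / c)) ≤ D := by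
      have hBc : B / c ≤ B := div_le_self hB hc1
      have hDc : D / c / c ≤ D / c := div_le_self (by positivity) hc1
      have : K * (((C + B / c) + (B + D / c) / c) + 2 * (B + D / c)) ≤
          K * (4 * B + C + 3 * (D / c)) := by
        refine mul_le_mul_of_nonneg_left ?_ hK
        rw [add_div]; linarith
      have h' : K * (4 * B + C + 3 * (D / c)) = D / 2 + 3 * ((K / c) * D) := by
        rw [hDdef]; ring
      have : K / c * D ≤ 1 / 6 * D := by gcongr
      linarith
    have hmain : K * (((C + B / c) + (B + D / c) / c) * ε ^ 2 +
        ((C + B / c) * ε * x + (B + D / c) * ε ^ 2) +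
          ((C + B / c) * ε * y + (B + D / c) * ε ^ 2)) + C * x * y ≤
        (C * x + B * ε) * y + (B * ε * x + D * ε ^ 2) := by
      have t1 := mul_le_mul_of_nonneg_right hBineq (mul_nonneg hε0 hS0)
      have t2 := mul_le_mul_of_nonneg_right hBineq (mul_nonneg hε0 hT0)
      have t3 := mul_le_mul_of_nonneg_right hDineq (sq_nonneg ε)
      linarith
    have := mul_le_mul_of_nonneg_left hmain hw.le
    rw [mul_add] at this
    linarith
  have hwle : ∀ z ∈ G, wt c z ≤ wt c (a, b) := fun z hz =>
    wt_mono hc0.le (hG.le z hz).1 (hG.le z hz).2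
  have hε2 : ε ^ 2 ≤ ε := by nlinarith
  have hBD : 0 ≤ B + D / c := by positivity
  have hCB : 0 ≤ C + B / c := by positivity
  have fin : ∀ z ∈ G, ∀ S : Set ℝ, ∀ x, wt c z * ((C + B / c) * ε * S.indicator (fun _ => 1) x +
      (B + D / c) * ε ^ 2) ≤ wt c (a, b) * ((C + B / c) + (B + D / c)) * ε := by
    intro z hz S x
    have h1 := i1 S x
    have h0 := i0 S x
    have : (C + B / c) * ε * S.indicator (fun _ => 1) x + (B + D / c) * ε ^ 2 ≤
        ((C + B / c) + (B + D / c)) * ε := by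
      have : (C + B / c) * ε * S.indicator (fun _ => 1) x ≤ (C + B / c) * ε * 1 := by gcongr
      have : (B + D / c) * ε ^ 2 ≤ (B + D / c) * ε := by gcongr
      linarith
    calc _ ≤ wt c (a, b) * (((C + B / c) + (B + D / c)) * ε) := by
          have := hwle z hz
          gcongr
      _ = _ := by ring
  -- The integral of κ is its double integral at the corner (a, b), where square, strips and
  -- remainder each contribute O(ε²).
  have hI : ∫ z, ‖k z‖ ≤ wt c (a, b) * ((C + B / c) + (B + D / c)) * ε ^ 2 := by
    have hab : (a, b) ∈ W (a, b) := ⟨⟨ha, le_rfl⟩, ⟨hb, le_rfl⟩⟩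
    have h1 : ∫ z, ‖k z‖ ≤ ∫ z, κ z := integral_mono (hk.integrable hG).norm (hκ.integrable hW) hkκ
    have h2 : ∫ z, κ z = int₁₂ κ (a, b) := by
      rw [int₁₂, hκdef, integral_indicator (measurableSet_W _)]
      exact setIntegral_congr_fun (measurableSet_W _) fun z hz => (indicator_of_mem hz _).symm
    rw [h2] at h1
    refine h1.trans ((e12 _ hab).trans ?_)
    rw [mul_assoc]
    gcongr
    exact div_le_self hBD hc1
  refine ⟨fun z hz => ⟨?_, ?_, ?_⟩, hI⟩
  · refine (norm_int₁₂_le hG hk z).trans (hI.trans ?_)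
    gcongr
  · exact (norm_int₂_le_int₂_norm k z).trans ((int₂_mono hG hW hk.norm hκ hkκ z).trans
      ((e2 z hz).trans (fin z hz _ _)))
  · exact (norm_int₁_le_int₁_norm k z).trans ((int₁_mono hG hW hk.norm hκ hkκ z).trans
      ((e1 z hz).trans (fin z hz _ _)))

end

end GoursatControl

namespace GoursatControl

noncomputable section

open Filter Topology

/-! ### The representation of solutions by the Riemann function -/

variable {E : Type*} [NormedAddCommGroup E] [NormedSpace ℝ E] {G : Set (ℝ × ℝ)} {a b : ℝ}

/-- A bounded strongly measurable function of `(z, w)`, zero unless `z ∈ G` and `w ∈ W z`. -/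
structure IsKernel (G : Set (ℝ × ℝ)) {F : Type*} [NormedAddCommGroup F]
    (r : (ℝ × ℝ) × (ℝ × ℝ) → F) : Prop where
  sm : StronglyMeasurable r
  zero : ∀ z w, ¬ (z ∈ G ∧ w ∈ W z) → r (z, w) = 0
  bdd : ∃ C, ∀ p, ‖r p‖ ≤ C

/-- `f_x r + f_p r_s + f_q r_t` for vector-valued fields. -/
def linField (A B C : ℝ × ℝ → E →L[ℝ] E) (r rs rt : (ℝ × ℝ) × (ℝ × ℝ) → E)
    (p : (ℝ × ℝ) × (ℝ × ℝ)) : E :=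
  A p.1 (r p) + B p.1 (rs p) + C p.1 (rt p)

/-- The fields `R h`, `R_s h`, `R_t h` obtained by applying the Riemann function and its
derivatives to a source `h`. -/
structure IsRiemannField (G : Set (ℝ × ℝ)) (A B C : ℝ × ℝ → E →L[ℝ] E) (h : ℝ × ℝ → E)
    (r rs rt : (ℝ × ℝ) × (ℝ × ℝ) → E) : Prop where
  A_density : IsDensity G A
  B_density : IsDensity G B
  C_density : IsDensity G C
  h_density : IsDensity G h
  r_kernel : IsKernel G r
  rs_kernel : IsKernel G rs
  rt_kernel : IsKernel G rt
  rs_eq : ∀ z ∈ G, ∀ w ∈ W z, rs (z, w) = C (z.1, w.2) (r ((z.1, w.2), w)) +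
    ∫ τ in Icc 0 z.2, linField A B C r rs rt ((z.1, τ), w)
  rt_eq : ∀ z ∈ G, ∀ w ∈ W z, rt (z, w) = B (w.1, z.2) (r ((w.1, z.2), w)) +
    ∫ σ in Icc 0 z.1, linField A B C r rs rt ((σ, z.2), w)
  r_vert : ∀ z ∈ G, ∀ τ ∈ Icc 0 z.2, r (z, (z.1, τ)) = h (z.1, τ) +
    ∫ v in Icc 0 z.2, B (z.1, v) (r ((z.1, v), (z.1, τ)))
  r_horiz : ∀ z ∈ G, ∀ σ ∈ Icc 0 z.1, r (z, (σ, z.2)) = h (σ, z.2) +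
    ∫ v in Icc 0 z.1, C (v, z.2) (r ((v, z.2), (σ, z.2)))

theorem stronglyMeasurable_clm_apply {α F F' : Type*} [MeasurableSpace α] [NormedAddCommGroup F]
    [NormedSpace ℝ F] [NormedAddCommGroup F'] [NormedSpace ℝ F'] {A : α → F →L[ℝ] F'} {f : α → F}
    (hA : StronglyMeasurable A) (hf : StronglyMeasurable f) :
    StronglyMeasurable fun x => A x (f x) :=
  isBoundedBilinearMap_apply.continuous.comp_stronglyMeasurable (hA.prodMk hf)

namespace IsKernel

variable {F F' : Type*} [NormedAddCommGroup F] [NormedSpace ℝ F] [NormedAddCommGroup F']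
  [NormedSpace ℝ F'] {r r' : (ℝ × ℝ) × (ℝ × ℝ) → F}

theorem add (hr : IsKernel G r) (hr' : IsKernel G r') : IsKernel G (fun p => r p + r' p) := by
  obtain ⟨C, hC⟩ := hr.bdd
  obtain ⟨C', hC'⟩ := hr'.bdd
  exact ⟨hr.sm.add hr'.sm, fun z w hzw => by simp [hr.zero z w hzw, hr'.zero z w hzw], C + C',
    fun p => (norm_add_le _ _).trans (add_le_add (hC p) (hC' p))⟩

theorem clm_apply (hr : IsKernel G r) {A : ℝ × ℝ → F →L[ℝ] F'} (hA : IsDensity G A) :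
    IsKernel G (fun p => A p.1 (r p)) := by
  obtain ⟨C, hC⟩ := hr.bdd
  obtain ⟨C', h0, hC'⟩ := hA.bdd
  exact ⟨stronglyMeasurable_clm_apply (hA.sm.comp_measurable measurable_fst) hr.sm,
    fun z w hzw => by simp [hr.zero z w hzw], C' * C,
    fun p => ((A p.1).le_opNorm _).trans (mul_le_mul (hC' _) (hC p) (norm_nonneg _) h0)⟩

theorem swap (hr : IsKernel G r) :
    IsKernel (Prod.swap ⁻¹' G) (fun p : (ℝ × ℝ) × (ℝ × ℝ) => r (p.1.swap, p.2.swap)) :=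
  ⟨hr.sm.comp_measurable (by fun_prop),
    fun z w hzw => hr.zero _ _ fun h => hzw ⟨h.1, h.2.2, h.2.1⟩,
    let ⟨C, hC⟩ := hr.bdd; ⟨C, fun p => hC _⟩⟩

theorem integrable_comp (hr : IsKernel G r) {α : Type*} [MeasurableSpace α] {μ : Measure α}
    [IsFiniteMeasure μ] {φ : α → (ℝ × ℝ) × (ℝ × ℝ)} (hφ : Measurable φ) :
    Integrable (fun x => r (φ x)) μ := by
  obtain ⟨C, hC⟩ := hr.bdd
  exact Integrable.of_bound (hr.sm.comp_measurable hφ).aestronglyMeasurable C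
    (ae_of_all _ fun x => hC _)

end IsKernel

instance (z : ℝ × ℝ) : IsFiniteMeasure (volume.restrict (W z)) :=
  ⟨by rw [Measure.restrict_apply_univ]; exact (isCompact_Icc.prod isCompact_Icc).measure_lt_top⟩

namespace IsRiemannField

variable {A B C : ℝ × ℝ → E →L[ℝ] E} {h : ℝ × ℝ → E} {r rs rt : (ℝ × ℝ) × (ℝ × ℝ) → E}

theorem lin_kernel (H : IsRiemannField G A B C h r rs rt) : IsKernel G (linField A B C r rs rt) :=
  ((H.r_kernel.clm_apply H.A_density).add (H.rs_kernel.clm_apply H.B_density)).add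
    (H.rt_kernel.clm_apply H.C_density)

/-- The state obtained from the Riemann function. -/
def fieldX (a b : ℝ) (r : (ℝ × ℝ) × (ℝ × ℝ) → E) (z : ℝ × ℝ) : E := ∫ w in W (a, b), r (z, w)

/-- The derivative in the first variable of the state obtained from the Riemann function. -/
def fieldP (a b : ℝ) (r rs : (ℝ × ℝ) × (ℝ × ℝ) → E) (z : ℝ × ℝ) : E :=
  (∫ τ in Icc 0 b, r (z, (z.1, τ))) + ∫ w in W (a, b), rs (z, w)

/-- The derivative in the second variable of the state obtained from the Riemann function. -/
def fieldQ (a b : ℝ) (r rt : (ℝ × ℝ) × (ℝ × ℝ) → E) (z : ℝ × ℝ) : E :=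
  (∫ σ in Icc 0 a, r (z, (σ, z.2))) + ∫ w in W (a, b), rt (z, w)

/-- The mixed derivative of the state obtained from the Riemann function. -/
def fieldK (a b : ℝ) (A B C : ℝ × ℝ → E →L[ℝ] E) (h : ℝ × ℝ → E)
    (r rs rt : (ℝ × ℝ) × (ℝ × ℝ) → E) (z : ℝ × ℝ) : E :=
  h z + A z (fieldX a b r z) + B z (fieldP a b r rs z) + C z (fieldQ a b r rt z)

variable [CompleteSpace E]

/-- The coefficients at z do not depend on the integration variable, so they move under the
integrals. The area terms then combine into `linField`, the right-hand side in the equations for R_s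
and R_t. -/
theorem fieldK_eq (H : IsRiemannField G A B C h r rs rt) (z : ℝ × ℝ) :
    fieldK a b A B C h r rs rt z = h z + (∫ τ in Icc 0 b, B z (r (z, (z.1, τ)))) +
      (∫ σ in Icc 0 a, C z (r (z, (σ, z.2)))) +
      ∫ w in W (a, b), linField A B C r rs rt (z, w) := by
  have i1 : ∀ {r : (ℝ × ℝ) × (ℝ × ℝ) → E}, IsKernel G r →
      Integrable (fun w => r (z, w)) (volume.restrict (W (a, b))) := fun hr =>
    hr.integrable_comp measurable_prodMk_left
  have e : ∫ w in W (a, b), linField A B C r rs rt (z, w) =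
      A z (∫ w in W (a, b), r (z, w)) + B z (∫ w in W (a, b), rs (z, w)) +
        C z (∫ w in W (a, b), rt (z, w)) := by
    rw [← ContinuousLinearMap.integral_comp_comm _ (i1 H.r_kernel),
      ← ContinuousLinearMap.integral_comp_comm _ (i1 H.rs_kernel),
      ← ContinuousLinearMap.integral_comp_comm _ (i1 H.rt_kernel), ← integral_add, ← integral_add]
    · rfl
    · exact ((A z).integrable_comp (i1 H.r_kernel)).add ((B z).integrable_comp (i1 H.rs_kernel))
    · exact (C z).integrable_comp (i1 H.rt_kernel)
    · exact (A z).integrable_comp (i1 H.r_kernel)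
    · exact (B z).integrable_comp (i1 H.rs_kernel)
  rw [e, ContinuousLinearMap.integral_comp_comm _
    (H.r_kernel.integrable_comp (by fun_prop : Measurable fun τ : ℝ => (z, (z.1, τ)))),
    ContinuousLinearMap.integral_comp_comm _
    (H.r_kernel.integrable_comp (by fun_prop : Measurable fun σ : ℝ => (z, (σ, z.2))))]
  simp only [fieldK, fieldX, fieldP, fieldQ, map_add]
  abel

theorem bilin_bdd (H : IsRiemannField G A B C h r rs rt) {D : ℝ × ℝ → E →L[ℝ] E}
    (hD : IsDensity G D) {α : Type*} [MeasurableSpace α] {μ : Measure α} [IsFiniteMeasure μ]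
    {φ : α → ℝ × ℝ} {ψ : α → (ℝ × ℝ) × (ℝ × ℝ)} (hφ : Measurable φ) (hψ : Measurable ψ) :
    Integrable (fun x => D (φ x) (r (ψ x))) μ := by
  obtain ⟨M, h0, hM⟩ := hD.bdd
  obtain ⟨N, hN⟩ := H.r_kernel.bdd
  exact Integrable.of_bound (stronglyMeasurable_clm_apply (hD.sm.comp_measurable hφ)
    (H.r_kernel.sm.comp_measurable hψ)).aestronglyMeasurable (M * N)
    (ae_of_all _ fun x => ((D (φ x)).le_opNorm _).trans
      (mul_le_mul (hM _) (hN _) (norm_nonneg _) h0))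

/-- By Fubini the four terms of the mixed derivative regroup in pairs: h with the B-term gives the
trace of r on s = σ by `r_vert`, and the C-term with the area term gives r_s by `rs_eq`. The
extension of the kernels by zero makes the domains of integration fixed rectangles. -/
theorem int₂_fieldK (hG : IsStaircase G a b) (H : IsRiemannField G A B C h r rs rt)
    {z : ℝ × ℝ} (hz : z ∈ G) : int₂ (fieldK a b A B C h r rs rt) z = fieldP a b r rs z := by
  obtain ⟨s, t⟩ := z
  have hs0 : 0 ≤ s := (hG.nonneg _ hz).1
  have ht0 : 0 ≤ t := (hG.nonneg _ hz).2
  have hsa : s ≤ a := (hG.le _ hz).1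
  have htb : t ≤ b := (hG.le _ hz).2
  set L := linField A B C r rs rt with hL
  have hLk : IsKernel G L := H.lin_kernel

  have iB : Integrable (fun p : ℝ × ℝ => B (s, p.1) (r ((s, p.1), (s, p.2))))
      ((volume.restrict (Icc 0 t)).prod (volume.restrict (Icc 0 b))) :=
    H.bilin_bdd H.B_density (by fun_prop) (by fun_prop)
  have iC : Integrable (fun p : ℝ × ℝ => C (s, p.1) (r ((s, p.1), (p.2, p.1))))
      ((volume.restrict (Icc 0 t)).prod (volume.restrict (Icc 0 a))) :=
    H.bilin_bdd H.C_density (by fun_prop) (by fun_prop)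
  have iL : Integrable (fun p : ℝ × (ℝ × ℝ) => L ((s, p.1), p.2))
      ((volume.restrict (Icc 0 t)).prod (volume.restrict (W (a, b)))) :=
    hLk.integrable_comp (by fun_prop)
  have ih : IntegrableOn (fun τ => h (s, τ)) (Icc 0 t) :=
    (H.h_density.integrable_section hG s).integrableOn
  have lhs : int₂ (fieldK a b A B C h r rs rt) (s, t) =
      (∫ v in Icc 0 t, h (s, v)) +
      (∫ v in Icc 0 t, ∫ τ in Icc 0 b, B (s, v) (r ((s, v), (s, τ)))) +
      (∫ v in Icc 0 t, ∫ σ in Icc 0 a, C (s, v) (r ((s, v), (σ, v)))) +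
      ∫ v in Icc 0 t, ∫ w in W (a, b), L ((s, v), w) := by
    rw [int₂]
    simp only [H.fieldK_eq]
    have j1 : IntegrableOn (fun v => ∫ τ in Icc 0 b, B (s, v) (r ((s, v), (s, τ)))) (Icc 0 t) :=
      iB.integral_prod_left
    have j2 : IntegrableOn (fun v => ∫ σ in Icc 0 a, C (s, v) (r ((s, v), (σ, v)))) (Icc 0 t) :=
      iC.integral_prod_left
    have j3 : IntegrableOn (fun v => ∫ w in W (a, b), L ((s, v), w)) (Icc 0 t) :=
      iL.integral_prod_left
    have e1 := integral_add ih j1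
    have e2 := integral_add (ih.add j1) j2
    have e3 := integral_add ((ih.add j1).add j2) j3
    simp only [Pi.add_apply] at e2 e3
    rw [e3, e2, e1]
  have rP : ∫ τ in Icc 0 b, r ((s, t), (s, τ)) = (∫ v in Icc 0 t, h (s, v)) +
      ∫ v in Icc 0 t, ∫ τ in Icc 0 b, B (s, v) (r ((s, v), (s, τ))) := by
    rw [integral_integral_swap iB]
    have e : ∀ τ ∈ Icc 0 b, r ((s, t), (s, τ)) = (Icc 0 t).indicator (fun v => h (s, v)) τ +
        ∫ v in Icc 0 t, B (s, v) (r ((s, v), (s, τ))) := by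
      intro τ hτ
      by_cases hτt : τ ≤ t
      · rw [indicator_of_mem (show τ ∈ Icc 0 t from ⟨hτ.1, hτt⟩)]
        exact H.r_vert _ hz τ ⟨hτ.1, hτt⟩
      · rw [indicator_of_notMem fun h' : τ ∈ Icc 0 t => hτt h'.2, zero_add,
          H.r_kernel.zero _ _ fun h' => hτt h'.2.2.2]
        refine (setIntegral_eq_zero_of_forall_eq_zero fun v hv => ?_).symm
        rw [H.r_kernel.zero _ _ fun h' => hτt (h'.2.2.2.trans hv.2), map_zero]
    rw [setIntegral_congr_fun measurableSet_Icc e, integral_add]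
    · congr 1
      rw [setIntegral_indicator measurableSet_Icc, Icc_inter_Icc, max_self, min_eq_right htb]
    · exact ((integrable_indicator_iff measurableSet_Icc).2 ih).integrableOn
    · exact iB.integral_prod_right
  have rS : ∫ w in W (a, b), rs ((s, t), w) =
      (∫ v in Icc 0 t, ∫ σ in Icc 0 a, C (s, v) (r ((s, v), (σ, v)))) +
      ∫ v in Icc 0 t, ∫ w in W (a, b), L ((s, v), w) := by
    rw [show ∫ v in Icc 0 t, ∫ w in W (a, b), L ((s, v), w) =
      ∫ w in W (a, b), ∫ v in Icc 0 t, L ((s, v), w) from integral_integral_swap iL]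
    have e : ∀ w ∈ W (a, b), rs ((s, t), w) =
        (Icc 0 a ×ˢ Icc 0 t).indicator (fun w => C (s, w.2) (r ((s, w.2), w))) w +
        ∫ v in Icc 0 t, L ((s, v), w) := by
      intro w hw
      by_cases hw' : w ∈ W (s, t)
      · rw [indicator_of_mem (show w ∈ Icc 0 a ×ˢ Icc 0 t from ⟨hw.1, hw'.2⟩)]
        exact H.rs_eq _ hz w hw'
      · have h0 : ∫ v in Icc 0 t, L ((s, v), w) = 0 :=
          setIntegral_eq_zero_of_forall_eq_zero fun v hv => hLk.zero _ _ fun h' =>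
            hw' ⟨h'.2.1, h'.2.2.1, h'.2.2.2.trans hv.2⟩
        rw [h0, add_zero, H.rs_kernel.zero _ _ fun h' => hw' h'.2]
        by_cases hwt : w ∈ Icc 0 a ×ˢ Icc 0 t
        · rw [indicator_of_mem hwt, H.r_kernel.zero (s, w.2) w fun h' => hw' ⟨h'.2.1, hwt.2⟩, map_zero]
        · rw [indicator_of_notMem hwt]
    have iC' : Integrable (fun w : ℝ × ℝ => C (s, w.2) (r ((s, w.2), w)))
        ((volume.restrict (Icc 0 a)).prod (volume.restrict (Icc 0 t))) :=
      H.bilin_bdd H.C_density (by fun_prop) (by fun_prop)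
    have iC'' : IntegrableOn (fun w : ℝ × ℝ => C (s, w.2) (r ((s, w.2), w)))
        (Icc 0 a ×ˢ Icc 0 t) := by
      rw [IntegrableOn, Measure.volume_eq_prod, ← Measure.prod_restrict]
      exact iC'
    rw [setIntegral_congr_fun (measurableSet_W _) e, integral_add]
    · congr 1
      rw [setIntegral_indicator (measurableSet_Icc.prod measurableSet_Icc),
        inter_eq_right.2 (show Icc 0 a ×ˢ Icc 0 t ⊆ W (a, b) from
          prod_mono subset_rfl (Icc_subset_Icc_right htb)),
        Measure.volume_eq_prod, ← Measure.prod_restrict, integral_prod_symm _ iC']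
    · exact ((integrable_indicator_iff (measurableSet_Icc.prod measurableSet_Icc)).2
        iC'').integrableOn
    · exact iL.integral_prod_right
  rw [lhs, fieldP]
  simp only at rP rS ⊢
  rw [rP, rS]
  abel

/-- This is r = (r on s = σ) + ∫ r_s integrated over the source point: the trace term of `fieldP`,
integrated in s, fills the area to the left of s by Fubini. -/
theorem int₁_fieldP (hG : IsStaircase G a b) (H : IsRiemannField G A B C h r rs rt)
    (hr : ∀ z ∈ G, ∀ w ∈ W z, r (z, w) = r ((w.1, z.2), w) + ∫ σ in Icc 0 z.1, rs ((σ, z.2), w))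
    {z : ℝ × ℝ} (hz : z ∈ G) : int₁ (fieldP a b r rs) z = fieldX a b r z := by
  obtain ⟨s, t⟩ := z
  have hs0 : 0 ≤ s := (hG.nonneg _ hz).1
  have ht0 : 0 ≤ t := (hG.nonneg _ hz).2
  have hsa : s ≤ a := (hG.le _ hz).1
  have htb : t ≤ b := (hG.le _ hz).2
  have i1 : Integrable (fun p : ℝ × ℝ => r ((p.1, t), p))
      ((volume.restrict (Icc 0 s)).prod (volume.restrict (Icc 0 b))) :=
    H.r_kernel.integrable_comp (by fun_prop)
  have i2 : Integrable (fun p : ℝ × (ℝ × ℝ) => rs ((p.1, t), p.2))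
      ((volume.restrict (Icc 0 s)).prod (volume.restrict (W (a, b)))) :=
    H.rs_kernel.integrable_comp (by fun_prop)
  have i1' : IntegrableOn (fun p : ℝ × ℝ => r ((p.1, t), p)) (Icc 0 s ×ˢ Icc 0 b) := by
    rw [IntegrableOn, Measure.volume_eq_prod, ← Measure.prod_restrict]
    exact i1
  have lhs : int₁ (fieldP a b r rs) (s, t) =
      (∫ σ in Icc 0 s, ∫ τ in Icc 0 b, r ((σ, t), (σ, τ))) +
      ∫ σ in Icc 0 s, ∫ w in W (a, b), rs ((σ, t), w) :=
    integral_add i1.integral_prod_left i2.integral_prod_left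
  have e : ∀ w ∈ W (a, b), r ((s, t), w) =
      (Icc 0 s ×ˢ Icc 0 b).indicator (fun w => r ((w.1, t), w)) w +
      ∫ σ in Icc 0 s, rs ((σ, t), w) := by
    intro w hw
    by_cases hw' : w ∈ W (s, t)
    · rw [indicator_of_mem (show w ∈ Icc 0 s ×ˢ Icc 0 b from ⟨hw'.1, hw.2⟩)]
      exact hr _ hz w hw'
    · have h0 : ∫ σ in Icc 0 s, rs ((σ, t), w) = 0 :=
        setIntegral_eq_zero_of_forall_eq_zero fun v hv => H.rs_kernel.zero _ _ fun h' =>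
          hw' ⟨⟨h'.2.1.1, h'.2.1.2.trans hv.2⟩, h'.2.2⟩
      rw [h0, add_zero, H.r_kernel.zero _ _ fun h' => hw' h'.2]
      by_cases hwt : w ∈ Icc 0 s ×ˢ Icc 0 b
      · rw [indicator_of_mem hwt, H.r_kernel.zero (w.1, t) w fun h' => hw' ⟨hwt.1, h'.2.2⟩]
      · rw [indicator_of_notMem hwt]
  rw [lhs, fieldX, show ∫ σ in Icc 0 s, ∫ w in W (a, b), rs ((σ, t), w) =
    ∫ w in W (a, b), ∫ σ in Icc 0 s, rs ((σ, t), w) from integral_integral_swap i2, setIntegral_congr_fun (measurableSet_W _) e,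
    integral_add]
  · congr 1
    rw [setIntegral_indicator (measurableSet_Icc.prod measurableSet_Icc),
      inter_eq_right.2 (show Icc 0 s ×ˢ Icc 0 b ⊆ W (a, b) from
        prod_mono (Icc_subset_Icc_right hsa) subset_rfl),
      Measure.volume_eq_prod, ← Measure.prod_restrict, integral_prod _ i1]
  · exact ((integrable_indicator_iff (measurableSet_Icc.prod measurableSet_Icc)).2
      i1').integrableOn
  · exact i2.integral_prod_right

/-- Under reflection f_p and f_q change places, together with r_s and r_t; the system is symmetric
in this sense. -/
theorem swap (H : IsRiemannField G A B C h r rs rt) :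
    IsRiemannField (Prod.swap ⁻¹' G) (A ∘ Prod.swap) (C ∘ Prod.swap) (B ∘ Prod.swap)
      (h ∘ Prod.swap) (fun p => r (p.1.swap, p.2.swap)) (fun p => rt (p.1.swap, p.2.swap))
      (fun p => rs (p.1.swap, p.2.swap)) where
  A_density := H.A_density.swap
  B_density := H.C_density.swap
  C_density := H.B_density.swap
  h_density := H.h_density.swap
  r_kernel := H.r_kernel.swap
  rs_kernel := H.rt_kernel.swap
  rt_kernel := H.rs_kernel.swap
  rs_eq z hz w hw := by
    have := H.rt_eq z.swap hz w.swap ⟨hw.2, hw.1⟩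
    simp only [linField, Function.comp, Prod.swap_prod_mk, Prod.snd_swap, Prod.fst_swap] at this ⊢
    rw [this]
    simp only [add_right_comm]
  rt_eq z hz w hw := by
    have := H.rs_eq z.swap hz w.swap ⟨hw.2, hw.1⟩
    simp only [linField, Function.comp, Prod.swap_prod_mk, Prod.snd_swap, Prod.fst_swap] at this ⊢
    rw [this]
    simp only [add_right_comm]
  r_vert z hz := H.r_horiz z.swap hz
  r_horiz z hz := H.r_vert z.swap hz

theorem setIntegral_W_swap (f : ℝ × ℝ → E) :
    ∫ w in W (b, a), f w.swap = ∫ w in W (a, b), f w := by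
  rw [Measure.volume_eq_prod]
  exact setIntegral_prod_swap (μ := volume) (ν := volume) (Icc 0 a) (Icc 0 b) f

theorem int₁_fieldK (hG : IsStaircase G a b) (H : IsRiemannField G A B C h r rs rt)
    {z : ℝ × ℝ} (hz : z ∈ G) : int₁ (fieldK a b A B C h r rs rt) z = fieldQ a b r rt z := by
  have := H.swap.int₂_fieldK hG.swap (z := z.swap) hz
  have e : (fieldK b a (A ∘ Prod.swap) (C ∘ Prod.swap) (B ∘ Prod.swap)
      (h ∘ Prod.swap) (fun p => r (p.1.swap, p.2.swap)) (fun p => rt (p.1.swap, p.2.swap))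
      (fun p => rs (p.1.swap, p.2.swap))) = fieldK a b A B C h r rs rt ∘ Prod.swap := by
    ext w
    simp only [fieldK, fieldX, fieldP, fieldQ, Function.comp, Prod.fst_swap, Prod.snd_swap,
      Prod.swap_prod_mk]
    rw [setIntegral_W_swap (fun w' => r (w.swap, w')), setIntegral_W_swap (fun w' => rs (w.swap, w')),
      setIntegral_W_swap (fun w' => rt (w.swap, w'))]
    abel
  rw [e] at this
  refine Eq.trans ?_ (this.trans ?_)
  · rfl
  · simp only [fieldP, fieldQ, Prod.fst_swap, Prod.swap_prod_mk, Prod.swap_swap]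
    rw [setIntegral_W_swap (fun w' => rt (z, w'))]

theorem fieldK_density (H : IsRiemannField G A B C h r rs rt) :
    IsDensity G (fieldK a b A B C h r rs rt) := by
  have sm2 : ∀ {r : (ℝ × ℝ) × (ℝ × ℝ) → E}, IsKernel G r →
      StronglyMeasurable fun z => ∫ w in W (a, b), r (z, w) := fun hr =>
    hr.sm.integral_prod_right'
  have b2 : ∀ {r : (ℝ × ℝ) × (ℝ × ℝ) → E}, IsKernel G r →
      ∃ M, ∀ z, ‖∫ w in W (a, b), r (z, w)‖ ≤ M := fun hr => by
    obtain ⟨M, hM⟩ := hr.bdd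
    exact ⟨M * volume.real (W (a, b)), fun z => norm_setIntegral_le_of_norm_le_const
      (isCompact_Icc.prod isCompact_Icc).measure_lt_top fun w _ => hM _⟩
  obtain ⟨M, hM⟩ := H.r_kernel.bdd
  obtain ⟨M₀, hM₀⟩ := b2 H.r_kernel
  obtain ⟨M₁, hM₁⟩ := b2 H.rs_kernel
  obtain ⟨M₂, hM₂⟩ := b2 H.rt_kernel
  obtain ⟨MA, hA0, hA⟩ := H.A_density.bdd
  obtain ⟨MB, hB0, hB⟩ := H.B_density.bdd
  obtain ⟨MC, hC0, hC⟩ := H.C_density.bdd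
  obtain ⟨Mh, hh0, hh⟩ := H.h_density.bdd
  have smP : StronglyMeasurable (fieldP a b r rs) :=
    (StronglyMeasurable.integral_prod_right' (ν := volume.restrict (Icc 0 b))
      (f := fun p : (ℝ × ℝ) × ℝ => r (p.1, (p.1.1, p.2)))
      (H.r_kernel.sm.comp_measurable (by fun_prop))).add (sm2 H.rs_kernel)
  have smQ : StronglyMeasurable (fieldQ a b r rt) :=
    (StronglyMeasurable.integral_prod_right' (ν := volume.restrict (Icc 0 a))
      (f := fun p : (ℝ × ℝ) × ℝ => r (p.1, (p.2, p.1.2)))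
      (H.r_kernel.sm.comp_measurable (by fun_prop))).add (sm2 H.rt_kernel)
  have bP : ∀ z, ‖fieldP a b r rs z‖ ≤ M * volume.real (Icc 0 b) + M₁ := fun z =>
    (norm_add_le _ _).trans (add_le_add (norm_setIntegral_le_of_norm_le_const
      measure_Icc_lt_top fun _ _ => hM _) (hM₁ z))
  have bQ : ∀ z, ‖fieldQ a b r rt z‖ ≤ M * volume.real (Icc 0 a) + M₂ := fun z =>
    (norm_add_le _ _).trans (add_le_add (norm_setIntegral_le_of_norm_le_const
      measure_Icc_lt_top fun _ _ => hM _) (hM₂ z))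
  refine ⟨((H.h_density.sm.add (stronglyMeasurable_clm_apply H.A_density.sm (sm2 H.r_kernel))).add
    (stronglyMeasurable_clm_apply H.B_density.sm smP)).add
    (stronglyMeasurable_clm_apply H.C_density.sm smQ), fun z hz => ?_, |Mh + MA * M₀ +
      MB * (M * volume.real (Icc 0 b) + M₁) + MC * (M * volume.real (Icc 0 a) + M₂)|,
      abs_nonneg _, fun z => ?_⟩
  · simp [fieldK, H.A_density.zero z hz, H.B_density.zero z hz, H.C_density.zero z hz,
      H.h_density.zero z hz]
  · refine le_trans ?_ (le_abs_self _)
    have ap : ∀ {D : E →L[ℝ] E} {x : E} {m m' : ℝ}, ‖D‖ ≤ m → ‖x‖ ≤ m' → 0 ≤ m → ‖D x‖ ≤ m * m' :=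
      fun {D x m m'} h1 h2 h0 => (D.le_opNorm x).trans (mul_le_mul h1 h2 (norm_nonneg _) h0)
    exact norm_add₄_le.trans (add_le_add (add_le_add (add_le_add (hh z) (ap (hA z) (hM₀ z) hA0))
      (ap (hB z) (bP z) hB0)) (ap (hC z) (bQ z) hC0))

/-- Variation of constants: the solution of the linear Goursat problem with source `h`. -/
theorem int₁₂_eq_fieldX (hG : IsStaircase G a b) (H : IsRiemannField G A B C h r rs rt)
    (hr : ∀ z ∈ G, ∀ w ∈ W z, r (z, w) = r ((w.1, z.2), w) + ∫ σ in Icc 0 z.1, rs ((σ, z.2), w))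
    {k : ℝ × ℝ → E} (hk : IsDensity G k)
    (hkeq : ∀ z ∈ G, k z = h z + A z (int₁₂ k z) + B z (int₂ k z) + C z (int₁ k z))
    {z : ℝ × ℝ} (hz : z ∈ G) : int₁₂ k z = fieldX a b r z := by
  have hk' := H.fieldK_density (a := a) (b := b)
  set k' := fieldK a b A B C h r rs rt with hk'def
  have e12 : ∀ z ∈ G, int₁₂ k' z = fieldX a b r z := fun z hz => by
    rw [hk'.int₁₂_eq hG, ← H.int₁_fieldP hG hr hz]
    exact setIntegral_congr_fun measurableSet_Icc fun σ hσ => H.int₂_fieldK hG (hG.horiz_mem hz hσ)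
  obtain ⟨MA, hA0, hA⟩ := H.A_density.bdd
  obtain ⟨MB, hB0, hB⟩ := H.B_density.bdd
  obtain ⟨MC, hC0, hC⟩ := H.C_density.bdd
  -- The field built from the kernel has the same source as k, so the difference solves the
  -- homogeneous linear problem and is zero by uniqueness.
  have hzero : ∀ z, k z - k' z = 0 := by
    refine density_eq_zero hG (hk.sub hk') (K := MA + MB + MC) (by positivity) fun z hz => ?_
    rw [int₁₂_sub hG hk hk', int₂_sub hG hk hk', int₁_sub hG hk hk']
    have : k z - k' z = A z (int₁₂ k z - int₁₂ k' z) + B z (int₂ k z - int₂ k' z) +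
        C z (int₁ k z - int₁ k' z) := by
      rw [e12 z hz, H.int₂_fieldK hG hz, H.int₁_fieldK hG hz, hkeq z hz, hk'def, fieldK]
      simp only [map_sub]
      abel
    rw [this]
    have ap : ∀ {D : E →L[ℝ] E} (x : E) {m : ℝ}, ‖D‖ ≤ m → ‖D x‖ ≤ m * ‖x‖ :=
      fun {D} x {m} h1 => (D.le_opNorm x).trans (by gcongr)
    set x := int₁₂ k z - int₁₂ k' z
    set y := int₂ k z - int₂ k' z
    set w := int₁ k z - int₁ k' z
    have h1 := ap x (hA z)
    have h2 := ap y (hB z)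
    have h3 := ap w (hC z)
    have h4 := norm_add₃_le (a := A z x) (b := B z y) (c := C z w)
    have := norm_nonneg x
    have := norm_nonneg y
    have := norm_nonneg w
    nlinarith
  have : k = k' := funext fun z => sub_eq_zero.1 (hzero z)
  rw [this, e12 z hz]

end IsRiemannField

end

end GoursatControl

namespace GoursatControl

noncomputable section

open Filter Topology

/-! ### The boundary curve -/

section sections

variable {F : Type*} [NormedAddCommGroup F] [NormedSpace ℝ F] {G : Set (ℝ × ℝ)} {a b : ℝ}

/-- The integral over a compact staircase domain of a function whose horizontal partial integrals
are given by `β`, as an integral over a parametrization of the boundary. -/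
theorem integral_section_boundary (hG : IsStaircase G a b) (hGc : IsCompact G)
    (hGb : ∀ t ∈ Icc 0 b, ∃ σ, (σ, t) ∈ G) {s : Set ℝ} (hs : MeasurableSet s) {w A f : ℝ → ℝ}
    (hf : ∀ m ∈ s, f m ∈ Icc 0 b)
    (hint : ∀ g : ℝ → F, IntegrableOn g (Icc 0 b) ↔ IntegrableOn (fun m => w m • g (f m)) s)
    (hcov : ∀ g : ℝ → F, ∫ t in Icc 0 b, g t = ∫ m in s, w m • g (f m))
    (hsec : ∀ m ∈ s, w m ≠ 0 → ∀ σ, (σ, f m) ∈ G ↔ σ ∈ Icc 0 (A m))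
    {φ β : ℝ × ℝ → F} (hφ : IntegrableOn φ G)
    (hβ : ∀ᵐ t : ℝ, ∀ σ, (σ, t) ∈ G → int₁ φ (σ, t) = β (σ, t)) :
    IntegrableOn (fun m => w m • β (A m, f m)) s ∧
      ∫ z in G, φ z = ∫ m in s, w m • β (A m, f m) := by
  -- The right end of the horizontal section at height t; it exists by compactness, and each section
  -- is the whole segment from 0 to it.
  set top : ℝ → ℝ := fun t => sSup {σ | (σ, t) ∈ G} with htop
  have hsect : ∀ t ∈ Icc 0 b, (top t, t) ∈ G ∧ ∀ σ, (σ, t) ∈ G ↔ σ ∈ Icc 0 (top t) := by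
    intro t ht
    have hc : IsCompact {σ | (σ, t) ∈ G} := by
      refine isCompact_Icc.of_isClosed_subset (hGc.isClosed.preimage (by fun_prop))
        (fun σ hσ => (hG.subset hσ).1)
    have hne : {σ | (σ, t) ∈ G}.Nonempty := hGb t ht
    have hmem : (top t, t) ∈ G := hc.sSup_mem hne
    refine ⟨hmem, fun σ => ⟨fun hσ => ⟨(hG.nonneg _ hσ).1, le_csSup hc.bddAbove hσ⟩, fun hσ =>
      hG.horiz_mem hmem hσ⟩⟩
  have hφ' : Integrable (G.indicator φ) (volume.prod volume) := by
    rw [← Measure.volume_eq_prod]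
    exact (integrable_indicator_iff hG.measurableSet).2 hφ
  set g : ℝ → F := fun t => ∫ σ, G.indicator φ (σ, t) with hg
  have hgi : Integrable g := hφ'.integral_prod_right
  have hgb : ∀ t ∈ Icc 0 b, g t = int₁ φ (top t, t) := by
    intro t ht
    rw [int₁, ← integral_indicator measurableSet_Icc]
    refine integral_congr_ae (ae_of_all _ fun σ => ?_)
    by_cases hσ : (σ, t) ∈ G
    · simp only [indicator_of_mem hσ, indicator_of_mem (((hsect t ht).2 σ).1 hσ)]
    · simp only [indicator_of_notMem hσ,
        indicator_of_notMem fun h' => hσ (((hsect t ht).2 σ).2 h')]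
  have hg0 : ∀ t, t ∉ Icc 0 b → g t = 0 := by
    intro t ht
    refine integral_eq_zero_of_ae (ae_of_all _ fun σ => indicator_of_notMem (fun h' => ?_) _)
    exact ht (hG.subset h').2
  have hgv : ∀ᵐ t ∂volume.restrict (Icc 0 b), g t = β (top t, t) := by
    filter_upwards [ae_restrict_of_ae hβ, ae_restrict_mem measurableSet_Icc] with t h1 h2
    rw [hgb t h2, h1 _ (hsect t h2).1]
  -- On pieces of the boundary parallel to the section, A m need not be the end of the section;
  -- there the factor w m is zero.
  have hvw : ∀ m ∈ s, w m • β (top (f m), f m) = w m • β (A m, f m) := by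
    intro m hm
    by_cases hw : w m = 0
    · simp [hw]
    · have e : {σ | (σ, f m) ∈ G} = Icc 0 (A m) := ext fun σ => hsec m hm hw σ
      have hA : 0 ≤ A m := by
        obtain ⟨σ, hσ⟩ := hGb _ (hf m hm)
        have := (hsec m hm hw σ).1 hσ
        exact this.1.trans this.2
      have : top (f m) = A m := by
        rw [htop]
        simp only [e]
        exact csSup_Icc hA
      rw [this]
  have hvi : IntegrableOn (fun t => β (top t, t)) (Icc 0 b) :=
    hgi.integrableOn.congr hgv
  refine ⟨((hint _).1 hvi).congr_fun hvw hs, ?_⟩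
  rw [← setIntegral_congr_fun hs hvw, ← hcov (fun t => β (top t, t)), ← integral_congr_ae hgv,
    setIntegral_eq_integral_of_forall_compl_eq_zero hg0, ← integral_indicator hG.measurableSet,
    Measure.volume_eq_prod, integral_prod_symm _ hφ']

end sections

namespace Curve

variable {N : ℕ} (c : Curve N)

/-! ### Geometry of the curve and integration over the region under it -/

theorem ℓ_pos : 0 < c.ℓ := by
  rw [← c.vert_zero, ← c.vert_last]
  exact c.vert_strictMono (Fin.last_pos)

theorem vert_mem (r : Fin (N + 2)) : c.vert r ∈ Icc 0 c.ℓ := by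
  rw [← c.vert_zero, ← c.vert_last]
  exact ⟨c.vert_strictMono.monotone (Fin.zero_le _), c.vert_strictMono.monotone (Fin.le_last _)⟩

theorem vert_castSucc_lt (r : Fin (N + 1)) : c.vert r.castSucc < c.vert r.succ :=
  c.vert_strictMono Fin.castSucc_lt_succ

theorem arc_subset (r : Fin (N + 1)) :
    Icc (c.vert r.castSucc) (c.vert r.succ) ⊆ Icc 0 c.ℓ :=
  Icc_subset_Icc (c.vert_mem _).1 (c.vert_mem _).2

/-- A property of sets that passes to unions of adjacent intervals holds on `[0,ℓ]` if it holds on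
all arcs. -/
theorem induction_arcs {p : Set ℝ → Prop} (h0 : p {0})
    (hstep : ∀ x y z : ℝ, x ≤ y → y ≤ z → p (Icc x y) → p (Icc y z) → p (Icc x z))
    (harc : ∀ r : Fin (N + 1), p (Icc (c.vert r.castSucc) (c.vert r.succ))) : p (Icc 0 c.ℓ) := by
  have : ∀ r : Fin (N + 2), p (Icc 0 (c.vert r)) := by
    intro r
    induction r using Fin.induction with
    | zero => rw [c.vert_zero, Icc_self]; exact h0
    | succ r ih => exact hstep _ _ _ (c.vert_mem _).1 (c.vert_castSucc_lt r).le ih (harc r)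
  rw [← c.vert_last]
  exact this _

theorem continuousOn_of_arcs {X : Type*} [TopologicalSpace X] {g : ℝ → X}
    (h : ∀ r : Fin (N + 1), ContinuousOn g (Icc (c.vert r.castSucc) (c.vert r.succ))) :
    ContinuousOn g (Icc 0 c.ℓ) := by
  refine c.induction_arcs (p := ContinuousOn g) (continuousOn_singleton _ _) ?_ h
  intro x y z hxy hyz h1 h2
  rw [← Icc_union_Icc_eq_Icc hxy hyz]
  exact h1.union_of_isClosed h2 isClosed_Icc isClosed_Icc

theorem continuousOn_L₁ : ContinuousOn c.L₁ (Icc 0 c.ℓ) :=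
  c.continuousOn_of_arcs fun r => (c.contDiffOn_L₁ r).continuousOn

theorem continuousOn_L₂ : ContinuousOn c.L₂ (Icc 0 c.ℓ) :=
  c.continuousOn_of_arcs fun r => (c.contDiffOn_L₂ r).continuousOn

theorem continuousOn_pt : ContinuousOn c.pt (Icc 0 c.ℓ) :=
  c.continuousOn_L₁.prodMk c.continuousOn_L₂

/-- The parameters of the curve that do not belong to vertices. -/
def smooth : Set ℝ := Icc 0 c.ℓ \ Set.range c.vert

theorem measurableSet_smooth : MeasurableSet c.smooth :=
  measurableSet_Icc.diff (finite_range _).measurableSet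

theorem exists_arc {m : ℝ} (hm : m ∈ c.smooth) :
    ∃ r : Fin (N + 1), m ∈ Ioo (c.vert r.castSucc) (c.vert r.succ) := by
  have := c.induction_arcs (p := fun S => ∀ m ∈ S, m ∉ Set.range c.vert →
    ∃ r : Fin (N + 1), m ∈ Ioo (c.vert r.castSucc) (c.vert r.succ)) ?_ ?_ ?_
  · exact this m hm.1 hm.2
  · rintro m rfl h
    exact absurd ⟨0, c.vert_zero⟩ h
  · intro x y z hxy hyz h1 h2 m hm h
    rcases le_total m y with h' | h'
    · exact h1 m ⟨hm.1, h'⟩ h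
    · exact h2 m ⟨h', hm.2⟩ h
  · intro r m hm h
    exact ⟨r, lt_of_le_of_ne hm.1 fun e => h ⟨_, e⟩, lt_of_le_of_ne hm.2 fun e => h ⟨_, e.symm⟩⟩

theorem hasDerivAt_L₁ {m : ℝ} (hm : m ∈ c.smooth) : HasDerivAt c.L₁ (deriv c.L₁ m) m := by
  obtain ⟨r, hr⟩ := c.exists_arc hm
  exact ((((c.contDiffOn_L₁ r).differentiableOn (by norm_num)) m (Ioo_subset_Icc_self hr)
    ).differentiableAt (Icc_mem_nhds hr.1 hr.2)).hasDerivAt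

theorem hasDerivAt_L₂ {m : ℝ} (hm : m ∈ c.smooth) : HasDerivAt c.L₂ (deriv c.L₂ m) m := by
  obtain ⟨r, hr⟩ := c.exists_arc hm
  exact ((((c.contDiffOn_L₂ r).differentiableOn (by norm_num)) m (Ioo_subset_Icc_self hr)
    ).differentiableAt (Icc_mem_nhds hr.1 hr.2)).hasDerivAt

theorem abs_deriv_le {m : ℝ} (hm : m ∈ c.smooth) : |deriv c.L₁ m| ≤ 1 ∧ |deriv c.L₂ m| ≤ 1 := by
  obtain ⟨r, hr⟩ := c.exists_arc hm
  have := c.unit_speed r m hr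
  constructor <;> rw [← sq_le_one_iff_abs_le_one] <;> nlinarith [sq_nonneg (deriv c.L₁ m), sq_nonneg (deriv c.L₂ m)]

theorem smooth_mem_nhds {m : ℝ} (hm : m ∈ c.smooth) : Icc 0 c.ℓ ∈ 𝓝 m := by
  obtain ⟨r, hr⟩ := c.exists_arc hm
  exact mem_of_superset (Icc_mem_nhds hr.1 hr.2) (c.arc_subset r)

theorem left_mem : (0 : ℝ) ∈ Icc 0 c.ℓ := ⟨le_rfl, c.ℓ_pos.le⟩

theorem right_mem : c.ℓ ∈ Icc 0 c.ℓ := ⟨c.ℓ_pos.le, le_rfl⟩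

theorem L₁_mem {m : ℝ} (hm : m ∈ Icc 0 c.ℓ) : c.L₁ m ∈ Icc 0 c.a := by
  have h1 := c.antitone_L₁ hm c.right_mem hm.2
  have h2 := c.antitone_L₁ c.left_mem hm hm.1
  rw [c.end_eq.1] at h1
  rw [c.start_eq.1] at h2
  exact ⟨h1, h2⟩

theorem L₂_mem {m : ℝ} (hm : m ∈ Icc 0 c.ℓ) : c.L₂ m ∈ Icc 0 c.b := by
  rw [← c.start_eq.2, ← c.end_eq.2]
  exact ⟨c.monotone_L₂ c.left_mem hm hm.1, c.monotone_L₂ hm c.right_mem hm.2⟩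

theorem pt_mem_G {m : ℝ} (hm : m ∈ Icc 0 c.ℓ) : c.pt m ∈ c.G :=
  ⟨(c.L₁_mem hm).1, (c.L₂_mem hm).1, m, hm, le_rfl, le_rfl⟩

theorem P_mem_G (r : Fin (N + 2)) : c.P r ∈ c.G := c.pt_mem_G (c.vert_mem r)

/-- G is the projection of the compact set of pairs (m, z) in which z lies in the first quadrant
below and to the left of the curve point with parameter m. -/
theorem isCompact_G : IsCompact c.G := by
  have hK : IsCompact (Icc 0 c.ℓ ×ˢ (Icc 0 c.a ×ˢ Icc 0 c.b)) :=
    isCompact_Icc.prod (isCompact_Icc.prod isCompact_Icc)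
  have hc1 : ContinuousOn (fun p : ℝ × (ℝ × ℝ) => c.L₁ p.1 - p.2.1)
      (Icc 0 c.ℓ ×ˢ (Icc 0 c.a ×ˢ Icc 0 c.b)) :=
    (c.continuousOn_L₁.comp continuousOn_fst fun p hp => hp.1).sub (by fun_prop)
  have hc2 : ContinuousOn (fun p : ℝ × (ℝ × ℝ) => c.L₂ p.1 - p.2.2)
      (Icc 0 c.ℓ ×ˢ (Icc 0 c.a ×ˢ Icc 0 c.b)) :=
    (c.continuousOn_L₂.comp continuousOn_fst fun p hp => hp.1).sub (by fun_prop)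
  have h1 := hc1.preimage_isClosed_of_isClosed hK.isClosed isClosed_Ici (t := Ici (0 : ℝ))
  have h2 := hc2.preimage_isClosed_of_isClosed hK.isClosed isClosed_Ici (t := Ici (0 : ℝ))
  have h3 := (hK.of_isClosed_subset (h1.inter h2) (fun p hp => hp.1.1)).image continuous_snd
  convert h3 using 1
  ext z
  constructor
  · rintro ⟨hz1, hz2, m, hm, h1, h2⟩
    have hb : (m, z) ∈ Icc 0 c.ℓ ×ˢ (Icc 0 c.a ×ˢ Icc 0 c.b) :=
      ⟨hm, ⟨hz1, h1.trans (c.L₁_mem hm).2⟩, ⟨hz2, h2.trans (c.L₂_mem hm).2⟩⟩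
    exact ⟨(m, z), ⟨⟨hb, sub_nonneg.2 h1⟩, ⟨hb, sub_nonneg.2 h2⟩⟩, rfl⟩
  · rintro ⟨⟨m, w⟩, ⟨⟨hb, h1⟩, ⟨-, h2⟩⟩, rfl⟩
    exact ⟨hb.2.1.1, hb.2.2.1, m, hb.1, sub_nonneg.1 h1, sub_nonneg.1 h2⟩

theorem isStaircase_G : IsStaircase c.G c.a c.b where
  measurableSet := c.isCompact_G.measurableSet
  nonneg z hz := ⟨hz.1, hz.2.1⟩
  le z hz := by
    obtain ⟨m, hm, h1, h2⟩ := hz.2.2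
    exact ⟨h1.trans (c.L₁_mem hm).2, h2.trans (c.L₂_mem hm).2⟩
  lower z hz w hw := by
    obtain ⟨m, hm, h1, h2⟩ := hz.2.2
    exact ⟨hw.1.1, hw.2.1, m, hm, hw.1.2.trans h1, hw.2.2.trans h2⟩

/-- By monotonicity L₂ is constant between m' and m, and a one-sided derivative determines the
derivative at m. This and its counterpart for L₁ deal with horizontal and vertical pieces of the
curve, where the coordinates are not strictly monotone. -/
theorem deriv_L₂_eq_zero_of_left {m m' : ℝ} (hm : m ∈ c.smooth) (hm' : m' ∈ Icc 0 c.ℓ)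
    (hlt : m' < m) (heq : c.L₂ m ≤ c.L₂ m') : deriv c.L₂ m = 0 := by
  have h1 := (c.hasDerivAt_L₂ hm).hasDerivWithinAt (s := Icc m' m)
  have h2 : HasDerivWithinAt c.L₂ 0 (Icc m' m) m := by
    refine (hasDerivWithinAt_const m (Icc m' m) (c.L₂ m)).congr (fun x hx => ?_) rfl
    have hx' : x ∈ Icc 0 c.ℓ := ⟨hm'.1.trans hx.1, hx.2.trans hm.1.2⟩
    exact le_antisymm (c.monotone_L₂ hx' hm.1 hx.2) (heq.trans (c.monotone_L₂ hm' hx' hx.1))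
  exact (uniqueDiffOn_Icc hlt m ⟨hlt.le, le_rfl⟩).eq_deriv _ h1 h2

theorem deriv_L₁_eq_zero_of_right {m m' : ℝ} (hm : m ∈ c.smooth) (hm' : m' ∈ Icc 0 c.ℓ)
    (hlt : m < m') (heq : c.L₁ m ≤ c.L₁ m') : deriv c.L₁ m = 0 := by
  have h1 := (c.hasDerivAt_L₁ hm).hasDerivWithinAt (s := Icc m m')
  have h2 : HasDerivWithinAt c.L₁ 0 (Icc m m') m := by
    refine (hasDerivWithinAt_const m (Icc m m') (c.L₁ m)).congr (fun x hx => ?_) rfl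
    have hx' : x ∈ Icc 0 c.ℓ := ⟨hm.1.1.trans hx.1, hx.2.trans hm'.2⟩
    exact le_antisymm (c.antitone_L₁ hm.1 hx' hx.1) (heq.trans (c.antitone_L₁ hx' hm' hx.2))
  exact (uniqueDiffOn_Icc hlt m ⟨le_rfl, hlt.le⟩).eq_deriv _ h1 h2

theorem deriv_L₂_nonneg {m : ℝ} (hm : m ∈ c.smooth) : 0 ≤ deriv c.L₂ m := by
  rw [← derivWithin_of_mem_nhds (c.smooth_mem_nhds hm)]
  exact c.monotone_L₂.derivWithin_nonneg

theorem deriv_L₁_nonpos {m : ℝ} (hm : m ∈ c.smooth) : deriv c.L₁ m ≤ 0 := by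
  rw [← derivWithin_of_mem_nhds (c.smooth_mem_nhds hm)]
  exact c.antitone_L₁.derivWithin_nonpos

theorem smooth_ae_eq : c.smooth =ᵐ[volume] Icc 0 c.ℓ :=
  sdiff_null_ae_eq_self ((finite_range _).measure_zero _)

/-- The intermediate value theorem gives all of [0,b] as the image of the closed parameter interval;
removing the vertices costs at most finitely many heights. -/
theorem image_L₂_ae_eq : (c.L₂ '' c.smooth : Set ℝ) =ᵐ[volume] Icc 0 c.b := by
  have hfin : (c.L₂ '' Set.range c.vert).Finite := (finite_range _).image _
  have himg : c.L₂ '' Icc 0 c.ℓ = Icc 0 c.b := by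
    refine Subset.antisymm (image_subset_iff.2 fun m hm => c.L₂_mem hm) ?_
    have := intermediate_value_Icc c.ℓ_pos.le c.continuousOn_L₂
    rwa [c.start_eq.2, c.end_eq.2] at this
  refine (LE.le.eventuallyLE (himg ▸ image_mono sdiff_subset)).antisymm ?_
  have h1 : Icc 0 c.b ⊆ c.L₂ '' c.smooth ∪ c.L₂ '' Set.range c.vert := by
    rw [← himg, ← image_union]
    exact image_mono fun m hm => by
      by_cases h : m ∈ Set.range c.vert
      · exact Or.inr h
      · exact Or.inl ⟨hm, h⟩
  exact (h1.eventuallyLE).trans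
    (union_ae_eq_left_of_ae_eq_empty (ae_eq_empty.2 (hfin.measure_zero _))).le

theorem image_L₁_ae_eq : (c.L₁ '' c.smooth : Set ℝ) =ᵐ[volume] Icc 0 c.a := by
  have hfin : (c.L₁ '' Set.range c.vert).Finite := (finite_range _).image _
  have himg : c.L₁ '' Icc 0 c.ℓ = Icc 0 c.a := by
    refine Subset.antisymm (image_subset_iff.2 fun m hm => c.L₁_mem hm) ?_
    have := intermediate_value_Icc' c.ℓ_pos.le c.continuousOn_L₁
    rwa [c.start_eq.1, c.end_eq.1] at this
  refine (LE.le.eventuallyLE (himg ▸ image_mono sdiff_subset)).antisymm ?_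
  have h1 : Icc 0 c.a ⊆ c.L₁ '' c.smooth ∪ c.L₁ '' Set.range c.vert := by
    rw [← himg, ← image_union]
    exact image_mono fun m hm => by
      by_cases h : m ∈ Set.range c.vert
      · exact Or.inr h
      · exact Or.inl ⟨hm, h⟩
  exact (h1.eventuallyLE).trans
    (union_ae_eq_left_of_ae_eq_empty (ae_eq_empty.2 (hfin.measure_zero _))).le

variable {F : Type*} [NormedAddCommGroup F] [NormedSpace ℝ F]

/-- Integration over `G` along horizontal sections, as an integral over the curve. -/
theorem integral_G_horizontal {φ β : ℝ × ℝ → F} (hφ : IntegrableOn φ c.G)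
    (hβ : ∀ᵐ t : ℝ, ∀ σ, (σ, t) ∈ c.G → int₁ φ (σ, t) = β (σ, t)) :
    IntegrableOn (fun m => deriv c.L₂ m • β (c.pt m)) c.smooth ∧
      ∫ z in c.G, φ z = ∫ m in c.smooth, deriv c.L₂ m • β (c.pt m) := by
  have hd : ∀ m ∈ c.smooth, HasDerivWithinAt c.L₂ (deriv c.L₂ m) c.smooth m := fun m hm =>
    (c.hasDerivAt_L₂ hm).hasDerivWithinAt
  have hmono : MonotoneOn c.L₂ c.smooth := c.monotone_L₂.mono sdiff_subset
  refine integral_section_boundary c.isStaircase_G c.isCompact_G (fun t ht => ?_)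
    c.measurableSet_smooth (f := c.L₂) (A := c.L₁) (fun m hm => c.L₂_mem hm.1) (fun g => ?_)
    (fun g => ?_) (fun m hm hw σ => ?_) hφ hβ
  · refine ⟨0, le_rfl, ht.1, c.ℓ, c.right_mem, c.end_eq.1.ge, c.end_eq.2 ▸ ht.2⟩
  · rw [← integrableOn_image_iff_integrableOn_deriv_smul_of_monotoneOn c.measurableSet_smooth hd
      hmono]
    exact integrableOn_congr_set_ae c.image_L₂_ae_eq.symm
  · rw [← integral_image_eq_integral_deriv_smul_of_monotoneOn c.measurableSet_smooth hd hmono]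
    exact setIntegral_congr_set c.image_L₂_ae_eq.symm
  · constructor
    · rintro ⟨h1, h2, m', hm', h3, h4⟩
      refine ⟨h1, ?_⟩
      -- A witness m' to the left of m would make L₂ constant up to m, so that the speed at m is
      -- zero; this is excluded. A witness to the right has a smaller L₁.
      rcases lt_or_ge m' m with h | h
      · exact absurd (c.deriv_L₂_eq_zero_of_left hm hm' h h4) hw
      · exact h3.trans (c.antitone_L₁ hm.1 hm' h)
    · intro h
      exact ⟨h.1, (c.L₂_mem hm.1).1, m, hm.1, h.2, le_rfl⟩

/-- Integration over `G` along vertical sections, as an integral over the curve. -/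
theorem integral_G_vertical {φ β : ℝ × ℝ → F} (hφ : IntegrableOn φ c.G)
    (hβ : ∀ᵐ s : ℝ, ∀ τ, (s, τ) ∈ c.G → int₂ φ (s, τ) = β (s, τ)) :
    IntegrableOn (fun m => (-deriv c.L₁ m) • β (c.pt m)) c.smooth ∧
      ∫ z in c.G, φ z = ∫ m in c.smooth, (-deriv c.L₁ m) • β (c.pt m) := by
  have hd : ∀ m ∈ c.smooth, HasDerivWithinAt c.L₁ (deriv c.L₁ m) c.smooth m := fun m hm =>
    (c.hasDerivAt_L₁ hm).hasDerivWithinAt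
  have hmono : AntitoneOn c.L₁ c.smooth := c.antitone_L₁.mono sdiff_subset
  have hsw : IntegrableOn (φ ∘ Prod.swap) (Prod.swap ⁻¹' c.G) := by
    rw [Measure.volume_eq_prod] at hφ ⊢
    exact (Measure.measurePreserving_swap.integrableOn_comp_preimage
      MeasurableEquiv.prodComm.measurableEmbedding).2 hφ
  have key := integral_section_boundary c.isStaircase_G.swap
    ((Homeomorph.prodComm ℝ ℝ).isCompact_preimage.2 c.isCompact_G) (fun t ht => ?_)
    c.measurableSet_smooth (f := c.L₁) (A := c.L₂) (w := fun m => -deriv c.L₁ m)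
    (fun m hm => c.L₁_mem hm.1) (fun g => ?_)
    (fun g => ?_) (fun m hm hw σ => ?_) hsw (β := β ∘ Prod.swap) hβ
  · refine ⟨key.1, ?_⟩
    rw [← show _ = ∫ m in c.smooth, (-deriv c.L₁ m) • β (c.pt m) from key.2,
      Measure.volume_eq_prod]
    exact (Measure.measurePreserving_swap.setIntegral_preimage_emb
      MeasurableEquiv.prodComm.measurableEmbedding φ c.G).symm
  · exact ⟨0, ht.1, le_rfl, 0, c.left_mem, c.start_eq.1 ▸ ht.2, c.start_eq.2.ge⟩
  · rw [← integrableOn_image_iff_integrableOn_deriv_smul_of_antitoneOn c.measurableSet_smooth hd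
      hmono]
    exact integrableOn_congr_set_ae c.image_L₁_ae_eq.symm
  · rw [← integral_image_eq_integral_deriv_smul_of_antitoneOn c.measurableSet_smooth hd hmono]
    exact setIntegral_congr_set c.image_L₁_ae_eq.symm
  · constructor
    · rintro ⟨h1, h2, m', hm', h3, h4⟩
      refine ⟨h2, ?_⟩
      rcases le_or_gt m' m with h | h
      · exact h4.trans (c.monotone_L₂ hm' hm.1 h)
      · exact absurd (c.deriv_L₁_eq_zero_of_right hm hm' h h3) (neg_ne_zero.1 hw)
    · intro h
      exact ⟨(c.L₁_mem hm.1).1, h.1, m, hm.1, le_rfl, h.2⟩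

/-- The tangential derivative along the curve of a double integral of `k`. -/
def traceDeriv (k : ℝ × ℝ → F) (m : ℝ) : F :=
  deriv c.L₁ m • int₂ k (c.pt m) + deriv c.L₂ m • int₁ k (c.pt m)

theorem integrableOn_smooth_int₁ {k : ℝ × ℝ → F} (hk : IsDensity c.G k) :
    IntegrableOn (fun m => deriv c.L₂ m • int₁ k (c.pt m)) c.smooth ∧
      ∫ z in c.G, k z = ∫ m in c.smooth, deriv c.L₂ m • int₁ k (c.pt m) :=
  c.integral_G_horizontal (hk.integrable c.isStaircase_G).integrableOn
    (ae_of_all _ fun _ _ _ => rfl)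

theorem integrableOn_smooth_int₂ {k : ℝ × ℝ → F} (hk : IsDensity c.G k) :
    IntegrableOn (fun m => (-deriv c.L₁ m) • int₂ k (c.pt m)) c.smooth ∧
      ∫ z in c.G, k z = ∫ m in c.smooth, (-deriv c.L₁ m) • int₂ k (c.pt m) :=
  c.integral_G_vertical (hk.integrable c.isStaircase_G).integrableOn
    (ae_of_all _ fun _ _ _ => rfl)

theorem integrableOn_traceDeriv {k : ℝ × ℝ → F} (hk : IsDensity c.G k) :
    IntegrableOn (c.traceDeriv k) c.smooth := by
  have := (c.integrableOn_smooth_int₁ hk).1.sub (c.integrableOn_smooth_int₂ hk).1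
  refine this.congr (ae_of_all _ fun m => ?_)
  simp only [Pi.sub_apply, traceDeriv, neg_smul]
  abel

theorem intervalIntegrable_traceDeriv {k : ℝ × ℝ → F} (hk : IsDensity c.G k) {m m' : ℝ}
    (hm : m ∈ Icc 0 c.ℓ) (hm' : m' ∈ Icc 0 c.ℓ) :
    IntervalIntegrable (c.traceDeriv k) volume m m' := by
  have : IntegrableOn (c.traceDeriv k) (Icc 0 c.ℓ) :=
    (integrableOn_congr_set_ae c.smooth_ae_eq).1 (c.integrableOn_traceDeriv hk)
  rw [intervalIntegrable_iff]
  exact this.mono_set (uIoc_subset_uIcc.trans (uIcc_subset_Icc hm hm'))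

/-- Each of the two terms of the tangential derivative, with norms inside, is the area integral of
‖k‖ rewritten over the curve. Hence the tangential variation is O(ε²) in the mean although it is
only O(ε) pointwise. -/
theorem integral_norm_traceDeriv_le {k : ℝ × ℝ → F} (hk : IsDensity c.G k) :
    ∫ m in c.smooth, ‖c.traceDeriv k m‖ ≤ 2 * ∫ z, ‖k z‖ := by
  have h1 := c.integrableOn_smooth_int₁ hk.norm
  have h2 := c.integrableOn_smooth_int₂ hk.norm
  have e : ∫ z in c.G, ‖k z‖ = ∫ z, ‖k z‖ :=
    setIntegral_eq_integral_of_forall_compl_eq_zero fun z hz => by rw [hk.zero z hz, norm_zero]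
  have hadd := integral_add h2.1 h1.1
  rw [← h1.2, ← h2.2, e] at hadd
  rw [two_mul, ← hadd]
  refine setIntegral_mono_on (c.integrableOn_traceDeriv hk).norm (h2.1.add h1.1)
    c.measurableSet_smooth fun m hm => ?_
  have a1 := c.deriv_L₁_nonpos hm
  have a2 := c.deriv_L₂_nonneg hm
  have b1 := norm_int₁_le_int₁_norm k (c.pt m)
  have b2 := norm_int₂_le_int₂_norm k (c.pt m)
  refine (norm_add_le _ _).trans ?_
  rw [norm_smul, norm_smul, Real.norm_of_nonpos a1, Real.norm_of_nonneg a2]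
  have : 0 ≤ -deriv c.L₁ m := neg_nonneg.2 a1
  simp only [smul_eq_mul]
  gcongr

/-- No differentiation along the curve is needed: the rectangle below a curve point is a difference
of two parts of G, one integrated over vertical and the other over horizontal sections. Both become
curve integrals over the parameters from m to ℓ. -/
theorem int₁₂_pt {k : ℝ × ℝ → F} (hk : IsDensity c.G k) {m : ℝ} (hm : m ∈ Icc 0 c.ℓ) :
    int₁₂ k (c.pt m) = -∫ μ in m..c.ℓ, c.traceDeriv k μ := by
  have hS : MeasurableSet {z : ℝ × ℝ | z.1 ≤ c.L₁ m} := measurableSet_le (by fun_prop) (by fun_prop)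
  have hT : MeasurableSet {z : ℝ × ℝ | c.L₂ m < z.2} := measurableSet_lt (by fun_prop) (by fun_prop)
  have hind : ∀ {S : Set (ℝ × ℝ)}, MeasurableSet S → IsDensity c.G (S.indicator k) := by
    intro S hS
    obtain ⟨C, h0, hC⟩ := hk.bdd
    refine ⟨hk.sm.indicator hS, fun z hz => ?_, C, h0, fun z => ?_⟩
    · exact norm_le_zero_iff.1 ((norm_indicator_le_norm_self _ _).trans (by rw [hk.zero z hz, norm_zero]))
    · exact (norm_indicator_le_norm_self _ _).trans (hC z)
  have d1 := hind hS
  have d2 := hind hT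
  -- A point of G above height L₂ m is covered by a later curve point, so it already lies to the
  -- left of L₁ m: inside G the second set is contained in the first.
  have hsub : ∀ z ∈ c.G, {z : ℝ × ℝ | z.1 ≤ c.L₁ m}.indicator k z -
      {z : ℝ × ℝ | c.L₂ m < z.2}.indicator k z = (W (c.pt m)).indicator k z := by
    rintro z ⟨h1, h2, m', hm', h3, h4⟩
    by_cases ht : c.L₂ m < z.2
    · have hlt : m < m' := by
        by_contra hcon
        exact absurd (h4.trans (c.monotone_L₂ hm' hm (not_lt.1 hcon))) (not_le.2 ht)
      have hs : z.1 ≤ c.L₁ m := h3.trans (c.antitone_L₁ hm hm' hlt.le)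
      rw [indicator_of_mem (show z ∈ {z : ℝ × ℝ | z.1 ≤ c.L₁ m} from hs),
        indicator_of_mem (show z ∈ {z : ℝ × ℝ | c.L₂ m < z.2} from ht), sub_self,
        indicator_of_notMem fun h' : z ∈ W (c.pt m) => absurd h'.2.2 (not_le.2 ht)]
    · rw [indicator_of_notMem (show z ∉ {z : ℝ × ℝ | c.L₂ m < z.2} from ht), sub_zero]
      by_cases hs : z.1 ≤ c.L₁ m
      · rw [indicator_of_mem (show z ∈ {z : ℝ × ℝ | z.1 ≤ c.L₁ m} from hs),
          indicator_of_mem (show z ∈ W (c.pt m) from ⟨⟨h1, hs⟩, ⟨h2, not_lt.1 ht⟩⟩)]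
      · rw [indicator_of_notMem (show z ∉ {z : ℝ × ℝ | z.1 ≤ c.L₁ m} from hs),
          indicator_of_notMem fun h' : z ∈ W (c.pt m) => hs h'.1.2]
  have lhs : int₁₂ k (c.pt m) = ∫ z in c.G, {z : ℝ × ℝ | z.1 ≤ c.L₁ m}.indicator k z -
      {z : ℝ × ℝ | c.L₂ m < z.2}.indicator k z := by
    rw [setIntegral_congr_fun c.isStaircase_G.measurableSet hsub,
      setIntegral_indicator (measurableSet_W _),
      inter_eq_right.2 (c.isStaircase_G.lower _ (c.pt_mem_G hm))]
    rfl
  rw [lhs, integral_sub (d1.integrable c.isStaircase_G).integrableOn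
    (d2.integrable c.isStaircase_G).integrableOn, (c.integrableOn_smooth_int₂ d1).2,
    (c.integrableOn_smooth_int₁ d2).2]
  -- Before m the vertical section at μ lies strictly to the right of L₁ m and contributes nothing,
  -- unless L₁ is constant between μ and m, in which case its derivative at μ vanishes. After m the
  -- whole section counts.
  have e1 : ∀ μ ∈ c.smooth, (-deriv c.L₁ μ) •
      int₂ ({z : ℝ × ℝ | z.1 ≤ c.L₁ m}.indicator k) (c.pt μ) =
      (Ici m).indicator (fun μ => (-deriv c.L₁ μ) • int₂ k (c.pt μ)) μ := by
    intro μ hμ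
    rcases lt_or_ge μ m with h | h
    · rw [indicator_of_notMem (show μ ∉ Ici m from not_le.2 h)]
      by_cases hle : c.L₁ μ ≤ c.L₁ m
      · rw [c.deriv_L₁_eq_zero_of_right hμ hm h hle, neg_zero, zero_smul]
      · have : int₂ ({z : ℝ × ℝ | z.1 ≤ c.L₁ m}.indicator k) (c.pt μ) = 0 :=
          integral_eq_zero_of_ae (ae_of_all _ fun τ => indicator_of_notMem
            (show (c.L₁ μ, τ) ∉ {z : ℝ × ℝ | z.1 ≤ c.L₁ m} from hle) _)
        rw [this, smul_zero]
    · rw [indicator_of_mem (show μ ∈ Ici m from h)]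
      congr 1
      refine integral_congr_ae (ae_of_all _ fun τ => indicator_of_mem ?_ _)
      exact c.antitone_L₁ hm hμ.1 h
  have e2 : ∀ μ ∈ c.smooth, deriv c.L₂ μ •
      int₁ ({z : ℝ × ℝ | c.L₂ m < z.2}.indicator k) (c.pt μ) =
      (Ioi m).indicator (fun μ => deriv c.L₂ μ • int₁ k (c.pt μ)) μ := by
    intro μ hμ
    rcases le_or_gt μ m with h | h
    · rw [indicator_of_notMem (show μ ∉ Ioi m from not_lt.2 h)]
      have : int₁ ({z : ℝ × ℝ | c.L₂ m < z.2}.indicator k) (c.pt μ) = 0 :=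
        integral_eq_zero_of_ae (ae_of_all _ fun τ => indicator_of_notMem
          (show (τ, c.L₂ μ) ∉ {z : ℝ × ℝ | c.L₂ m < z.2} from
            not_lt.2 (c.monotone_L₂ hμ.1 hm h)) _)
      rw [this, smul_zero]
    · rw [indicator_of_mem (show μ ∈ Ioi m from h)]
      by_cases hle : c.L₂ μ ≤ c.L₂ m
      · rw [c.deriv_L₂_eq_zero_of_left hμ hm h hle, zero_smul, zero_smul]
      · congr 1
        exact integral_congr_ae (ae_of_all _ fun τ => indicator_of_mem
          (show (τ, c.L₂ μ) ∈ {z : ℝ × ℝ | c.L₂ m < z.2} from not_le.1 hle) _)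
  have hset : (Icc 0 c.ℓ ∩ Ici m : Set ℝ) = Icc m c.ℓ := by
    ext x
    exact ⟨fun h => ⟨h.2, h.1.2⟩, fun h => ⟨⟨hm.1.trans h.1, h.2⟩, h.1⟩⟩
  have hset' : (Icc 0 c.ℓ ∩ Ioi m : Set ℝ) = Ioc m c.ℓ := by
    ext x
    exact ⟨fun h => ⟨h.2, h.1.2⟩, fun h => ⟨⟨hm.1.trans h.1.le, h.2⟩, h.1⟩⟩
  have s1 : (c.smooth ∩ Ici m : Set ℝ) =ᵐ[volume] Ioc m c.ℓ :=
    (hset ▸ c.smooth_ae_eq.inter (ae_eq_refl _)).trans Ioc_ae_eq_Icc.symm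
  have s2 : (c.smooth ∩ Ioi m : Set ℝ) =ᵐ[volume] Ioc m c.ℓ :=
    hset' ▸ c.smooth_ae_eq.inter (ae_eq_refl _)
  rw [setIntegral_congr_fun c.measurableSet_smooth e1,
    setIntegral_congr_fun c.measurableSet_smooth e2, setIntegral_indicator measurableSet_Ici,
    setIntegral_indicator measurableSet_Ioi, setIntegral_congr_set s1, setIntegral_congr_set s2,
    intervalIntegral.integral_of_le hm.2]
  have i1 : IntegrableOn (fun μ => (-deriv c.L₁ μ) • int₂ k (c.pt μ)) (Ioc m c.ℓ) :=
    (integrableOn_congr_set_ae s1).1 ((c.integrableOn_smooth_int₂ hk).1.mono_set inter_subset_left)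
  have i2 : IntegrableOn (fun μ => deriv c.L₂ μ • int₁ k (c.pt μ)) (Ioc m c.ℓ) :=
    (integrableOn_congr_set_ae s2).1 ((c.integrableOn_smooth_int₁ hk).1.mono_set inter_subset_left)
  rw [← integral_sub i1 i2, ← integral_neg]
  refine integral_congr_ae (ae_of_all _ fun μ => ?_)
  simp only [traceDeriv, neg_smul]
  abel

/-- The double integral of `k` along the curve is the integral of its tangential derivative. -/
theorem int₁₂_pt_sub {k : ℝ × ℝ → F} (hk : IsDensity c.G k) {m m' : ℝ} (hm : m ∈ Icc 0 c.ℓ)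
    (hm' : m' ∈ Icc 0 c.ℓ) :
    int₁₂ k (c.pt m') = int₁₂ k (c.pt m) + ∫ μ in m..m', c.traceDeriv k μ := by
  rw [c.int₁₂_pt hk hm, c.int₁₂_pt hk hm', ← intervalIntegral.integral_add_adjacent_intervals
    (c.intervalIntegrable_traceDeriv hk hm hm') (c.intervalIntegrable_traceDeriv hk hm' c.right_mem)]
  abel

end Curve

end

end GoursatControl

namespace GoursatControl

noncomputable section

open Filter Topology

/-! ### Integration by parts -/

section ibp

variable {n : ℕ}

theorem covec_apply_eq_sum (φ : Covec n) (v : Vec n) :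
    φ v = ∑ i, φ (EuclideanSpace.single i 1) * v i := by
  conv_lhs => rw [← (EuclideanSpace.basisFun (Fin n) ℝ).sum_repr v]
  simp [map_sum, mul_comm]

theorem covec_eq_sum (φ : Covec n) :
    φ = ∑ i, φ (EuclideanSpace.single i 1) • (EuclideanSpace.proj i : Covec n) := by
  ext v
  rw [covec_apply_eq_sum φ v]
  simp

theorem _root_.AbsolutelyContinuousOnInterval.clm_apply_const {F F' : Type*} [NormedAddCommGroup F]
    [NormedSpace ℝ F] [NormedAddCommGroup F'] [NormedSpace ℝ F'] {f : ℝ → F →L[ℝ] F'} {s t : ℝ}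
    (hf : AbsolutelyContinuousOnInterval f s t) (v : F) :
    AbsolutelyContinuousOnInterval (fun x => f x v) s t := by
  have h := Tendsto.const_mul ‖v‖ hf
  rw [mul_zero] at h
  refine squeeze_zero (fun E => Finset.sum_nonneg fun _ _ => dist_nonneg) (fun E => ?_) h
  rw [Finset.mul_sum]
  refine Finset.sum_le_sum fun i _ => ?_
  rw [dist_eq_norm, dist_eq_norm, ← sub_apply, mul_comm]
  exact ContinuousLinearMap.le_opNorm _ _

variable {f : ℝ → Covec n} {s t : ℝ}

/-- Lebesgue's theorem for each coordinate; a row vector has finitely many coordinates, so the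
exceptional null sets can be joined. -/
theorem ae_differentiableAt_of_ac (hf : AbsolutelyContinuousOnInterval f s t) :
    ∀ᵐ x, x ∈ uIcc s t → DifferentiableAt ℝ f x := by
  have h : ∀ᵐ x, ∀ i : Fin n, x ∈ uIcc s t →
      DifferentiableAt ℝ (fun x => f x (EuclideanSpace.single i 1)) x :=
    ae_all_iff.2 fun i => (hf.clm_apply_const _).ae_differentiableAt
  filter_upwards [h] with x hx hxs
  have e : f = fun x => ∑ i, f x (EuclideanSpace.single i 1) • (EuclideanSpace.proj i : Covec n) :=
    funext fun x => covec_eq_sum (f x)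
  rw [e]
  exact DifferentiableAt.fun_sum fun i _ => (hx i hxs).smul_const _

theorem deriv_clm_apply_const {F F' : Type*} [NormedAddCommGroup F]
    [NormedSpace ℝ F] [NormedAddCommGroup F'] [NormedSpace ℝ F'] {f : ℝ → F →L[ℝ] F'} {x : ℝ}
    (hf : DifferentiableAt ℝ f x) (v : F) :
    deriv (fun y => f y v) x = deriv f x v := by
  have h : HasDerivAt (fun y => f y v) (deriv f x v) x :=
    (ContinuousLinearMap.apply ℝ F' v).hasFDerivAt.comp_hasDerivAt x hf.hasDerivAt
  exact h.deriv

theorem intervalIntegrable_deriv_of_ac (hf : AbsolutelyContinuousOnInterval f s t) :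
    IntervalIntegrable (deriv f) volume s t := by
  have hd : ∀ i : Fin n, Integrable (deriv fun y => f y (EuclideanSpace.single i 1))
      (volume.restrict (uIoc s t)) := fun i =>
    intervalIntegrable_iff.1 (hf.clm_apply_const (EuclideanSpace.single i 1)).intervalIntegrable_deriv
  rw [intervalIntegrable_iff]
  refine Integrable.mono' (integrable_finsetSum Finset.univ fun i _ => (hd i).norm)
    (stronglyMeasurable_deriv f).aestronglyMeasurable ?_
  rw [ae_restrict_iff' measurableSet_uIoc]
  filter_upwards [ae_differentiableAt_of_ac hf] with x hx hxs
  simp only [deriv_clm_apply_const (hx (uIoc_subset_uIcc hxs))]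
  refine ContinuousLinearMap.opNorm_le_bound _ (Finset.sum_nonneg fun i _ => norm_nonneg _)
    fun v => ?_
  rw [covec_apply_eq_sum, Finset.sum_mul]
  refine (norm_sum_le _ _).trans (Finset.sum_le_sum fun i _ => ?_)
  rw [norm_mul]
  gcongr
  exact PiLp.norm_apply_le v i

/-- Integration by parts for a row vector times a column vector. -/
theorem integral_covec_apply_by_parts (hf : AbsolutelyContinuousOnInterval f s t) {g g' : ℝ → Vec n}
    (hg' : IntervalIntegrable g' volume s t)
    (hg : ∀ x ∈ uIcc s t, g x = g s + ∫ y in s..x, g' y) :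
    ∫ x in s..t, (f x (g' x) + deriv f x (g x)) = f t (g t) - f s (g s) := by
  have hpi : ∀ i : Fin n, IntervalIntegrable (fun x => g' x i) volume s t := fun i =>
    ⟨(EuclideanSpace.proj i : Vec n →L[ℝ] ℝ).integrable_comp hg'.1,
      (EuclideanSpace.proj i : Vec n →L[ℝ] ℝ).integrable_comp hg'.2⟩
  -- The coordinates of g are replaced by primitives defined on the whole line, which are absolutely
  -- continuous; they agree with the coordinates of g on the interval only.
  set γ : Fin n → ℝ → ℝ := fun i x => g s i + ∫ y in s..x, g' y i with hγ
  have hγg : ∀ i, ∀ x ∈ uIcc s t, γ i x = g x i := by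
    intro i x hx
    have hsub : IntervalIntegrable g' volume s x :=
      hg'.mono_set (uIcc_subset_uIcc left_mem_uIcc hx)
    have := (EuclideanSpace.proj i : Vec n →L[ℝ] ℝ).intervalIntegral_comp_comm hsub
    simp only [hγ, hg x hx]
    change _ + _ = g s i + EuclideanSpace.proj i (∫ y in s..x, g' y)
    rw [← this]
    rfl
  have hγac : ∀ i, AbsolutelyContinuousOnInterval (γ i) s t := fun i => by
    have h1 : AbsolutelyContinuousOnInterval (fun _ : ℝ => g s i) s t :=
      (LipschitzWith.const (g s i)).lipschitzOnWith.absolutelyContinuousOnInterval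
    exact h1.add ((hpi i).absolutelyContinuousOnInterval_intervalIntegral left_mem_uIcc)
  have hfi : ∀ i : Fin n, AbsolutelyContinuousOnInterval
      (fun x => f x (EuclideanSpace.single i 1)) s t := fun i => hf.clm_apply_const _
  have hint : ∀ i : Fin n, IntervalIntegrable (fun x =>
      deriv (fun y => f y (EuclideanSpace.single i 1)) x * γ i x +
      f x (EuclideanSpace.single i 1) * g' x i) volume s t := fun i =>
    ((hfi i).intervalIntegrable_deriv.mul_continuousOn (hγac i).continuousOn).add
      ((hpi i).continuousOn_mul (hfi i).continuousOn)
  have hcoord : ∀ i : Fin n, ∫ x in s..t, (deriv (fun y => f y (EuclideanSpace.single i 1)) x * γ i x +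
      f x (EuclideanSpace.single i 1) * g' x i) =
      f t (EuclideanSpace.single i 1) * γ i t - f s (EuclideanSpace.single i 1) * γ i s := by
    intro i
    rw [← (hfi i).integral_deriv_mul_eq_sub (hγac i)]
    -- The primitive has derivative g' only almost everywhere, by Lebesgue differentiation; this
    -- suffices under the integral.
    refine intervalIntegral.integral_congr_ae ?_
    filter_upwards [(hpi i).ae_hasDerivAt_integral] with x hx hxs
    have := ((hx (uIoc_subset_uIcc hxs) s left_mem_uIcc).const_add (g s i)).deriv
    rw [this]
  have e : ∀ᵐ x, x ∈ uIoc s t → f x (g' x) + deriv f x (g x) =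
      ∑ i, (deriv (fun y => f y (EuclideanSpace.single i 1)) x * γ i x +
      f x (EuclideanSpace.single i 1) * g' x i) := by
    filter_upwards [ae_differentiableAt_of_ac hf] with x hx hxs
    rw [covec_apply_eq_sum (f x), covec_apply_eq_sum (deriv f x), ← Finset.sum_add_distrib]
    refine Finset.sum_congr rfl fun i _ => ?_
    rw [deriv_clm_apply_const (hx (uIoc_subset_uIcc hxs)), hγg i x (uIoc_subset_uIcc hxs)]
    ring
  rw [intervalIntegral.integral_congr_ae e, intervalIntegral.integral_finsetSum fun i _ => hint i,
    Finset.sum_congr rfl fun i _ => hcoord i, Finset.sum_sub_distrib,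
    covec_apply_eq_sum (f t), covec_apply_eq_sum (f s)]
  simp only [hγg _ _ left_mem_uIcc, hγg _ _ right_mem_uIcc]

end ibp

/-! ### Integration by parts over the region and along the curve -/

section duality

variable {n N : ℕ} (c : Curve N)

theorem integrableOn_clm_apply_density {F F' : Type*} [NormedAddCommGroup F] [NormedSpace ℝ F]
    [NormedAddCommGroup F'] [NormedSpace ℝ F'] {α : Type*} [MeasurableSpace α] {μ : Measure α}
    {u : α → F →L[ℝ] F'} (hu : Integrable u μ) {v : α → F} (hv : AEStronglyMeasurable v μ)
    {C : ℝ} (hC : ∀ᵐ z ∂μ, ‖v z‖ ≤ C) : Integrable (fun z => u z (v z)) μ := by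
  refine (hu.norm.mul_const C).mono' (isBoundedBilinearMap_apply.continuous.comp_aestronglyMeasurable
    (hu.aestronglyMeasurable.prodMk hv)) ?_
  filter_upwards [hC] with z hz
  exact ((u z).le_opNorm _).trans (by gcongr)

namespace IsDensity

variable {V : Type*} [NormedAddCommGroup V] [NormedSpace ℝ V] {G : Set (ℝ × ℝ)} {a b : ℝ}
  {k : ℝ × ℝ → V}

theorem int₁₂_horiz (hG : IsStaircase G a b) (hk : IsDensity G k) {s t σ : ℝ} (h : (s, t) ∈ G)
    (hσ : σ ∈ Icc 0 s) : int₁₂ k (σ, t) = ∫ y in (0 : ℝ)..σ, int₂ k (y, t) := by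
  rw [hk.int₁₂_eq hG, int₁, integral_Icc_eq_integral_Ioc, intervalIntegral.integral_of_le hσ.1]

theorem int₁₂_vert (hG : IsStaircase G a b) (hk : IsDensity G k) {s t τ : ℝ} (h : (s, t) ∈ G)
    (hτ : τ ∈ Icc 0 t) : int₁₂ k (s, τ) = ∫ y in (0 : ℝ)..τ, int₁ k (s, y) := by
  rw [hk.int₁₂_eq' hG, int₂, integral_Icc_eq_integral_Ioc, intervalIntegral.integral_of_le hτ.1]

theorem intervalIntegrable_int₂ (hG : IsStaircase G a b) (hk : IsDensity G k) {s t : ℝ}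
    (h : (s, t) ∈ G) : IntervalIntegrable (fun y => int₂ k (y, t)) volume 0 s := by
  obtain ⟨C, h0, hC⟩ := hk.bdd_ops hG
  rw [intervalIntegrable_iff, uIoc_of_le (hG.nonneg _ h).1]
  refine Measure.integrableOn_of_bounded (M := C) measure_Ioc_lt_top.ne
    (hk.sm_int₂.comp_measurable (by fun_prop)).aestronglyMeasurable ?_
  exact (ae_restrict_mem measurableSet_Ioc).mono fun y hy =>
    (hC _ (hG.horiz_mem h ⟨hy.1.le, hy.2⟩)).2.1

theorem intervalIntegrable_int₁ (hG : IsStaircase G a b) (hk : IsDensity G k) {s t : ℝ}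
    (h : (s, t) ∈ G) : IntervalIntegrable (fun y => int₁ k (s, y)) volume 0 t := by
  obtain ⟨C, h0, hC⟩ := hk.bdd_ops hG
  rw [intervalIntegrable_iff, uIoc_of_le (hG.nonneg _ h).2]
  refine Measure.integrableOn_of_bounded (M := C) measure_Ioc_lt_top.ne
    (hk.sm_int₁.comp_measurable (by fun_prop)).aestronglyMeasurable ?_
  exact (ae_restrict_mem measurableSet_Ioc).mono fun y hy =>
    (hC _ (hG.vert_mem h ⟨hy.1.le, hy.2⟩)).2.2

theorem bdd_ae {v : ℝ × ℝ → V} (hG : IsStaircase G a b) {C : ℝ} (h : ∀ z ∈ G, ‖v z‖ ≤ C) :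
    ∀ᵐ z ∂volume.restrict G, ‖v z‖ ≤ C :=
  (ae_restrict_mem hG.measurableSet).mono h

theorem integrableOn_of_indicator {u : ℝ × ℝ → V} (hG : IsStaircase G a b)
    (hu : IsDensity G (G.indicator u)) : IntegrableOn u G :=
  (integrable_indicator_iff hG.measurableSet).1 (hu.integrable hG)

end IsDensity

theorem int₁₂_zero_left {V : Type*} [NormedAddCommGroup V] [NormedSpace ℝ V] (k : ℝ × ℝ → V)
    (t : ℝ) : int₁₂ k (0, t) = 0 := by
  rw [int₁₂]
  refine setIntegral_measure_zero _ ?_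
  simp [W, Measure.volume_eq_prod, Measure.prod_prod]

theorem int₁₂_zero_right {V : Type*} [NormedAddCommGroup V] [NormedSpace ℝ V] (k : ℝ × ℝ → V)
    (s : ℝ) : int₁₂ k (s, 0) = 0 := by
  rw [int₁₂]
  refine setIntegral_measure_zero _ ?_
  simp [W, Measure.volume_eq_prod, Measure.prod_prod]

namespace Curve

variable {u : ℝ × ℝ → Covec n} {k : ℝ × ℝ → Vec n}

theorem integrableOn_apply_ops {v : ℝ × ℝ → Covec n} (hv : IntegrableOn v c.G)
    (hk : IsDensity c.G k) :
    IntegrableOn (fun z => v z (int₁₂ k z)) c.G ∧ IntegrableOn (fun z => v z (int₂ k z)) c.G ∧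
      IntegrableOn (fun z => v z (int₁ k z)) c.G := by
  obtain ⟨C, h0, hC⟩ := hk.bdd_ops c.isStaircase_G
  exact ⟨integrableOn_clm_apply_density hv hk.sm_int₁₂.aestronglyMeasurable
      (IsDensity.bdd_ae c.isStaircase_G fun z hz => (hC z hz).1),
    integrableOn_clm_apply_density hv hk.sm_int₂.aestronglyMeasurable
      (IsDensity.bdd_ae c.isStaircase_G fun z hz => (hC z hz).2.1),
    integrableOn_clm_apply_density hv hk.sm_int₁.aestronglyMeasurable
      (IsDensity.bdd_ae c.isStaircase_G fun z hz => (hC z hz).2.2)⟩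

/-- Integration by parts on `G` in the first variable. -/
theorem integral_by_parts_fst (hu : IntegrableOn u c.G) (hk : IsDensity c.G k)
    (hac : ∀ᵐ t : ℝ, ∀ s : ℝ, (s, t) ∈ c.G →
      AbsolutelyContinuousOnInterval (fun σ => u (σ, t)) 0 s)
    (hdu : IntegrableOn (fun z : ℝ × ℝ => deriv (fun σ => u (σ, z.2)) z.1) c.G) :
    IntegrableOn (fun m => deriv c.L₂ m • u (c.pt m) (int₁₂ k (c.pt m))) c.smooth ∧
    ∫ z in c.G, u z (int₂ k z) = (∫ m in c.smooth, deriv c.L₂ m • u (c.pt m) (int₁₂ k (c.pt m))) -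
      ∫ z in c.G, deriv (fun σ => u (σ, z.2)) z.1 (int₁₂ k z) := by
  have hG := c.isStaircase_G
  have i1 := (c.integrableOn_apply_ops hu hk).2.1
  have i2 := (c.integrableOn_apply_ops hdu hk).1
  -- On almost every horizontal section the integrand is the s-derivative of u · X with X = `int₁₂
  -- k`. Since X = 0 on s = 0, only the value on the curve survives.
  have key := c.integral_G_horizontal (i1.add i2) (β := fun z => u z (int₁₂ k z)) (by
    filter_upwards [hac] with t ht s hs
    have hs0 : 0 ≤ s := (hG.nonneg _ hs).1
    have := integral_covec_apply_by_parts (ht s hs) (g := fun y => int₁₂ k (y, t))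
      (g' := fun y => int₂ k (y, t)) (hk.intervalIntegrable_int₂ hG hs) (fun x hx => by
        rw [uIcc_of_le hs0] at hx
        rw [int₁₂_zero_left, zero_add, hk.int₁₂_horiz hG hs hx])
    rw [int₁₂_zero_left, map_zero, sub_zero, intervalIntegral.integral_of_le hs0,
      ← integral_Icc_eq_integral_Ioc] at this
    exact this)
  refine ⟨key.1, ?_⟩
  rw [← key.2]
  have := integral_add i1 i2
  simp only [Pi.add_apply]
  rw [this]
  ring

/-- Integration by parts on `G` in the second variable. -/
theorem integral_by_parts_snd (hu : IntegrableOn u c.G) (hk : IsDensity c.G k)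
    (hac : ∀ᵐ s : ℝ, ∀ t : ℝ, (s, t) ∈ c.G →
      AbsolutelyContinuousOnInterval (fun τ => u (s, τ)) 0 t)
    (hdu : IntegrableOn (fun z : ℝ × ℝ => deriv (fun τ => u (z.1, τ)) z.2) c.G) :
    IntegrableOn (fun m => (-deriv c.L₁ m) • u (c.pt m) (int₁₂ k (c.pt m))) c.smooth ∧
    ∫ z in c.G, u z (int₁ k z) =
      (∫ m in c.smooth, (-deriv c.L₁ m) • u (c.pt m) (int₁₂ k (c.pt m))) -
      ∫ z in c.G, deriv (fun τ => u (z.1, τ)) z.2 (int₁₂ k z) := by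
  have hG := c.isStaircase_G
  have i1 := (c.integrableOn_apply_ops hu hk).2.2
  have i2 := (c.integrableOn_apply_ops hdu hk).1
  have key := c.integral_G_vertical (i1.add i2) (β := fun z => u z (int₁₂ k z)) (by
    filter_upwards [hac] with s ht t hs
    have hs0 : 0 ≤ t := (hG.nonneg _ hs).2
    have := integral_covec_apply_by_parts (ht t hs) (g := fun y => int₁₂ k (s, y))
      (g' := fun y => int₁ k (s, y)) (hk.intervalIntegrable_int₁ hG hs) (fun x hx => by
        rw [uIcc_of_le hs0] at hx
        rw [int₁₂_zero_right, zero_add, hk.int₁₂_vert hG hs hx])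
    rw [int₁₂_zero_right, map_zero, sub_zero, intervalIntegral.integral_of_le hs0,
      ← integral_Icc_eq_integral_Ioc] at this
    exact this)
  refine ⟨key.1, ?_⟩
  rw [← key.2]
  have := integral_add i1 i2
  simp only [Pi.add_apply]
  rw [this]
  ring

theorem integral_eq_sum_arcs {F : Type*} [NormedAddCommGroup F] [NormedSpace ℝ F] {g : ℝ → F}
    (hg : ∀ r : Fin (N + 1), IntervalIntegrable g volume (c.vert r.castSucc) (c.vert r.succ)) :
    ∫ m in (0 : ℝ)..c.ℓ, g m = ∑ r : Fin (N + 1), ∫ m in (c.vert r.castSucc)..(c.vert r.succ), g m := by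
  -- The vertices as a sequence over ℕ, for the telescoping sum of adjacent intervals; the default 0
  -- lies beyond the last vertex and is never reached.
  let v : ℕ → ℝ := fun j => if h : j < N + 2 then c.vert ⟨j, h⟩ else 0
  have h1 : ∀ r : Fin (N + 1), v r = c.vert r.castSucc := fun r => by
    simp only [v, dif_pos (show (r : ℕ) < N + 2 by omega)]; rfl
  have h2 : ∀ r : Fin (N + 1), v (r + 1) = c.vert r.succ := fun r => by
    simp only [v, dif_pos (show (r : ℕ) + 1 < N + 2 by omega)]; rfl
  have := intervalIntegral.sum_integral_adjacent_intervals (f := g) (μ := volume) (a := v)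
    (n := N + 1) (fun j hj => by
      have := hg ⟨j, hj⟩
      rwa [← h1, ← h2] at this)
  have hv0 : v 0 = 0 := by
    simp only [v, dif_pos (show 0 < N + 2 by omega)]; exact c.vert_zero
  have hvl : v (N + 1) = c.ℓ := by
    simp only [v, dif_pos (show N + 1 < N + 2 by omega)]; exact c.vert_last
  rw [hv0, hvl] at this
  rw [← this, Finset.sum_range]
  exact Finset.sum_congr rfl fun r _ => by rw [h1, h2]

theorem setIntegral_smooth {F : Type*} [NormedAddCommGroup F] [NormedSpace ℝ F] (g : ℝ → F) :
    ∫ m in c.smooth, g m = ∫ m in (0 : ℝ)..c.ℓ, g m := by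
  rw [setIntegral_congr_set c.smooth_ae_eq, integral_Icc_eq_integral_Ioc,
    intervalIntegral.integral_of_le c.ℓ_pos.le]

theorem integrableOn_smooth_of_arcs {F : Type*} [NormedAddCommGroup F] [NormedSpace ℝ F] {g : ℝ → F}
    (hg : ∀ r : Fin (N + 1), IntervalIntegrable g volume (c.vert r.castSucc) (c.vert r.succ)) :
    IntegrableOn g c.smooth := by
  refine (integrableOn_congr_set_ae c.smooth_ae_eq).2 ?_
  refine c.induction_arcs (p := fun S => IntegrableOn g S) ?_ ?_ fun r => ?_
  · exact IntegrableOn.of_measure_zero (by simp)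
  · intro x y z hxy hyz h1 h2
    rw [← Icc_union_Icc_eq_Icc hxy hyz]
    exact h1.union h2
  · rw [integrableOn_Icc_iff_integrableOn_Ioc]
    exact (intervalIntegrable_iff_integrableOn_Ioc_of_le (c.vert_castSucc_lt r).le).1 (hg r)

variable {w : ℝ → Covec n}

theorem deriv_eqOn_arc {g : ℝ → Covec n} {r : Fin (N + 1)}
    (h : EqOn w g (Ioo (c.vert r.castSucc) (c.vert r.succ))) {m : ℝ}
    (hm : m ∈ Ioo (c.vert r.castSucc) (c.vert r.succ)) : deriv w m = deriv g m :=
  (h.eventuallyEq_of_mem (isOpen_Ioo.mem_nhds hm)).deriv_eq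

theorem intervalIntegrable_deriv_arc (hac : ∀ r : Fin (N + 1), ∃ g : ℝ → Covec n,
      AbsolutelyContinuousOnInterval g (c.vert r.castSucc) (c.vert r.succ) ∧
      EqOn w g (Ioo (c.vert r.castSucc) (c.vert r.succ))) (r : Fin (N + 1)) :
    IntervalIntegrable (deriv w) volume (c.vert r.castSucc) (c.vert r.succ) := by
  obtain ⟨g, hg, he⟩ := hac r
  rw [intervalIntegrable_iff_integrableOn_Ioo_of_le (c.vert_castSucc_lt r).le]
  have := (intervalIntegrable_iff_integrableOn_Ioo_of_le (c.vert_castSucc_lt r).le).1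
    (intervalIntegrable_deriv_of_ac hg)
  exact this.congr_fun (fun m hm => (c.deriv_eqOn_arc he hm).symm) measurableSet_Ioo

theorem integrableOn_deriv_smooth (hac : ∀ r : Fin (N + 1), ∃ g : ℝ → Covec n,
      AbsolutelyContinuousOnInterval g (c.vert r.castSucc) (c.vert r.succ) ∧
      EqOn w g (Ioo (c.vert r.castSucc) (c.vert r.succ))) :
    IntegrableOn (deriv w) c.smooth :=
  c.integrableOn_smooth_of_arcs (c.intervalIntegrable_deriv_arc hac)

/-- The parametrization is controlled only on [0,ℓ], so it is measurable up to null sets of the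
restricted measure; a measurable representative is composed instead. -/
theorem aestronglyMeasurable_comp_pt {F : Type*} [NormedAddCommGroup F] {v : ℝ × ℝ → F}
    (hv : StronglyMeasurable v) :
    AEStronglyMeasurable (fun m => v (c.pt m)) (volume.restrict c.smooth) := by
  have hp : AEMeasurable c.pt (volume.restrict c.smooth) :=
    (c.continuousOn_pt.mono sdiff_subset).aemeasurable c.measurableSet_smooth
  exact ⟨v ∘ hp.mk, hv.comp_measurable hp.measurable_mk, by
      filter_upwards [hp.ae_eq_mk] with m hm
      simp only [Function.comp, ← hm]⟩

/-- Integration by parts along the curve, arc by arc. -/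
theorem integral_by_parts_curve (hk : IsDensity c.G k)
    (hac : ∀ r : Fin (N + 1), ∃ g : ℝ → Covec n,
      AbsolutelyContinuousOnInterval g (c.vert r.castSucc) (c.vert r.succ) ∧
      EqOn w g (Ioo (c.vert r.castSucc) (c.vert r.succ))) :
    IntegrableOn (fun m => w m (c.traceDeriv k m)) c.smooth ∧
    IntegrableOn (fun m => deriv w m (int₁₂ k (c.pt m))) c.smooth ∧
    ∫ m in c.smooth, w m (c.traceDeriv k m) = -(∫ m in c.smooth, deriv w m (int₁₂ k (c.pt m))) -
      ∑ i : Fin N, (Function.rightLim w (c.vert i.succ.castSucc) -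
        Function.leftLim w (c.vert i.succ.castSucc)) (int₁₂ k (c.P i.succ.castSucc)) := by
  have i2 : IntegrableOn (fun m => deriv w m (int₁₂ k (c.pt m))) c.smooth := by
    obtain ⟨C, h0, hC⟩ := hk.bdd_ops c.isStaircase_G
    refine integrableOn_clm_apply_density (c.integrableOn_deriv_smooth hac)
      (c.aestronglyMeasurable_comp_pt hk.sm_int₁₂) (C := C) ?_
    exact (ae_restrict_mem c.measurableSet_smooth).mono fun m hm => (hC _ (c.pt_mem_G hm.1)).1
  have hInt : ∀ r : Fin (N + 1),
      IntervalIntegrable (fun m => w m (c.traceDeriv k m)) volume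
        (c.vert r.castSucc) (c.vert r.succ) := by
    intro r
    obtain ⟨g, hg, he⟩ := hac r
    have h2 := c.intervalIntegrable_traceDeriv hk (c.vert_mem r.castSucc) (c.vert_mem r.succ)
    have hle := (c.vert_castSucc_lt r).le
    obtain ⟨C, hC⟩ := hg.exists_bound
    rw [intervalIntegrable_iff_integrableOn_Ioo_of_le hle] at h2 ⊢
    have h3 : IntegrableOn (fun m => g m (c.traceDeriv k m))
        (Ioo (c.vert r.castSucc) (c.vert r.succ)) := by
      refine (h2.norm.const_mul C).mono' ?_ ?_
      · refine isBoundedBilinearMap_apply.continuous.comp_aestronglyMeasurable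
          (AEStronglyMeasurable.prodMk ?_ h2.aestronglyMeasurable)
        refine (hg.continuousOn.mono ?_).aestronglyMeasurable measurableSet_Ioo
        rw [uIcc_of_le hle]; exact Ioo_subset_Icc_self
      · refine (ae_restrict_mem measurableSet_Ioo).mono fun m hm => ?_
        refine ((g m).le_opNorm _).trans ?_
        gcongr
        exact hC m (by rw [uIcc_of_le hle]; exact Ioo_subset_Icc_self hm)
    refine h3.congr_fun (fun m hm => ?_) measurableSet_Ioo
    simp only [he hm]
  have i1 := c.integrableOn_smooth_of_arcs hInt
  refine ⟨i1, i2, ?_⟩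
  have harc : ∀ r : Fin (N + 1), ∫ m in (c.vert r.castSucc)..(c.vert r.succ),
      (w m (c.traceDeriv k m) + deriv w m (int₁₂ k (c.pt m))) =
      Function.leftLim w (c.vert r.succ) (int₁₂ k (c.P r.succ)) -
        Function.rightLim w (c.vert r.castSucc) (int₁₂ k (c.P r.castSucc)) := by
    intro r
    obtain ⟨g, hg, he⟩ := hac r
    have hlt := c.vert_castSucc_lt r
    have hcont := hg.continuousOn
    rw [uIcc_of_le hlt.le] at hcont
    -- w agrees with the absolutely continuous g on the open arc only, so its value at a vertex
    -- carries no information. The one-sided limits are what the boundary terms see, and they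
    -- combine into jumps.
    have hl : Function.leftLim w (c.vert r.succ) = g (c.vert r.succ) := by
      refine leftLim_eq_of_tendsto ?_
      have h1 : Tendsto g (𝓝[<] (c.vert r.succ)) (𝓝 (g (c.vert r.succ))) :=
        ((hcont _ (right_mem_Icc.2 hlt.le)).mono_of_mem_nhdsWithin
          (mem_of_superset (Ioo_mem_nhdsLT hlt) Ioo_subset_Icc_self)).tendsto
      exact h1.congr' (mem_of_superset (Ioo_mem_nhdsLT hlt) fun m hm => (he hm).symm)
    have hr : Function.rightLim w (c.vert r.castSucc) = g (c.vert r.castSucc) := by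
      refine rightLim_eq_of_tendsto ?_
      have h1 : Tendsto g (𝓝[>] (c.vert r.castSucc)) (𝓝 (g (c.vert r.castSucc))) :=
        ((hcont _ (left_mem_Icc.2 hlt.le)).mono_of_mem_nhdsWithin
          (mem_of_superset (Ioo_mem_nhdsGT hlt) Ioo_subset_Icc_self)).tendsto
      exact h1.congr' (mem_of_superset (Ioo_mem_nhdsGT hlt) fun m hm => (he hm).symm)
    have := integral_covec_apply_by_parts hg (g := fun m => int₁₂ k (c.pt m)) (g' := c.traceDeriv k)
      (c.intervalIntegrable_traceDeriv hk (c.vert_mem r.castSucc) (c.vert_mem r.succ))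
      (fun x hx => by
        rw [uIcc_of_le hlt.le] at hx
        exact c.int₁₂_pt_sub hk (c.vert_mem r.castSucc) (c.arc_subset r hx))
    rw [hl, hr]
    refine Eq.trans ?_ this
    rw [intervalIntegral.integral_of_le hlt.le, intervalIntegral.integral_of_le hlt.le,
      integral_Ioc_eq_integral_Ioo, integral_Ioc_eq_integral_Ioo]
    refine setIntegral_congr_fun measurableSet_Ioo fun m hm => ?_
    simp only [he hm, c.deriv_eqOn_arc he hm]
  have hInt' : ∀ r : Fin (N + 1),
      IntervalIntegrable (fun m => w m (c.traceDeriv k m) + deriv w m (int₁₂ k (c.pt m))) volume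
        (c.vert r.castSucc) (c.vert r.succ) := by
    intro r
    refine (hInt r).add ?_
    rw [intervalIntegrable_iff_integrableOn_Ioo_of_le (c.vert_castSucc_lt r).le]
    refine ((integrableOn_congr_set_ae c.smooth_ae_eq).1 i2).mono_set ?_
    exact Ioo_subset_Icc_self.trans (c.arc_subset r)
  have hsum := c.integral_eq_sum_arcs hInt'
  rw [← c.setIntegral_smooth, integral_add i1 i2, Finset.sum_congr rfl fun r _ => harc r,
    Finset.sum_sub_distrib, Fin.sum_univ_castSucc, Fin.sum_univ_succ (n := N)
      (f := fun r : Fin (N + 1) => Function.rightLim w (c.vert r.castSucc)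
        (int₁₂ k (c.P r.castSucc)))] at hsum
  -- The end vertices lie on the axes, where the double integral vanishes. The remaining one-sided
  -- limits pair up at the interior vertices.
  have hP0 : int₁₂ k (c.P (Fin.castSucc 0)) = 0 := by
    have : c.P (Fin.castSucc 0) = (c.a, 0) := by
      rw [Fin.castSucc_zero, P, pt, c.vert_zero, c.start_eq.1, c.start_eq.2]
    rw [this, int₁₂_zero_right]
  have hPl : int₁₂ k (c.P (Fin.last N).succ) = 0 := by
    have : c.P (Fin.last N).succ = (0, c.b) := by
      rw [Fin.succ_last, P, pt, c.vert_last, c.end_eq.1, c.end_eq.2]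
    rw [this, int₁₂_zero_left]
  rw [hP0, hPl, map_zero, map_zero, add_zero, zero_add] at hsum
  simp only [sub_apply, Finset.sum_sub_distrib]
  have e : ∀ i : Fin N, i.castSucc.succ = i.succ.castSucc := fun i => Fin.succ_castSucc i
  simp only [e] at hsum
  linarith

end Curve

end duality

end

end GoursatControl

namespace GoursatControl
noncomputable section
open Filter Topology

/-! ### Integrands along a controlled state -/

/-- States and kernels are known to be measurable only on their domain and are arbitrary outside.
Extension by zero gives functions on the whole space to which Fubini applies. -/
theorem stronglyMeasurable_indicator_of_subtype {α F : Type*} [MeasurableSpace α]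
    [TopologicalSpace F] [Zero F] {s : Set α} {f : α → F} (hs : MeasurableSet s)
    (hf : StronglyMeasurable fun x : s => f x) : StronglyMeasurable (s.indicator f) := by
  have h := (MeasurableEmbedding.subtype_coe hs).stronglyMeasurable_extend hf
    (g' := fun _ => (0 : F)) stronglyMeasurable_const
  convert h using 1
  funext x
  by_cases hx : x ∈ s
  · rw [indicator_of_mem hx]
    exact (Subtype.val_injective.extend_apply (fun x : s => f x) _ ⟨x, hx⟩).symm
  · rw [indicator_of_notMem hx, Function.extend_apply' _ _ _ fun ⟨y, hy⟩ => hx (hy ▸ y.2)]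

theorem stronglyMeasurable_indicator_of_continuousOn {α F : Type*} [TopologicalSpace α]
    [SecondCountableTopology α] [MeasurableSpace α] [OpensMeasurableSpace α]
    [NormedAddCommGroup F] {s : Set α} {f : α → F} (hs : MeasurableSet s) (hf : ContinuousOn f s) :
    StronglyMeasurable (s.indicator f) :=
  stronglyMeasurable_indicator_of_subtype hs hf.domRestrict.stronglyMeasurable

/-- A first order Taylor expansion, uniform for parameters in a compact set and base points in a
ball. -/
theorem exists_uniform_taylor {P Y F : Type*} [PseudoMetricSpace P] [NormedAddCommGroup Y]
    [NormedSpace ℝ Y] [ProperSpace Y] [NormedAddCommGroup F] [NormedSpace ℝ F] {K : Set P}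
    (hK : IsCompact K) {φ : P → Y → F} (hd : ∀ p ∈ K, Differentiable ℝ (φ p))
    (hc : ContinuousOn (fun w : P × Y => fderiv ℝ (φ w.1) w.2) (K ×ˢ univ)) (C : ℝ) {η : ℝ}
    (hη : 0 < η) : ∃ δ > 0, ∀ p ∈ K, ∀ y, ‖y‖ ≤ C → ∀ k, ‖k‖ ≤ δ →
      ‖φ p (y + k) - φ p y - fderiv ℝ (φ p) y k‖ ≤ η * ‖k‖ := by
  have hcomp : IsCompact (K ×ˢ Metric.closedBall (0 : Y) (C + 1)) :=
    hK.prod (isCompact_closedBall 0 (C + 1))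
  have hu := hcomp.uniformContinuousOn_of_continuous
    (hc.mono (prod_mono_right (subset_univ _)))
  rw [Metric.uniformContinuousOn_iff] at hu
  obtain ⟨δ, hδ, h⟩ := hu η hη
  -- The bound 1 keeps the segment from y to y + k in the ball of radius C + 1 on which the
  -- derivative is uniformly continuous; the half makes the distance strictly less than δ.
  refine ⟨min 1 (δ / 2), lt_min one_pos (half_pos hδ), fun p hp y hy k hk => ?_⟩
  have hk1 : ‖k‖ ≤ 1 := hk.trans (min_le_left _ _)
  have hk2 : ‖k‖ ≤ δ / 2 := hk.trans (min_le_right _ _)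
  have := (convex_closedBall y ‖k‖).norm_image_sub_le_of_norm_fderiv_le' (𝕜 := ℝ) (f := φ p)
    (φ := fderiv ℝ (φ p) y) (C := η) (x := y) (y := y + k) (fun x _ => hd p hp x)
    (fun x hx => by
      rw [Metric.mem_closedBall, dist_eq_norm] at hx
      have h1 : ‖x‖ ≤ C + 1 := by
        have := norm_add_le (x - y) y
        rw [sub_add_cancel] at this
        linarith
      have := h (p, x) ⟨hp, mem_closedBall_zero_iff.2 h1⟩ (p, y)
        ⟨hp, mem_closedBall_zero_iff.2 (by linarith)⟩ (by
          rw [Prod.dist_eq, dist_self, dist_eq_norm]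
          exact max_lt hδ (by linarith))
      rw [dist_eq_norm] at this
      exact this.le) (Metric.mem_closedBall_self (norm_nonneg _))
    (by rw [Metric.mem_closedBall, dist_eq_norm, add_sub_cancel_left])
  rwa [add_sub_cancel_left] at this

theorem exists_uniform_bound {P Y F : Type*} [PseudoMetricSpace P] [NormedAddCommGroup Y]
    [ProperSpace Y] [NormedAddCommGroup F] {K : Set P} (hK : IsCompact K) {φ : P × Y → F}
    (hc : ContinuousOn φ (K ×ˢ univ)) (C : ℝ) :
    ∃ M, 0 ≤ M ∧ ∀ p ∈ K, ∀ y, ‖y‖ ≤ C → ‖φ (p, y)‖ ≤ M := by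
  obtain ⟨M, hM⟩ := (hK.prod (isCompact_closedBall (0 : Y) C)).exists_bound_of_continuousOn
    (hc.mono (prod_mono_right (subset_univ _)))
  exact ⟨max M 0, le_max_right _ _, fun p hp y hy =>
    (hM (p, y) ⟨hp, mem_closedBall_zero_iff.2 hy⟩).trans (le_max_left _ _)⟩

namespace Data

variable {n m N : ℕ} {d : Data n m N}

theorem isClosed_U : IsClosed d.U := by
  have : d.U = ⋂ j, {v : Vec m | d.lo j ≤ v j} ∩ {v : Vec m | v j ≤ d.hi j} := by
    ext v; simp [U]
  rw [this]
  exact isClosed_iInter fun j => (isClosed_le (by fun_prop) (by fun_prop)).inter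
    (isClosed_le (by fun_prop) (by fun_prop))

theorem isCompact_U : IsCompact d.U := by
  have h : IsCompact (Icc d.lo d.hi) := isCompact_Icc
  have := h.image (PiLp.continuous_toLp 2 (fun _ : Fin m => ℝ))
  convert this using 1
  ext v
  constructor
  · intro hv
    exact ⟨fun j => v j, ⟨fun j => (hv j).1, fun j => (hv j).2⟩, rfl⟩
  · rintro ⟨w, hw, rfl⟩
    exact fun j => ⟨hw.1 j, hw.2 j⟩

theorem convex_U : Convex ℝ d.U := by
  intro v hv w hw α β hα hβ hαβ j
  have e : (α • v + β • w) j = α * v j + β * w j := rfl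
  rw [e]
  have h1 := hv j
  have h2 := hw j
  constructor
  · calc d.lo j = α * d.lo j + β * d.lo j := by rw [← add_mul, hαβ, one_mul]
      _ ≤ _ := by gcongr; exacts [h1.1, h2.1]
  · calc _ ≤ α * d.hi j + β * d.hi j := by gcongr; exacts [h1.2, h2.2]
      _ = d.hi j := by rw [← add_mul, hαβ, one_mul]

/-- The set of arguments of the integrands. -/
def dom (d : Data n m N) : Set ((ℝ × ℝ) × (Vec n × Vec n × Vec n) × Vec m) :=
  d.c.G ×ˢ univ ×ˢ d.U

/-- The arguments of the integrands along a controlled state. -/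
def arg (π : ControlledState n m) (z : ℝ × ℝ) : (ℝ × ℝ) × (Vec n × Vec n × Vec n) × Vec m :=
  (z, (π.x z, π.p z, π.q z), π.u z)

/-- A bounded Borel controlled state with control values in `U`. -/
structure IsState (d : Data n m N) (π : ControlledState n m) : Prop where
  measurable_u : Measurable fun z : d.c.G => π.u z
  measurable_x : Measurable fun z : d.c.G => π.x z
  measurable_p : Measurable fun z : d.c.G => π.p z
  measurable_q : Measurable fun z : d.c.G => π.q z
  mem_U : ∀ z ∈ d.c.G, π.u z ∈ d.U
  bounded : ∃ C : ℝ, ∀ z ∈ d.c.G, ‖π.x z‖ ≤ C ∧ ‖π.p z‖ ≤ C ∧ ‖π.q z‖ ≤ C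

theorem IsTrajectory.isState {π : ControlledState n m} (h : d.IsTrajectory π)
    (hu : Measurable fun z : d.c.G => π.u z) (hU : ∀ z ∈ d.c.G, π.u z ∈ d.U) : d.IsState π :=
  ⟨hu, h.measurable_x, h.measurable_p, h.measurable_q, hU, h.bounded⟩

namespace IsState

variable {π : ControlledState n m} {F : Type*} [NormedAddCommGroup F]

theorem bounded' (h : d.IsState π) :
    ∃ C : ℝ, ∀ z ∈ d.c.G, ‖(π.x z, π.p z, π.q z)‖ ≤ C := by
  obtain ⟨C, hC⟩ := h.bounded
  exact ⟨C, fun z hz => norm_prod_le_iff.2 ⟨(hC z hz).1, norm_prod_le_iff.2 (hC z hz).2⟩⟩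

theorem const_control (h : d.IsState π) {v : Vec m} (hv : v ∈ d.U) :
    d.IsState { π with u := fun _ => v } :=
  ⟨measurable_const, h.measurable_x, h.measurable_p, h.measurable_q, fun _ _ => hv, h.bounded⟩

theorem arg_mem (h : d.IsState π) {z : ℝ × ℝ} (hz : z ∈ d.c.G) : arg π z ∈ d.dom :=
  ⟨hz, mem_univ _, h.mem_U z hz⟩

/-- Continuous integrands are bounded and Borel along a controlled state. -/
theorem density (h : d.IsState π) {Ψ : (ℝ × ℝ) × (Vec n × Vec n × Vec n) × Vec m → F}
    (hΨ : ContinuousOn Ψ d.dom) : IsDensity d.c.G (d.c.G.indicator fun z => Ψ (arg π z)) := by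
  have hG := d.c.isStaircase_G.measurableSet
  have hS : MeasurableSet d.dom := hG.prod (MeasurableSet.univ.prod isClosed_U.measurableSet)
  have hsm := stronglyMeasurable_indicator_of_continuousOn hS hΨ
  have hm : Measurable fun z : d.c.G => arg π z :=
    measurable_subtype_coe.prodMk
      ((h.measurable_x.prodMk (h.measurable_p.prodMk h.measurable_q)).prodMk h.measurable_u)
  obtain ⟨C, hC⟩ := h.bounded'
  obtain ⟨M, hM⟩ := (d.c.isCompact_G.prod ((isCompact_closedBall
    (0 : Vec n × Vec n × Vec n) C).prod isCompact_U)).exists_bound_of_continuousOn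
    (hΨ.mono (prod_mono_right (prod_mono_left (subset_univ _))))
  refine ⟨stronglyMeasurable_indicator_of_subtype hG ?_, fun z hz => indicator_of_notMem hz _,
    max M 0, le_max_right _ _, fun z => ?_⟩
  · have e : (fun z : d.c.G => Ψ (arg π z)) = d.dom.indicator Ψ ∘ fun z : d.c.G => arg π z :=
      funext fun z => (indicator_of_mem (h.arg_mem z.2) _).symm
    rw [e]
    exact hsm.comp_measurable hm
  · by_cases hz : z ∈ d.c.G
    · rw [indicator_of_mem hz]
      exact (hM (arg π z) ⟨hz, mem_closedBall_zero_iff.2 (hC z hz), h.mem_U z hz⟩).trans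
        (le_max_left _ _)
    · rw [indicator_of_notMem hz, norm_zero]; exact le_max_right _ _

end IsState

namespace IsC1

variable {F : Type*} [NormedAddCommGroup F] [NormedSpace ℝ F]
  {g : ℝ × ℝ → Vec n → Vec n → Vec n → Vec m → F} {π : ControlledState n m}

/-- The derivative in the state variables at `w`. -/
def D (g : ℝ × ℝ → Vec n → Vec n → Vec n → Vec m → F)
    (w : (ℝ × ℝ) × (Vec n × Vec n × Vec n) × Vec m) : (Vec n × Vec n × Vec n) →L[ℝ] F :=
  fderiv ℝ (fun y : Vec n × Vec n × Vec n => g w.1 y.1 y.2.1 y.2.2 w.2.2) w.2.1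

theorem hasFDerivAt (hg : d.IsC1 g) {z : ℝ × ℝ} (hz : z ∈ d.c.G) {u : Vec m} (hu : u ∈ d.U)
    (y : Vec n × Vec n × Vec n) :
    HasFDerivAt (fun y : Vec n × Vec n × Vec n => g z y.1 y.2.1 y.2.2 u) (D g (z, y, u)) y :=
  (hg.differentiable z hz u hu y).hasFDerivAt

/-- The partial derivatives are the total derivative composed with coordinate inclusions, so they
inherit its joint continuity, boundedness and measurability along a state. -/
theorem dx_eq (hg : d.IsC1 g) {z : ℝ × ℝ} (hz : z ∈ d.c.G) {u : Vec m} (hu : u ∈ d.U)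
    (x p q : Vec n) : dx g z x p q u = D g (z, (x, p, q), u) ∘L ContinuousLinearMap.inl ℝ _ _ :=
  (HasFDerivAt.comp (f := fun e => (e, p, q)) x (hg.hasFDerivAt hz hu (x, p, q))
    (hasFDerivAt_prodMk_left x (p, q))).fderiv

theorem dp_eq (hg : d.IsC1 g) {z : ℝ × ℝ} (hz : z ∈ d.c.G) {u : Vec m} (hu : u ∈ d.U)
    (x p q : Vec n) : dp g z x p q u = D g (z, (x, p, q), u) ∘L
      (ContinuousLinearMap.inr ℝ _ _ ∘L ContinuousLinearMap.inl ℝ _ _) :=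
  (HasFDerivAt.comp (f := fun e => (x, e, q)) p (hg.hasFDerivAt hz hu (x, p, q))
    (HasFDerivAt.comp (f := fun e => (e, q)) p (hasFDerivAt_prodMk_right x (p, q))
      (hasFDerivAt_prodMk_left p q))).fderiv

theorem dq_eq (hg : d.IsC1 g) {z : ℝ × ℝ} (hz : z ∈ d.c.G) {u : Vec m} (hu : u ∈ d.U)
    (x p q : Vec n) : dq g z x p q u = D g (z, (x, p, q), u) ∘L
      (ContinuousLinearMap.inr ℝ _ _ ∘L ContinuousLinearMap.inr ℝ _ _) :=
  (HasFDerivAt.comp (f := fun e => (x, p, e)) q (hg.hasFDerivAt hz hu (x, p, q))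
    (HasFDerivAt.comp (f := fun e => (p, e)) q (hasFDerivAt_prodMk_right x (p, q))
      (hasFDerivAt_prodMk_right p q))).fderiv

theorem D_apply (hg : d.IsC1 g) (hπ : d.IsState π) {z : ℝ × ℝ} (hz : z ∈ d.c.G)
    (ξ ζ χ : Vec n) : D g (arg π z) (ξ, ζ, χ) =
      along (dx g) π z ξ + along (dp g) π z ζ + along (dq g) π z χ := by
  rw [along, along, along, hg.dx_eq hz (hπ.mem_U z hz), hg.dp_eq hz (hπ.mem_U z hz),
    hg.dq_eq hz (hπ.mem_U z hz)]
  simp only [ContinuousLinearMap.comp_apply, ContinuousLinearMap.inl_apply,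
    ContinuousLinearMap.inr_apply, arg, ← map_add, Prod.mk_add_mk, add_zero, zero_add]

theorem along_density (hg : d.IsC1 g) (hπ : d.IsState π) :
    IsDensity d.c.G (d.c.G.indicator (along g π)) :=
  hπ.density hg.continuousOn

theorem continuousOn_D (hg : d.IsC1 g) : ContinuousOn (D g) d.dom := hg.continuousOn_fderiv

theorem comp_D_density (hg : d.IsC1 g) (hπ : d.IsState π)
    (ι : Vec n →L[ℝ] Vec n × Vec n × Vec n) :
    IsDensity d.c.G (d.c.G.indicator fun z => D g (arg π z) ∘L ι) :=
  hπ.density (Ψ := fun w => D g w ∘L ι) (hg.continuousOn_D.clm_comp continuousOn_const)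

theorem dx_density (hg : d.IsC1 g) (hπ : d.IsState π) :
    IsDensity d.c.G (d.c.G.indicator (along (dx g) π)) :=
  (indicator_congr fun z hz => hg.dx_eq hz (hπ.mem_U z hz) _ _ _ :
    d.c.G.indicator (along (dx g) π) = _) ▸ hg.comp_D_density hπ _

theorem dp_density (hg : d.IsC1 g) (hπ : d.IsState π) :
    IsDensity d.c.G (d.c.G.indicator (along (dp g) π)) :=
  (indicator_congr fun z hz => hg.dp_eq hz (hπ.mem_U z hz) _ _ _ :
    d.c.G.indicator (along (dp g) π) = _) ▸ hg.comp_D_density hπ _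

theorem dq_density (hg : d.IsC1 g) (hπ : d.IsState π) :
    IsDensity d.c.G (d.c.G.indicator (along (dq g) π)) :=
  (indicator_congr fun z hz => hg.dq_eq hz (hπ.mem_U z hz) _ _ _ :
    d.c.G.indicator (along (dq g) π) = _) ▸ hg.comp_D_density hπ _

theorem continuousOn_D_param (hg : d.IsC1 g) : ContinuousOn
    (fun w : ((ℝ × ℝ) × Vec m) × (Vec n × Vec n × Vec n) => D g (w.1.1, w.2, w.1.2))
    ((d.c.G ×ˢ d.U) ×ˢ univ) :=
  hg.continuousOn_D.comp (f := fun w : ((ℝ × ℝ) × Vec m) × (Vec n × Vec n × Vec n) =>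
    (w.1.1, w.2, w.1.2)) (by fun_prop) fun w hw => ⟨hw.1.1, mem_univ _, hw.1.2⟩

/-- The change of `g` when both the state and the control vary. -/
theorem exists_remainder_bound (hg : d.IsC1 g) (C : ℝ) : ∃ M, 0 ≤ M ∧ ∀ η > 0, ∃ δ > 0,
    ∀ z ∈ d.c.G, ∀ u ∈ d.U, ∀ u' ∈ d.U, ∀ y k : Vec n × Vec n × Vec n, ‖y‖ ≤ C → ‖k‖ ≤ δ →
      ‖g z (y + k).1 (y + k).2.1 (y + k).2.2 u - g z y.1 y.2.1 y.2.2 u - D g (z, y, u) k‖ ≤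
        η * ‖k‖ ∧
      ‖g z (y + k).1 (y + k).2.1 (y + k).2.2 u' - g z y.1 y.2.1 y.2.2 u' - D g (z, y, u) k‖ ≤
        (η + M) * ‖k‖ := by
  have hK : IsCompact (d.c.G ×ˢ d.U) := d.c.isCompact_G.prod isCompact_U
  obtain ⟨M, hM0, hM⟩ := exists_uniform_bound hK hg.continuousOn_D_param C
  refine ⟨M + M, by positivity, fun η hη => ?_⟩
  obtain ⟨δ, hδ, h⟩ := exists_uniform_taylor (P := (ℝ × ℝ) × Vec m) hK
    (φ := fun p (y : Vec n × Vec n × Vec n) => g p.1 y.1 y.2.1 y.2.2 p.2)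
    (fun p hp => hg.differentiable p.1 hp.1 p.2 hp.2) hg.continuousOn_D_param C hη
  refine ⟨δ, hδ, fun z hz u hu u' hu' y k hy hk => ⟨h (z, u) ⟨hz, hu⟩ y hy k hk, ?_⟩⟩
  have h1 := h (z, u') ⟨hz, hu'⟩ y hy k hk
  -- The linear part is taken at the control u instead of u'. The mismatch is not small relative to
  -- ‖k‖, but bounded by a constant independent of η; it is used only on the small square.
  have h2 : ‖D g (z, y, u') k - D g (z, y, u) k‖ ≤ (M + M) * ‖k‖ := by
    rw [← sub_apply]
    refine (ContinuousLinearMap.le_opNorm _ _).trans ?_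
    gcongr
    exact (norm_sub_le _ _).trans (add_le_add (hM (z, u') ⟨hz, hu'⟩ y hy) (hM (z, u) ⟨hz, hu⟩ y hy))
  have := norm_add_le (g z (y + k).1 (y + k).2.1 (y + k).2.2 u' - g z y.1 y.2.1 y.2.2 u' -
    D g (z, y, u') k) (D g (z, y, u') k - D g (z, y, u) k)
  rw [sub_add_sub_cancel] at this
  rw [add_mul]
  exact this.trans (add_le_add h1 h2)

end IsC1

end Data

end
end GoursatControl

namespace GoursatControl
noncomputable section
open Filter Topology

/-! ### The Riemann function of the linearized problem -/

namespace IsKernel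

variable {F : Type*} [NormedAddCommGroup F] [NormedSpace ℝ F] {G : Set (ℝ × ℝ)} {a b : ℝ}

/-- A kernel vanishes when its first point is not above and to the right of w, so integrals starting
at w may start at 0. The lower limits then no longer depend on w, as Fubini requires. -/
theorem setIntegral_vert {M : (ℝ × ℝ) × (ℝ × ℝ) → F} (hM : IsKernel G M) {z w : ℝ × ℝ}
    (hw : w ∈ W z) (s : ℝ) :
    ∫ τ in Icc w.2 z.2, M ((s, τ), w) = ∫ τ in Icc 0 z.2, M ((s, τ), w) :=
  (setIntegral_eq_of_subset_of_forall_sdiff_eq_zero measurableSet_Icc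
    (Icc_subset_Icc_left hw.2.1) fun τ hτ => hM.zero _ _ fun h =>
      hτ.2 ⟨h.2.2.2, hτ.1.2⟩).symm

theorem setIntegral_horiz {M : (ℝ × ℝ) × (ℝ × ℝ) → F} (hM : IsKernel G M) {z w : ℝ × ℝ}
    (hw : w ∈ W z) (t : ℝ) :
    ∫ σ in Icc w.1 z.1, M ((σ, t), w) = ∫ σ in Icc 0 z.1, M ((σ, t), w) :=
  (setIntegral_eq_of_subset_of_forall_sdiff_eq_zero measurableSet_Icc
    (Icc_subset_Icc_left hw.1.1) fun σ hσ => hM.zero _ _ fun h =>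
      hσ.2 ⟨h.2.1.2, hσ.1.2⟩).symm

theorem setIntegral_rect {M : (ℝ × ℝ) × (ℝ × ℝ) → F} (hM : IsKernel G M) {z w : ℝ × ℝ}
    (hw : w ∈ W z) : ∫ v in Icc w.1 z.1 ×ˢ Icc w.2 z.2, M (v, w) =
      ∫ σ in Icc 0 z.1, ∫ τ in Icc 0 z.2, M ((σ, τ), w) := by
  have e : ∫ v in Icc w.1 z.1 ×ˢ Icc w.2 z.2, M (v, w) = ∫ v in W z, M (v, w) :=
    (setIntegral_eq_of_subset_of_forall_sdiff_eq_zero (measurableSet_W z)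
      (prod_mono (Icc_subset_Icc_left hw.1.1) (Icc_subset_Icc_left hw.2.1))
      fun v hv => hM.zero _ _ fun h => hv.2 ⟨⟨h.2.1.2, hv.1.1.2⟩, ⟨h.2.2.2, hv.1.2.2⟩⟩).symm
  rw [e, W]
  have hi : IntegrableOn (fun v => M (v, w)) (W z) := hM.integrable_comp (by fun_prop)
  exact setIntegral_prod (fun v => M (v, w)) hi

theorem apply {F' : Type*} [NormedAddCommGroup F'] [NormedSpace ℝ F']
    {M : (ℝ × ℝ) × (ℝ × ℝ) → F →L[ℝ] F'} (hM : IsKernel G M) {h : ℝ × ℝ → F}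
    (hh : IsDensity G h) : IsKernel G (fun p => M p (h p.2)) := by
  obtain ⟨C, hC⟩ := hM.bdd
  obtain ⟨C', h0, hC'⟩ := hh.bdd
  exact ⟨stronglyMeasurable_clm_apply hM.sm (hh.sm.comp_measurable measurable_snd),
    fun z w hzw => by simp [hM.zero z w hzw], C * C', fun p => ((M p).le_opNorm _).trans
      (mul_le_mul (hC p) (hC' _) (norm_nonneg _) ((norm_nonneg _).trans (hC p)))⟩

theorem comp {n : ℕ} {M : (ℝ × ℝ) × (ℝ × ℝ) → Mat n} (hM : IsKernel G M) {A : ℝ × ℝ → Mat n}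
    (hA : IsDensity G A) : IsKernel G (fun p => A p.1 ∘L M p) := by
  obtain ⟨C, hC⟩ := hM.bdd
  obtain ⟨C', h0, hC'⟩ := hA.bdd
  exact ⟨isBoundedBilinearMap_comp.continuous.comp_stronglyMeasurable
      ((hA.sm.comp_measurable measurable_fst).prodMk hM.sm),
    fun z w hzw => by simp [hM.zero z w hzw], C' * C,
    fun p => (ContinuousLinearMap.opNorm_comp_le _ _).trans
      (mul_le_mul (hC' _) (hC p) (norm_nonneg _) h0)⟩

end IsKernel

/-- Extension of a matrix function of `z ∈ G`, `w ∈ W z` by zero. -/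
def zeroExt {n : ℕ} (G : Set (ℝ × ℝ)) (R : ℝ × ℝ → ℝ × ℝ → Mat n) : (ℝ × ℝ) × (ℝ × ℝ) → Mat n :=
  {v : (ℝ × ℝ) × (ℝ × ℝ) | v.1 ∈ G ∧ v.2 ∈ W v.1}.indicator fun v => R v.1 v.2

theorem zeroExt_of_mem {n : ℕ} {G : Set (ℝ × ℝ)} {R : ℝ × ℝ → ℝ × ℝ → Mat n} {z w : ℝ × ℝ}
    (hz : z ∈ G) (hw : w ∈ W z) : zeroExt G R (z, w) = R z w :=
  indicator_of_mem (show (z, w) ∈ {v : (ℝ × ℝ) × (ℝ × ℝ) | v.1 ∈ G ∧ v.2 ∈ W v.1} from ⟨hz, hw⟩) _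

theorem zeroExt_of_notMem {n : ℕ} {G : Set (ℝ × ℝ)} {R : ℝ × ℝ → ℝ × ℝ → Mat n} {z w : ℝ × ℝ}
    (h : ¬ (z ∈ G ∧ w ∈ W z)) : zeroExt G R (z, w) = 0 :=
  indicator_of_notMem (show (z, w) ∉ {v : (ℝ × ℝ) × (ℝ × ℝ) | v.1 ∈ G ∧ v.2 ∈ W v.1} from h) _

theorem isKernel_zeroExt {n : ℕ} {G : Set (ℝ × ℝ)} (hG : MeasurableSet G)
    {R : ℝ × ℝ → ℝ × ℝ → Mat n}
    (hR : Measurable fun v : {v : (ℝ × ℝ) × (ℝ × ℝ) // v.1 ∈ G ∧ v.2 ∈ W v.1} => R v.1.1 v.1.2)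
    {C : ℝ} (hC : ∀ z ∈ G, ∀ w ∈ W z, ‖R z w‖ ≤ C) : IsKernel G (zeroExt G R) := by
  have hS : MeasurableSet {v : (ℝ × ℝ) × (ℝ × ℝ) | v.1 ∈ G ∧ v.2 ∈ W v.1} :=
    (hG.preimage measurable_fst).inter measurableSet_mem_W
  refine ⟨stronglyMeasurable_indicator_of_subtype hS hR.stronglyMeasurable,
    fun z w h => zeroExt_of_notMem h, max C 0, fun p => ?_⟩
  by_cases hp : p.1 ∈ G ∧ p.2 ∈ W p.1
  · rw [show p = (p.1, p.2) from rfl, zeroExt_of_mem hp.1 hp.2]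
    exact (hC _ hp.1 _ hp.2).trans (le_max_left _ _)
  · rw [show p = (p.1, p.2) from rfl, zeroExt_of_notMem hp, norm_zero]; exact le_max_right _ _

namespace Data

variable {n m N : ℕ} {d : Data n m N} {π : ControlledState n m}
  {R Rs Rt : ℝ × ℝ → ℝ × ℝ → Mat n}

/-- The right-hand side of the equation for the Riemann function, extended by zero. -/
def linKernel (d : Data n m N) (π : ControlledState n m) (R Rs Rt : ℝ × ℝ → ℝ × ℝ → Mat n)
    (p : (ℝ × ℝ) × (ℝ × ℝ)) : Mat n :=
  d.c.G.indicator (along (dx d.f) π) p.1 ∘L zeroExt d.c.G R p +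
    d.c.G.indicator (along (dp d.f) π) p.1 ∘L zeroExt d.c.G Rs p +
    d.c.G.indicator (along (dq d.f) π) p.1 ∘L zeroExt d.c.G Rt p

theorem linKernel_of_mem {z w : ℝ × ℝ} (hz : z ∈ d.c.G) (hw : w ∈ W z) :
    linKernel d π R Rs Rt (z, w) = d.linRHS π R Rs Rt z w := by
  rw [linKernel, linRHS]
  simp only [zeroExt_of_mem hz hw, indicator_of_mem hz]

namespace IsRiemann

theorem kernel_R (hR : d.IsRiemann π R Rs Rt) : IsKernel d.c.G (zeroExt d.c.G R) :=
  let ⟨_, hC⟩ := hR.bounded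
  isKernel_zeroExt d.c.isStaircase_G.measurableSet hR.measurable_R fun z hz w hw => (hC z hz w hw).1

theorem kernel_Rs (hR : d.IsRiemann π R Rs Rt) : IsKernel d.c.G (zeroExt d.c.G Rs) :=
  let ⟨_, hC⟩ := hR.bounded
  isKernel_zeroExt d.c.isStaircase_G.measurableSet hR.measurable_Rs
    fun z hz w hw => (hC z hz w hw).2.1

theorem kernel_Rt (hR : d.IsRiemann π R Rs Rt) : IsKernel d.c.G (zeroExt d.c.G Rt) :=
  let ⟨_, hC⟩ := hR.bounded
  isKernel_zeroExt d.c.isStaircase_G.measurableSet hR.measurable_Rt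
    fun z hz w hw => (hC z hz w hw).2.2

variable (hf : d.IsC1 d.f) (hπ : d.IsState π) (hR : d.IsRiemann π R Rs Rt)

include hf hπ hR

theorem kernel_lin : IsKernel d.c.G (linKernel d π R Rs Rt) :=
  ((hR.kernel_R.comp (hf.dx_density hπ)).add (hR.kernel_Rs.comp (hf.dp_density hπ))).add
    (hR.kernel_Rt.comp (hf.dq_density hπ))

theorem Rs_ext {z w : ℝ × ℝ} (hz : z ∈ d.c.G) (hw : w ∈ W z) :
    zeroExt d.c.G Rs (z, w) =
      d.c.G.indicator (along (dq d.f) π) (z.1, w.2) ∘L zeroExt d.c.G R ((z.1, w.2), w) +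
      ∫ τ in Icc 0 z.2, linKernel d π R Rs Rt ((z.1, τ), w) := by
  have hG := d.c.isStaircase_G
  have h1 : (z.1, w.2) ∈ d.c.G := hG.vert_mem hz hw.2
  rw [zeroExt_of_mem hz hw, zeroExt_of_mem h1 ⟨hw.1, hw.2.1, le_rfl⟩, indicator_of_mem h1,
    hR.Rs_eq z hz w hw, intervalIntegral.integral_of_le hw.2.2, ← integral_Icc_eq_integral_Ioc,
    ← (kernel_lin hf hπ hR).setIntegral_vert hw]
  congr 1
  refine setIntegral_congr_fun measurableSet_Icc fun τ hτ => ?_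
  exact (linKernel_of_mem (hG.vert_mem hz ⟨hw.2.1.trans hτ.1, hτ.2⟩) ⟨hw.1, hw.2.1, hτ.1⟩).symm

theorem Rt_ext {z w : ℝ × ℝ} (hz : z ∈ d.c.G) (hw : w ∈ W z) :
    zeroExt d.c.G Rt (z, w) =
      d.c.G.indicator (along (dp d.f) π) (w.1, z.2) ∘L zeroExt d.c.G R ((w.1, z.2), w) +
      ∫ σ in Icc 0 z.1, linKernel d π R Rs Rt ((σ, z.2), w) := by
  have hG := d.c.isStaircase_G
  have h1 : (w.1, z.2) ∈ d.c.G := hG.horiz_mem hz hw.1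
  rw [zeroExt_of_mem hz hw, zeroExt_of_mem h1 ⟨⟨hw.1.1, le_rfl⟩, hw.2⟩, indicator_of_mem h1,
    hR.Rt_eq z hz w hw, intervalIntegral.integral_of_le hw.1.2, ← integral_Icc_eq_integral_Ioc,
    ← (kernel_lin hf hπ hR).setIntegral_horiz hw]
  congr 1
  refine setIntegral_congr_fun measurableSet_Icc fun σ hσ => ?_
  exact (linKernel_of_mem (hG.horiz_mem hz ⟨hw.1.1.trans hσ.1, hσ.2⟩) ⟨⟨hw.1.1, hσ.1⟩, hw.2⟩).symm

theorem R_ext {z w : ℝ × ℝ} (hz : z ∈ d.c.G) (hw : w ∈ W z) :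
    zeroExt d.c.G R (z, w) = ContinuousLinearMap.id ℝ (Vec n) +
      (∫ σ in Icc 0 z.1,
        d.c.G.indicator (along (dq d.f) π) (σ, w.2) ∘L zeroExt d.c.G R ((σ, w.2), w)) +
      (∫ τ in Icc 0 z.2,
        d.c.G.indicator (along (dp d.f) π) (w.1, τ) ∘L zeroExt d.c.G R ((w.1, τ), w)) +
      ∫ σ in Icc 0 z.1, ∫ τ in Icc 0 z.2, linKernel d π R Rs Rt ((σ, τ), w) := by
  have hG := d.c.isStaircase_G
  rw [zeroExt_of_mem hz hw, hR.R_eq z hz w hw, ← (kernel_lin hf hπ hR).setIntegral_rect hw,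
    ← (hR.kernel_R.comp (hf.dq_density hπ)).setIntegral_horiz hw w.2,
    ← (hR.kernel_R.comp (hf.dp_density hπ)).setIntegral_vert hw w.1,
    intervalIntegral.integral_of_le hw.1.2, intervalIntegral.integral_of_le hw.2.2,
    ← integral_Icc_eq_integral_Ioc, ← integral_Icc_eq_integral_Ioc]
  have hσ : ∀ σ ∈ Icc w.1 z.1, ∀ τ ∈ Icc w.2 z.2, (σ, τ) ∈ d.c.G ∧ w ∈ W (σ, τ) :=
    fun σ hσ τ hτ => ⟨hG.lower z hz ⟨⟨hw.1.1.trans hσ.1, hσ.2⟩, ⟨hw.2.1.trans hτ.1, hτ.2⟩⟩,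
      ⟨hw.1.1, hσ.1⟩, ⟨hw.2.1, hτ.1⟩⟩
  congr 1
  · congr 1
    · congr 1
      refine setIntegral_congr_fun measurableSet_Icc fun σ h => ?_
      have := hσ σ h w.2 ⟨le_rfl, hw.2.2⟩
      simp only [zeroExt_of_mem this.1 this.2, indicator_of_mem this.1]
    · refine setIntegral_congr_fun measurableSet_Icc fun τ h => ?_
      have := hσ w.1 ⟨le_rfl, hw.1.2⟩ τ h
      simp only [zeroExt_of_mem this.1 this.2, indicator_of_mem this.1]
  · refine setIntegral_congr_fun (measurableSet_Icc.prod measurableSet_Icc) fun v hv => ?_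
    have := hσ v.1 hv.1 v.2 hv.2
    exact (linKernel_of_mem this.1 this.2).symm

/-- For σ = s the horizontal integral and the area integral in the equation for R run over null
sets. -/
theorem R_vert {z : ℝ × ℝ} (hz : z ∈ d.c.G) {τ : ℝ} (hτ : τ ∈ Icc 0 z.2) :
    zeroExt d.c.G R (z, (z.1, τ)) = ContinuousLinearMap.id ℝ (Vec n) +
      ∫ v in Icc 0 z.2,
        d.c.G.indicator (along (dp d.f) π) (z.1, v) ∘L zeroExt d.c.G R ((z.1, v), (z.1, τ)) := by
  have hw : (z.1, τ) ∈ W z := ⟨⟨(d.c.isStaircase_G.nonneg z hz).1, le_rfl⟩, hτ⟩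
  rw [R_ext hf hπ hR hz hw, ← (hR.kernel_R.comp (hf.dq_density hπ)).setIntegral_horiz hw τ,
    ← (kernel_lin hf hπ hR).setIntegral_rect hw]
  have h1 : volume (Icc z.1 z.1 ×ˢ Icc τ z.2 : Set (ℝ × ℝ)) = 0 := by
    simp [Measure.volume_eq_prod, Measure.prod_prod]
  have h2 : volume (Icc z.1 z.1) = 0 := by simp
  rw [setIntegral_measure_zero _ h1, setIntegral_measure_zero _ h2, add_zero, add_zero]

theorem R_horiz {z : ℝ × ℝ} (hz : z ∈ d.c.G) {σ : ℝ} (hσ : σ ∈ Icc 0 z.1) :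
    zeroExt d.c.G R (z, (σ, z.2)) = ContinuousLinearMap.id ℝ (Vec n) +
      ∫ v in Icc 0 z.1,
        d.c.G.indicator (along (dq d.f) π) (v, z.2) ∘L zeroExt d.c.G R ((v, z.2), (σ, z.2)) := by
  have hw : (σ, z.2) ∈ W z := ⟨hσ, ⟨(d.c.isStaircase_G.nonneg z hz).2, le_rfl⟩⟩
  rw [R_ext hf hπ hR hz hw, ← (hR.kernel_R.comp (hf.dp_density hπ)).setIntegral_vert hw σ,
    ← (kernel_lin hf hπ hR).setIntegral_rect hw]
  have h1 : volume (Icc σ z.1 ×ˢ Icc z.2 z.2 : Set (ℝ × ℝ)) = 0 := by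
    simp [Measure.volume_eq_prod, Measure.prod_prod]
  have h2 : volume (Icc z.2 z.2) = 0 := by simp
  rw [setIntegral_measure_zero _ h1, setIntegral_measure_zero _ h2, add_zero, add_zero]

/-- Subtracting the equation for R at (σ,t) from the one at (s,t) cancels the identity and the
vertical integral. What is left is, section by section, the equation for R_s. -/
theorem R_eq_integral_Rs {z w : ℝ × ℝ} (hz : z ∈ d.c.G) (hw : w ∈ W z) :
    zeroExt d.c.G R (z, w) = zeroExt d.c.G R ((w.1, z.2), w) +
      ∫ σ in Icc 0 z.1, zeroExt d.c.G Rs ((σ, z.2), w) := by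
  have hG := d.c.isStaircase_G
  have hw' : w ∈ W (w.1, z.2) := ⟨⟨hw.1.1, le_rfl⟩, hw.2⟩
  have kC := hR.kernel_R.comp (hf.dq_density hπ)
  have kL := kernel_lin hf hπ hR
  have e : ∀ σ ∈ Icc 0 z.1, zeroExt d.c.G Rs ((σ, z.2), w) =
      d.c.G.indicator (along (dq d.f) π) (σ, w.2) ∘L zeroExt d.c.G R ((σ, w.2), w) +
      ∫ τ in Icc 0 z.2, linKernel d π R Rs Rt ((σ, τ), w) := by
    intro σ hσ
    -- To the left of w every term is zero by extension, so the identity also holds on the part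
    -- added to the integration interval.
    by_cases h : w.1 ≤ σ
    · exact Rs_ext hf hπ hR (z := (σ, z.2)) (hG.horiz_mem hz hσ) ⟨⟨hw.1.1, h⟩, hw.2⟩
    · have h0 : ∀ τ, ¬ w ∈ W (σ, τ) := fun τ h' => h h'.1.2
      rw [hR.kernel_Rs.zero _ _ fun h' => h0 _ h'.2, kC.zero _ _ fun h' => h0 _ h'.2,
        setIntegral_eq_zero_of_forall_eq_zero fun τ _ => kL.zero _ _ fun h' => h0 _ h'.2, add_zero]
  have iL : Integrable (fun v : ℝ × ℝ => linKernel d π R Rs Rt (v, w))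
      ((volume.restrict (Icc 0 z.1)).prod (volume.restrict (Icc 0 z.2))) :=
    kL.integrable_comp (by fun_prop)
  rw [R_ext hf hπ hR hz hw, R_ext hf hπ hR (hG.horiz_mem hz hw.1) hw',
    ← kC.setIntegral_horiz hw' w.2, ← kL.setIntegral_rect hw',
    setIntegral_congr_fun measurableSet_Icc e,
    integral_add (kC.integrable_comp (φ := fun σ => ((σ, w.2), w)) (by fun_prop))
      iL.integral_prod_left]
  have h1 : volume (Icc w.1 w.1 ×ˢ Icc w.2 z.2 : Set (ℝ × ℝ)) = 0 := by
    simp [Measure.volume_eq_prod, Measure.prod_prod]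
  have h2 : volume (Icc w.1 w.1) = 0 := by simp
  simp only
  rw [setIntegral_measure_zero _ h1, setIntegral_measure_zero _ h2]
  abel

/-- Matrices are applied to the source at the source point w, which is fixed in the integrals of the
Riemann equations; evaluation therefore commutes with those integrals. -/
theorem isRiemannField {h : ℝ × ℝ → Vec n} (hh : IsDensity d.c.G h) :
    IsRiemannField d.c.G (d.c.G.indicator (along (dx d.f) π)) (d.c.G.indicator (along (dp d.f) π))
      (d.c.G.indicator (along (dq d.f) π)) h (fun p => zeroExt d.c.G R p (h p.2))
      (fun p => zeroExt d.c.G Rs p (h p.2)) (fun p => zeroExt d.c.G Rt p (h p.2)) where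
  A_density := hf.dx_density hπ
  B_density := hf.dp_density hπ
  C_density := hf.dq_density hπ
  h_density := hh
  r_kernel := hR.kernel_R.apply hh
  rs_kernel := hR.kernel_Rs.apply hh
  rt_kernel := hR.kernel_Rt.apply hh
  rs_eq z hz w hw := by
    simp only [Rs_ext hf hπ hR hz hw, _root_.add_apply]
    rw [ContinuousLinearMap.integral_apply ((kernel_lin hf hπ hR).integrable_comp (by fun_prop))]
    rfl
  rt_eq z hz w hw := by
    simp only [Rt_ext hf hπ hR hz hw, _root_.add_apply]
    rw [ContinuousLinearMap.integral_apply ((kernel_lin hf hπ hR).integrable_comp (by fun_prop))]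
    rfl
  r_vert z hz τ hτ := by
    simp only [R_vert hf hπ hR hz hτ, _root_.add_apply]
    rw [ContinuousLinearMap.integral_apply
      ((hR.kernel_R.comp (hf.dp_density hπ)).integrable_comp
        (φ := fun v => ((z.1, v), (z.1, τ))) (by fun_prop))]
    rfl
  r_horiz z hz σ hσ := by
    simp only [R_horiz hf hπ hR hz hσ, _root_.add_apply]
    rw [ContinuousLinearMap.integral_apply
      ((hR.kernel_R.comp (hf.dq_density hπ)).integrable_comp
        (φ := fun v => ((v, z.2), (σ, z.2))) (by fun_prop))]
    rfl

/-- The Riemann function solves the linearized problem. -/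
theorem int₁₂_eq {h k : ℝ × ℝ → Vec n} (hh : IsDensity d.c.G h) (hk : IsDensity d.c.G k)
    (hkeq : ∀ z ∈ d.c.G, k z = h z + along (dx d.f) π z (int₁₂ k z) +
      along (dp d.f) π z (int₂ k z) + along (dq d.f) π z (int₁ k z)) {z : ℝ × ℝ}
    (hz : z ∈ d.c.G) :
    int₁₂ k z = ∫ w in W (d.c.a, d.c.b), zeroExt d.c.G R (z, w) (h w) := by
  refine (isRiemannField hf hπ hR hh).int₁₂_eq_fieldX d.c.isStaircase_G (fun z hz w hw => ?_) hk
    (fun z hz => ?_) hz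
  · simp only [R_eq_integral_Rs hf hπ hR hz hw, _root_.add_apply]
    rw [ContinuousLinearMap.integral_apply (hR.kernel_Rs.integrable_comp (by fun_prop))]
  · simpa only [indicator_of_mem hz] using hkeq z hz

end IsRiemann

end Data

end
end GoursatControl

namespace GoursatControl
noncomputable section
open Filter Topology

/-! ### Duality between the linearized state and the co-state -/

section

variable {α : Type*} [MeasurableSpace α] {μ : Measure α} [SFinite μ] {ν : Measure (ℝ × ℝ)}
  [IsFiniteMeasure ν] {n : ℕ} {φ : α → Covec n} {ρ : α × (ℝ × ℝ) → Mat n} {C : ℝ}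

theorem norm_integral_comp_kernel_le (hφ : Integrable φ μ) (hC : ∀ p, ‖ρ p‖ ≤ C) (w : ℝ × ℝ) :
    ‖∫ a, φ a ∘L ρ (a, w) ∂μ‖ ≤ (∫ a, ‖φ a‖ ∂μ) * C := by
  rw [← integral_mul_const]
  refine norm_integral_le_of_norm_le (hφ.norm.mul_const C) (ae_of_all _ fun a => ?_)
  refine (ContinuousLinearMap.opNorm_comp_le _ _).trans ?_
  gcongr
  exact hC _

theorem integrable_comp_kernel (hφ : Integrable φ μ) (hρ : AEStronglyMeasurable ρ (μ.prod ν))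
    (hC : ∀ p, ‖ρ p‖ ≤ C) :
    Integrable (fun p : α × (ℝ × ℝ) => φ p.1 ∘L ρ p) (μ.prod ν) := by
  refine ((hφ.comp_fst ν).norm.mul_const C).mono'
    (isBoundedBilinearMap_comp.continuous.comp_aestronglyMeasurable
      ((hφ.comp_fst ν).aestronglyMeasurable.prodMk hρ)) (ae_of_all _ fun p => ?_)
  refine (ContinuousLinearMap.opNorm_comp_le _ _).trans ?_
  gcongr
  exact hC _

/-- Fubini's theorem for a row vector measure applied to the image of a source under a kernel. -/
theorem integral_apply_kernel (hφ : Integrable φ μ) (hρ : AEStronglyMeasurable ρ (μ.prod ν))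
    (hC : ∀ p, ‖ρ p‖ ≤ C) {h : ℝ × ℝ → Vec n} (hh : StronglyMeasurable h) {M : ℝ}
    (hM : ∀ w, ‖h w‖ ≤ M) :
    ∫ a, φ a (∫ w, ρ (a, w) (h w) ∂ν) ∂μ = ∫ w, (∫ a, φ a ∘L ρ (a, w) ∂μ) (h w) ∂ν := by
  have hI := integrable_comp_kernel hφ hρ hC
  have hIh : Integrable (fun p : α × (ℝ × ℝ) => (φ p.1 ∘L ρ p) (h p.2)) (μ.prod ν) :=
    integrableOn_clm_apply_density hI (hh.comp_measurable measurable_snd).aestronglyMeasurable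
      (ae_of_all _ fun p => hM _)
  have h1 : ∀ᵐ a ∂μ, φ a (∫ w, ρ (a, w) (h w) ∂ν) = ∫ w, (φ a ∘L ρ (a, w)) (h w) ∂ν := by
    filter_upwards [hρ.prodMk_left] with a ha
    have : Integrable (fun w => ρ (a, w) (h w)) ν :=
      integrableOn_clm_apply_density (Integrable.of_bound ha C (ae_of_all _ fun w => hC _))
        hh.aestronglyMeasurable (ae_of_all _ hM)
    exact ((φ a).integral_comp_comm this).symm
  have h2 : ∀ᵐ w ∂ν, (∫ a, φ a ∘L ρ (a, w) ∂μ) (h w) = ∫ a, (φ a ∘L ρ (a, w)) (h w) ∂μ := by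
    filter_upwards [hI.prod_left_ae] with w hw
    exact ContinuousLinearMap.integral_apply hw _
  rw [integral_congr_ae h1, integral_congr_ae h2]
  exact integral_integral_swap hIh

end

theorem integrable_sum_of_integrable {α ι F : Type*} [Fintype ι] [MeasurableSpace α] {μ : Measure α}
    [NormedAddCommGroup F] {g : ι → α → F} (hg : ∀ i, Integrable (g i) μ) :
    Integrable (fun x => ∑ i, g i x) μ :=
  integrable_finsetSum _ fun i _ => hg i

instance {N : ℕ} (c : Curve N) : IsFiniteMeasure (volume.restrict c.smooth) :=
  ⟨by
    rw [Measure.restrict_apply_univ]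
    exact (measure_mono sdiff_subset).trans_lt (measure_Icc_lt_top (a := (0 : ℝ)) (b := c.ℓ))⟩

namespace Data

variable {n m N : ℕ} {d : Data n m N} {π : ControlledState n m}
  {R Rs Rt : ℝ × ℝ → ℝ × ℝ → Mat n}

/-- The arguments of the curve cost along a controlled state. -/
def curveArg (d : Data n m N) (π : ControlledState n m) (μ : ℝ) : (ℝ × ℝ) × (Vec n × Vec n) :=
  (d.c.pt μ, (π.x (d.c.pt μ), d.c.tangential π.p π.q μ))

theorem isCompact_range (c : Curve N) : IsCompact c.range :=
  isCompact_Icc.image_of_continuousOn c.continuousOn_pt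

theorem isDensity_x (hπ : d.IsState π) : IsDensity d.c.G (d.c.G.indicator π.x) :=
  hπ.density (Ψ := fun w => w.2.1.1) (by fun_prop)

theorem isDensity_p (hπ : d.IsState π) : IsDensity d.c.G (d.c.G.indicator π.p) :=
  hπ.density (Ψ := fun w => w.2.1.2.1) (by fun_prop)

theorem isDensity_q (hπ : d.IsState π) : IsDensity d.c.G (d.c.G.indicator π.q) :=
  hπ.density (Ψ := fun w => w.2.1.2.2) (by fun_prop)

/-- A bounded Borel function on `G` is bounded and measurable along the curve. -/
theorem integrableOn_smooth_pt {F : Type*} [NormedAddCommGroup F] [NormedSpace ℝ F]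
    {v : ℝ × ℝ → F} (hv : IsDensity d.c.G (d.c.G.indicator v)) {θ : ℝ → ℝ} (hθ : Measurable θ)
    (hθ1 : ∀ m ∈ d.c.smooth, |θ m| ≤ 1) :
    IntegrableOn (fun m => θ m • v (d.c.pt m)) d.c.smooth := by
  obtain ⟨C, h0, hC⟩ := hv.bdd
  have h : IntegrableOn (fun m => θ m • d.c.G.indicator v (d.c.pt m)) d.c.smooth := by
    refine Integrable.of_bound
      (hθ.aestronglyMeasurable.smul (d.c.aestronglyMeasurable_comp_pt hv.sm)) C ?_
    refine (ae_restrict_mem d.c.measurableSet_smooth).mono fun m hm => ?_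
    rw [norm_smul]
    exact (mul_le_mul (hθ1 m hm) (hC _) (norm_nonneg _) zero_le_one).trans (one_mul C).le
  exact h.congr_fun (fun m hm => by simp only [indicator_of_mem (d.c.pt_mem_G hm.1)])
    d.c.measurableSet_smooth

theorem norm_tangential_le {p q : ℝ × ℝ → Vec n} {C : ℝ} {μ : ℝ} (hμ : μ ∈ d.c.smooth)
    (hp : ‖p (d.c.pt μ)‖ ≤ C) (hq : ‖q (d.c.pt μ)‖ ≤ C) : ‖d.c.tangential p q μ‖ ≤ 2 * C := by
  have h := d.c.abs_deriv_le hμ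
  rw [Curve.tangential, Curve.n₂, Curve.n₁, neg_neg, two_mul]
  refine (norm_add_le _ _).trans (add_le_add ?_ ?_)
  · rw [norm_smul]
    exact (mul_le_mul h.1 hp (norm_nonneg _) zero_le_one).trans (one_mul C).le
  · rw [norm_smul]
    exact (mul_le_mul h.2 hq (norm_nonneg _) zero_le_one).trans (one_mul C).le

theorem curveArg_bounded (hπ : d.IsState π) :
    ∃ C : ℝ, ∀ m ∈ d.c.smooth, ‖(d.curveArg π m).2‖ ≤ C := by
  obtain ⟨C, hC⟩ := hπ.bounded
  refine ⟨max C (2 * C), fun m hm => norm_prod_le_iff.2 ⟨?_, ?_⟩⟩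
  · exact (hC _ (d.c.pt_mem_G hm.1)).1.trans (le_max_left _ _)
  · exact (norm_tangential_le hm (hC _ (d.c.pt_mem_G hm.1)).2.1
      (hC _ (d.c.pt_mem_G hm.1)).2.2).trans (le_max_right _ _)

theorem curveArg_mem {m : ℝ} (hm : m ∈ d.c.smooth) :
    d.curveArg π m ∈ d.c.range ×ˢ (univ : Set (Vec n × Vec n)) :=
  ⟨mem_image_of_mem _ hm.1, mem_univ _⟩

theorem aestronglyMeasurable_curve (hπ : d.IsState π) {F : Type*} [NormedAddCommGroup F]
    {Ψ : (ℝ × ℝ) × (Vec n × Vec n) → F} (hΨ : ContinuousOn Ψ (d.c.range ×ˢ univ)) :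
    AEStronglyMeasurable (fun m => Ψ (d.curveArg π m)) (volume.restrict d.c.smooth) := by
  have hS : MeasurableSet (d.c.range ×ˢ (univ : Set (Vec n × Vec n))) :=
    (isCompact_range d.c).measurableSet.prod MeasurableSet.univ
  have hs := d.c.measurableSet_smooth
  have hpt : AEMeasurable d.c.pt (volume.restrict d.c.smooth) :=
    (d.c.continuousOn_pt.mono sdiff_subset).aemeasurable hs
  have cp : ∀ {v : ℝ × ℝ → Vec n}, IsDensity d.c.G (d.c.G.indicator v) →
      AEMeasurable (fun m => v (d.c.pt m)) (volume.restrict d.c.smooth) := fun {v} hv =>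
    (d.c.aestronglyMeasurable_comp_pt hv.sm).aemeasurable.congr
      ((ae_restrict_mem hs).mono fun m hm => indicator_of_mem (d.c.pt_mem_G hm.1) _)
  have harg : AEMeasurable (d.curveArg π) (volume.restrict d.c.smooth) := by
    refine hpt.prodMk ((cp (isDensity_x hπ)).prodMk ?_)
    exact ((measurable_deriv d.c.L₁).neg.neg.aemeasurable.smul (cp (isDensity_p hπ))).add
      ((measurable_deriv d.c.L₂).aemeasurable.smul (cp (isDensity_q hπ)))
  have := (stronglyMeasurable_indicator_of_continuousOn hS hΨ).aestronglyMeasurable.comp_aemeasurable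
    harg
  exact this.congr ((ae_restrict_mem hs).mono fun m hm => indicator_of_mem (curveArg_mem hm) _)

theorem curve_bounded (hπ : d.IsState π) {F : Type*} [NormedAddCommGroup F]
    {Ψ : (ℝ × ℝ) × (Vec n × Vec n) → F} (hΨ : ContinuousOn Ψ (d.c.range ×ˢ univ)) :
    ∃ C : ℝ, ∀ m ∈ d.c.smooth, ‖Ψ (d.curveArg π m)‖ ≤ C := by
  obtain ⟨C, hC⟩ := curveArg_bounded hπ
  obtain ⟨M, _, hM⟩ := exists_uniform_bound (isCompact_range d.c) hΨ C
  exact ⟨M, fun m hm => hM _ (curveArg_mem (π := π) hm).1 _ (hC m hm)⟩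

theorem integrableOn_curve (hπ : d.IsState π) {F : Type*} [NormedAddCommGroup F]
    {Ψ : (ℝ × ℝ) × (Vec n × Vec n) → F} (hΨ : ContinuousOn Ψ (d.c.range ×ˢ univ)) :
    IntegrableOn (fun m => Ψ (d.curveArg π m)) d.c.smooth := by
  obtain ⟨C, hC⟩ := curve_bounded hπ hΨ
  exact Integrable.of_bound (aestronglyMeasurable_curve hπ hΨ) C
    ((ae_restrict_mem d.c.measurableSet_smooth).mono hC)

/-- The derivative of the curve cost in the state variables. -/
def D₁ (d : Data n m N) (w : (ℝ × ℝ) × (Vec n × Vec n)) : (Vec n × Vec n) →L[ℝ] ℝ :=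
  fderiv ℝ (fun y : Vec n × Vec n => d.Φ₁ w.1 y.1 y.2) w.2

theorem Φ₁x_eq (hd : d.Regular) {μ : ℝ} (hμ : μ ∈ d.c.smooth) :
    d.Φ₁x π μ = d.D₁ (d.curveArg π μ) ∘L ContinuousLinearMap.inl ℝ _ _ :=
  (HasFDerivAt.comp (f := fun e => (e, d.c.tangential π.p π.q μ)) (π.x (d.c.pt μ))
    (hd.Φ₁_differentiable _ (mem_image_of_mem _ hμ.1)
      (π.x (d.c.pt μ), d.c.tangential π.p π.q μ)).hasFDerivAt
    (hasFDerivAt_prodMk_left _ _)).fderiv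

theorem Φ₁η_eq (hd : d.Regular) {μ : ℝ} (hμ : μ ∈ d.c.smooth) :
    d.Φ₁η π μ = d.D₁ (d.curveArg π μ) ∘L ContinuousLinearMap.inr ℝ _ _ :=
  (HasFDerivAt.comp (f := fun e => (π.x (d.c.pt μ), e)) (d.c.tangential π.p π.q μ)
    (hd.Φ₁_differentiable _ (mem_image_of_mem _ hμ.1)
      (π.x (d.c.pt μ), d.c.tangential π.p π.q μ)).hasFDerivAt
    (hasFDerivAt_prodMk_right _ _)).fderiv

theorem D₁_apply (hd : d.Regular) {μ : ℝ} (hμ : μ ∈ d.c.smooth) (ξ η : Vec n) :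
    d.D₁ (d.curveArg π μ) (ξ, η) = d.Φ₁x π μ ξ + d.Φ₁η π μ η := by
  rw [Φ₁x_eq hd hμ, Φ₁η_eq hd hμ]
  simp only [ContinuousLinearMap.comp_apply, ContinuousLinearMap.inl_apply,
    ContinuousLinearMap.inr_apply, ← map_add, Prod.mk_add_mk, add_zero, zero_add]

theorem integrableOn_Φ₁x (hd : d.Regular) (hπ : d.IsState π) :
    IntegrableOn (d.Φ₁x π) d.c.smooth := by
  have h : ContinuousOn (fun w => d.D₁ w ∘L ContinuousLinearMap.inl ℝ (Vec n) (Vec n))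
      (d.c.range ×ˢ univ) :=
    ContinuousOn.clm_comp hd.Φ₁_continuousOn_fderiv continuousOn_const
  exact (integrableOn_curve hπ h).congr_fun (fun m hm => (Φ₁x_eq hd hm).symm)
    d.c.measurableSet_smooth

section costate

variable (hd : d.Regular) (hπ : d.IsState π) (hreg : d.CostateRegular π)

include hd hπ hreg

theorem integrableOn_F : IntegrableOn (d.F π) d.c.G :=
  ((IsDensity.integrableOn_of_indicator d.c.isStaircase_G (hd.Φ_C1.dx_density hπ)).sub
    hreg.integrable_s).sub hreg.integrable_t

theorem integrableOn_F₁ : IntegrableOn (d.F₁ π) d.c.smooth := by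
  have h1 := integrableOn_smooth_pt (hd.Φ_C1.dp_density hπ) (measurable_deriv d.c.L₂)
    fun m hm => (d.c.abs_deriv_le hm).2
  have h2 := integrableOn_smooth_pt (hd.Φ_C1.dq_density hπ) (measurable_deriv d.c.L₁).neg
    fun m hm => by rw [Pi.neg_apply, abs_neg]; exact (d.c.abs_deriv_le hm).1
  exact ((h1.add h2).add (integrableOn_Φ₁x hd hπ)).sub (d.c.integrableOn_deriv_smooth hreg.ac_μ)

omit hd hπ hreg in
-- With R extended by zero the restrictions to E(s,t), to the part of the curve above (s,t) and to
-- the dominating vertices become automatic, and all integrals run over domains independent of w.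
theorem costate_eq (π : ControlledState n m) (R : ℝ × ℝ → ℝ × ℝ → Mat n) (w : ℝ × ℝ) :
    d.costate π R w = (∫ z in d.c.G, d.F π z ∘L zeroExt d.c.G R (z, w)) +
      (∫ μ in d.c.smooth, d.F₁ π μ ∘L zeroExt d.c.G R (d.c.pt μ, w)) +
      ∑ r : Fin N, d.F₀ π r.succ.castSucc ∘L zeroExt d.c.G R (d.c.P r.succ.castSucc, w) := by
  have hG := d.c.isStaircase_G.measurableSet
  have hE : MeasurableSet (d.c.E w) :=
    hG.inter (measurableSet_mem_W.preimage (measurable_id.prodMk measurable_const))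
  rw [costate, ← d.c.setIntegral_smooth]
  congr 1
  · congr 1
    · rw [setIntegral_eq_of_subset_of_forall_sdiff_eq_zero hG (s := d.c.E w) (fun z hz => hz.1)
        fun z hz => by rw [zeroExt_of_notMem fun h => hz.2 h, ContinuousLinearMap.comp_zero]]
      exact setIntegral_congr_fun hE fun z hz => by simp only [zeroExt_of_mem hz.1 hz.2]
    · refine setIntegral_congr_fun d.c.measurableSet_smooth fun μ hμ => ?_
      by_cases h : w ∈ W (d.c.pt μ)
      · simp only [if_pos h, zeroExt_of_mem (d.c.pt_mem_G hμ.1) h]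
      · simp only [if_neg h, zeroExt_of_notMem fun h' => h h'.2, ContinuousLinearMap.comp_zero]
  · refine Finset.sum_congr rfl fun r _ => ?_
    by_cases h : w ∈ W (d.c.P r.succ.castSucc)
    · simp only [if_pos h, zeroExt_of_mem (d.c.P_mem_G _) h]
    · simp only [if_neg h, zeroExt_of_notMem fun h' => h h'.2, ContinuousLinearMap.comp_zero]

variable (hR : d.IsRiemann π R Rs Rt)

include hR

omit hd hπ hreg in
theorem aestronglyMeasurable_kernel_curve (ν : Measure (ℝ × ℝ)) [IsFiniteMeasure ν] :
    AEStronglyMeasurable (fun p : ℝ × (ℝ × ℝ) => zeroExt d.c.G R (d.c.pt p.1, p.2))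
      ((volume.restrict d.c.smooth).prod ν) := by
  have hpt : AEMeasurable d.c.pt (volume.restrict d.c.smooth) :=
    (d.c.continuousOn_pt.mono sdiff_subset).aemeasurable d.c.measurableSet_smooth
  have hm : AEMeasurable (fun p : ℝ × (ℝ × ℝ) => (d.c.pt p.1, p.2))
      ((volume.restrict d.c.smooth).prod ν) :=
    (hpt.comp_quasiMeasurePreserving Measure.quasiMeasurePreserving_fst).prodMk
      measurable_snd.aemeasurable
  exact hR.kernel_R.sm.aestronglyMeasurable.comp_aemeasurable hm

/-- The densities `F` and `F₁` are integrable, there are finitely many vertex weights, and the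
Riemann function is bounded. -/
theorem exists_costate_bound : ∃ C, 0 ≤ C ∧ ∀ w, ‖d.costate π R w‖ ≤ C := by
  obtain ⟨C, hC⟩ := hR.kernel_R.bdd
  have hC0 : 0 ≤ C := (norm_nonneg _).trans (hC 0)
  refine ⟨(∫ z in d.c.G, ‖d.F π z‖) * C + (∫ μ in d.c.smooth, ‖d.F₁ π μ‖) * C +
    ∑ r : Fin N, ‖d.F₀ π r.succ.castSucc‖ * C, ?_, fun w => ?_⟩
  · have h1 : 0 ≤ ∫ z in d.c.G, ‖d.F π z‖ := integral_nonneg fun _ => norm_nonneg _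
    have h2 : 0 ≤ ∫ μ in d.c.smooth, ‖d.F₁ π μ‖ := integral_nonneg fun _ => norm_nonneg _
    positivity
  · rw [costate_eq]
    refine norm_add₃_le.trans (add_le_add (add_le_add ?_ ?_) ?_)
    · exact norm_integral_comp_kernel_le (integrableOn_F hd hπ hreg) hC w
    · exact norm_integral_comp_kernel_le (ρ := fun p => zeroExt d.c.G R (d.c.pt p.1, p.2))
        (integrableOn_F₁ hd hπ hreg) (fun p => hC _) w
    · refine (norm_sum_le _ _).trans (Finset.sum_le_sum fun r _ => ?_)
      refine (ContinuousLinearMap.opNorm_comp_le _ _).trans ?_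
      gcongr
      exact hC _

/-- Duality: the weights of the co-state, applied to the state produced by a source. -/
theorem integral_costate {h k : ℝ × ℝ → Vec n} (hh : IsDensity d.c.G h)
    (hX : ∀ z ∈ d.c.G, int₁₂ k z = ∫ w in W (d.c.a, d.c.b), zeroExt d.c.G R (z, w) (h w)) :
    IntegrableOn (fun w => d.costate π R w) d.c.G ∧
    ∫ w in d.c.G, d.costate π R w (h w) = (∫ z in d.c.G, d.F π z (int₁₂ k z)) +
      (∫ μ in d.c.smooth, d.F₁ π μ (int₁₂ k (d.c.pt μ))) +
      ∑ r : Fin N, d.F₀ π r.succ.castSucc (int₁₂ k (d.c.P r.succ.castSucc)) := by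
  have hG := d.c.isStaircase_G
  obtain ⟨C, hC⟩ := hR.kernel_R.bdd
  obtain ⟨M, _, hM⟩ := hh.bdd
  have iF := integrableOn_F hd hπ hreg
  have iF₁ := integrableOn_F₁ hd hπ hreg
  have m₁ := aestronglyMeasurable_kernel_curve hR (volume.restrict (W (d.c.a, d.c.b)))
  have m₀ : AEStronglyMeasurable (zeroExt d.c.G R)
    ((volume.restrict d.c.G).prod (volume.restrict (W (d.c.a, d.c.b)))) :=
    hR.kernel_R.sm.aestronglyMeasurable
  have iW₀ : Integrable (fun w => ∫ z in d.c.G, d.F π z ∘L zeroExt d.c.G R (z, w))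
      (volume.restrict (W (d.c.a, d.c.b))) := (integrable_comp_kernel iF m₀ hC).integral_prod_right
  have iW₁ : Integrable (fun w => ∫ μ in d.c.smooth, d.F₁ π μ ∘L zeroExt d.c.G R (d.c.pt μ, w))
      (volume.restrict (W (d.c.a, d.c.b))) :=
    (integrable_comp_kernel iF₁ m₁ fun p => hC _).integral_prod_right
  have iR : ∀ r : Fin N, Integrable
      (fun w => d.F₀ π r.succ.castSucc ∘L zeroExt d.c.G R (d.c.P r.succ.castSucc, w))
      (volume.restrict (W (d.c.a, d.c.b))) := fun r => by
    have := hR.kernel_R.integrable_comp (μ := volume.restrict (W (d.c.a, d.c.b)))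
      (φ := fun w => (d.c.P r.succ.castSucc, w)) (by fun_prop)
    exact (ContinuousLinearMap.compL ℝ (Vec n) (Vec n) ℝ (d.F₀ π r.succ.castSucc)).integrable_comp this
  have ap : ∀ {φ : ℝ × ℝ → Covec n}, Integrable φ (volume.restrict (W (d.c.a, d.c.b))) →
      Integrable (fun w => φ w (h w)) (volume.restrict (W (d.c.a, d.c.b))) := fun hφ =>
    integrableOn_clm_apply_density hφ hh.sm.aestronglyMeasurable (ae_of_all _ hM)
  constructor
  · have : Integrable (d.costate π R) (volume.restrict (W (d.c.a, d.c.b))) := by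
      rw [funext (costate_eq π R)]
      exact (iW₀.add iW₁).add (integrable_sum_of_integrable iR)
    exact IntegrableOn.mono_set this hG.subset
  -- The source vanishes off G, so the integral is extended to the rectangle on which the
  -- representation of the state by R is formulated.
  · have e : ∫ w in d.c.G, d.costate π R w (h w) =
        ∫ w in W (d.c.a, d.c.b), d.costate π R w (h w) :=
      (setIntegral_eq_of_subset_of_forall_sdiff_eq_zero (measurableSet_W _) hG.subset
        fun w hw => by rw [hh.zero w hw.2, map_zero]).symm
    rw [e]
    simp only [costate_eq π R, _root_.add_apply, _root_.sum_apply]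
    have i01 : Integrable (fun w => (∫ z in d.c.G, d.F π z ∘L zeroExt d.c.G R (z, w)) (h w) +
        (∫ μ in d.c.smooth, d.F₁ π μ ∘L zeroExt d.c.G R (d.c.pt μ, w)) (h w))
        (volume.restrict (W (d.c.a, d.c.b))) := (ap iW₀).add (ap iW₁)
    rw [integral_add i01 (integrable_finsetSum _ fun r _ => ap (iR r)),
      integral_add (ap iW₀) (ap iW₁), integral_finsetSum _ fun r _ => ap (iR r)]
    congr 1
    · congr 1
      · rw [← integral_apply_kernel iF m₀ hC hh.sm hM]
        exact setIntegral_congr_fun hG.measurableSet fun z hz => by simp only [hX z hz]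
      · rw [← integral_apply_kernel (ρ := fun p => zeroExt d.c.G R (d.c.pt p.1, p.2))
          iF₁ m₁ (fun p => hC _) hh.sm hM]
        exact setIntegral_congr_fun d.c.measurableSet_smooth fun μ hμ => by
          simp only [hX _ (d.c.pt_mem_G hμ.1)]
    · refine Finset.sum_congr rfl fun r _ => ?_
      have := (hR.kernel_R.apply hh).integrable_comp (μ := volume.restrict (W (d.c.a, d.c.b)))
        (φ := fun w => (d.c.P r.succ.castSucc, w)) (by fun_prop)
      rw [hX _ (d.c.P_mem_G _)]
      exact ((d.F₀ π r.succ.castSucc).integral_comp_comm this)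

end costate

end Data

end
end GoursatControl

namespace GoursatControl
noncomputable section
open Filter Topology

/-! ### Variations of the state -/

section ops

variable {V : Type*} [NormedAddCommGroup V] [NormedSpace ℝ V] {G : Set (ℝ × ℝ)} {a b : ℝ}
  {k : ℝ × ℝ → V}

namespace IsDensity

theorem integrableOn_ops (hG : IsStaircase G a b) (hk : IsDensity G k) :
    IntegrableOn (int₁₂ k) G ∧ IntegrableOn (int₂ k) G ∧ IntegrableOn (int₁ k) G := by
  obtain ⟨C, _, hC⟩ := hk.bdd_ops hG
  have hfin : IsFiniteMeasure (volume.restrict G) :=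
    ⟨by rw [Measure.restrict_apply_univ]; exact hG.volume_lt_top⟩
  exact ⟨Integrable.of_bound hk.sm_int₁₂.aestronglyMeasurable C (bdd_ae hG fun z hz => (hC z hz).1),
    Integrable.of_bound hk.sm_int₂.aestronglyMeasurable C (bdd_ae hG fun z hz => (hC z hz).2.1),
    Integrable.of_bound hk.sm_int₁.aestronglyMeasurable C (bdd_ae hG fun z hz => (hC z hz).2.2)⟩

theorem integral_norm_int₁₂_le (hG : IsStaircase G a b) (ha : 0 ≤ a) (hb : 0 ≤ b)
    (hk : IsDensity G k) : ∫ z in G, ‖int₁₂ k z‖ ≤ a * b * ∫ z, ‖k z‖ := by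
  have h0 : 0 ≤ ∫ z, ‖k z‖ := integral_nonneg fun _ => norm_nonneg _
  have h1 : ∫ z in G, ‖int₁₂ k z‖ ≤ ∫ z in G, ∫ w, ‖k w‖ :=
    setIntegral_mono_on (hk.integrableOn_ops hG).1.norm
      (integrableOn_const hG.volume_lt_top.ne) hG.measurableSet fun z _ => norm_int₁₂_le hG hk z
  refine h1.trans ?_
  rw [setIntegral_const, smul_eq_mul]
  gcongr
  have h2 : volume.real G ≤ volume.real (Icc 0 a ×ˢ Icc 0 b : Set (ℝ × ℝ)) :=
    measureReal_mono hG.subset (by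
      rw [Measure.volume_eq_prod, Measure.prod_prod]
      exact (ENNReal.mul_lt_top measure_Icc_lt_top measure_Icc_lt_top).ne)
  refine h2.trans (le_of_eq ?_)
  rw [Measure.volume_eq_prod, measureReal_prod_prod, Real.volume_real_Icc_of_le ha,
    Real.volume_real_Icc_of_le hb, sub_zero, sub_zero]

/-- Extending the vertical integrals of ‖k‖ to full height makes them independent of t; integration
over the rectangle then multiplies ∫‖k‖ by b. -/
theorem integral_norm_int₂_le (hG : IsStaircase G a b) (ha : 0 ≤ a) (hb : 0 ≤ b)
    (hk : IsDensity G k) : ∫ z in G, ‖int₂ k z‖ ≤ b * ∫ z, ‖k z‖ := by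
  have hκ := hk.norm
  obtain ⟨C, h0, hC⟩ := hκ.bdd
  have hi : IntegrableOn (fun z : ℝ × ℝ => int₂ (fun w => ‖k w‖) (z.1, b)) (W (a, b)) := by
    refine Integrable.of_bound (hκ.sm_int₂.comp_measurable (by fun_prop)).aestronglyMeasurable
      (C * b) (ae_of_all _ fun z => ?_)
    refine (norm_setIntegral_le_of_norm_le_const measure_Icc_lt_top fun τ _ => hC _).trans
      (le_of_eq ?_)
    rw [Real.volume_real_Icc_of_le hb, sub_zero]
  have h1 : ∫ z in G, ‖int₂ k z‖ ≤ ∫ z in G, int₂ (fun w => ‖k w‖) (z.1, b) := by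
    refine setIntegral_mono_on (hk.integrableOn_ops hG).2.1.norm (hi.mono_set hG.subset)
      hG.measurableSet fun z hz => (norm_int₂_le_int₂_norm k z).trans ?_
    exact setIntegral_mono_set (hκ.integrable_section hG z.1).integrableOn
      (ae_of_all _ fun _ => norm_nonneg _)
      (Icc_subset_Icc_right (hG.le z hz).2).eventuallyLE
  have h2 : ∫ z in G, int₂ (fun w => ‖k w‖) (z.1, b) ≤
      ∫ z in W (a, b), int₂ (fun w => ‖k w‖) (z.1, b) :=
    setIntegral_mono_set hi (ae_of_all _ fun _ => integral_nonneg fun _ => norm_nonneg _)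
      hG.subset.eventuallyLE
  have h3 : ∫ z in W (a, b), int₂ (fun w => ‖k w‖) (z.1, b) =
      b * int₁₂ (fun w => ‖k w‖) (a, b) := by
    rw [W] at hi ⊢
    rw [Measure.volume_eq_prod, setIntegral_prod _ hi, hκ.int₁₂_eq hG, int₁, ← integral_const_mul]
    refine setIntegral_congr_fun measurableSet_Icc fun σ _ => ?_
    simp only [setIntegral_const, Real.volume_real_Icc_of_le hb, sub_zero, smul_eq_mul]
  have h4 := norm_int₁₂_le hG hκ (a, b)
  simp only [norm_norm] at h4
  rw [h3] at h2
  refine h1.trans (h2.trans ?_)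
  gcongr
  exact (le_abs_self _).trans h4

theorem integral_norm_int₁_le (hG : IsStaircase G a b) (ha : 0 ≤ a) (hb : 0 ≤ b)
    (hk : IsDensity G k) : ∫ z in G, ‖int₁ k z‖ ≤ a * ∫ z, ‖k z‖ := by
  have hκ := hk.norm
  obtain ⟨C, h0, hC⟩ := hκ.bdd
  have hi : IntegrableOn (fun z : ℝ × ℝ => int₁ (fun w => ‖k w‖) (a, z.2)) (W (a, b)) := by
    refine Integrable.of_bound (hκ.sm_int₁.comp_measurable (by fun_prop)).aestronglyMeasurable
      (C * a) (ae_of_all _ fun z => ?_)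
    refine (norm_setIntegral_le_of_norm_le_const measure_Icc_lt_top fun σ _ => hC _).trans
      (le_of_eq ?_)
    rw [Real.volume_real_Icc_of_le ha, sub_zero]
  have h1 : ∫ z in G, ‖int₁ k z‖ ≤ ∫ z in G, int₁ (fun w => ‖k w‖) (a, z.2) := by
    refine setIntegral_mono_on (hk.integrableOn_ops hG).2.2.norm (hi.mono_set hG.subset)
      hG.measurableSet fun z hz => (norm_int₁_le_int₁_norm k z).trans ?_
    exact setIntegral_mono_set (hκ.integrable_section' hG z.2).integrableOn
      (ae_of_all _ fun _ => norm_nonneg _)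
      (Icc_subset_Icc_right (hG.le z hz).1).eventuallyLE
  have h2 : ∫ z in G, int₁ (fun w => ‖k w‖) (a, z.2) ≤
      ∫ z in W (a, b), int₁ (fun w => ‖k w‖) (a, z.2) :=
    setIntegral_mono_set hi (ae_of_all _ fun _ => integral_nonneg fun _ => norm_nonneg _)
      hG.subset.eventuallyLE
  have h3 : ∫ z in W (a, b), int₁ (fun w => ‖k w‖) (a, z.2) =
      a * int₁₂ (fun w => ‖k w‖) (a, b) := by
    rw [W] at hi ⊢
    rw [Measure.volume_eq_prod, setIntegral_prod _ hi, hκ.int₁₂_eq' hG, int₂]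
    simp only [setIntegral_const, Real.volume_real_Icc_of_le ha, sub_zero, smul_eq_mul]
  have h4 := norm_int₁₂_le hG hκ (a, b)
  simp only [norm_norm] at h4
  rw [h3] at h2
  refine h1.trans (h2.trans ?_)
  gcongr
  exact (le_abs_self _).trans h4

end IsDensity

end ops

namespace Data

variable {n m N : ℕ} {d : Data n m N} {π ρ : ControlledState n m}
  {R Rs Rt : ℝ × ℝ → ℝ × ℝ → Mat n}

/-- Integration by parts moves the derivatives from X = `int₁₂ k` onto Φ_p, Φ_q and Φ_{1,η}. The
boundary terms of the area integrals land on the curve as n₁Φ_p + n₂Φ_q, and those of the curve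
integral land on the vertices as jumps. The costs at the two end vertices drop out because X
vanishes on the axes. -/
theorem linearized_cost (hd : d.Regular) (hπ : d.IsState π) (hreg : d.CostateRegular π)
    {k : ℝ × ℝ → Vec n} (hk : IsDensity d.c.G k) :
    IntegrableOn (fun z => along (dx d.Φ) π z (int₁₂ k z) + along (dp d.Φ) π z (int₂ k z) +
      along (dq d.Φ) π z (int₁ k z)) d.c.G ∧
    IntegrableOn (fun μ => d.Φ₁x π μ (int₁₂ k (d.c.pt μ)) + d.Φ₁η π μ (d.c.traceDeriv k μ))
      d.c.smooth ∧
    (∫ z in d.c.G, (along (dx d.Φ) π z (int₁₂ k z) + along (dp d.Φ) π z (int₂ k z) +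
      along (dq d.Φ) π z (int₁ k z))) +
    (∫ μ in d.c.smooth, (d.Φ₁x π μ (int₁₂ k (d.c.pt μ)) + d.Φ₁η π μ (d.c.traceDeriv k μ))) +
    ∑ r, fderiv ℝ (d.Φ₀ (d.c.P r)) (π.x (d.c.P r)) (int₁₂ k (d.c.P r)) =
    (∫ z in d.c.G, d.F π z (int₁₂ k z)) + (∫ μ in d.c.smooth, d.F₁ π μ (int₁₂ k (d.c.pt μ))) +
      ∑ r : Fin N, d.F₀ π r.succ.castSucc (int₁₂ k (d.c.P r.succ.castSucc)) := by
  have hG := d.c.isStaircase_G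
  have iX := IsDensity.integrableOn_of_indicator hG (hd.Φ_C1.dx_density hπ)
  have iP := IsDensity.integrableOn_of_indicator hG (hd.Φ_C1.dp_density hπ)
  have iQ := IsDensity.integrableOn_of_indicator hG (hd.Φ_C1.dq_density hπ)
  have jX := (d.c.integrableOn_apply_ops iX hk).1
  have jP := (d.c.integrableOn_apply_ops iP hk).2.1
  have jQ := (d.c.integrableOn_apply_ops iQ hk).2.2
  have jS := (d.c.integrableOn_apply_ops hreg.integrable_s hk).1
  have jT := (d.c.integrableOn_apply_ops hreg.integrable_t hk).1
  obtain ⟨bP, eP⟩ := d.c.integral_by_parts_fst iP hk hreg.ac_s hreg.integrable_s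
  obtain ⟨bQ, eQ⟩ := d.c.integral_by_parts_snd iQ hk hreg.ac_t hreg.integrable_t
  obtain ⟨bη, bη', eη⟩ := d.c.integral_by_parts_curve hk hreg.ac_μ
  obtain ⟨C, _, hC⟩ := hk.bdd_ops hG
  have b1 : IntegrableOn (fun μ => d.Φ₁x π μ (int₁₂ k (d.c.pt μ))) d.c.smooth :=
    integrableOn_clm_apply_density (integrableOn_Φ₁x hd hπ)
      (d.c.aestronglyMeasurable_comp_pt hk.sm_int₁₂)
      ((ae_restrict_mem d.c.measurableSet_smooth).mono fun m hm => (hC _ (d.c.pt_mem_G hm.1)).1)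
  have jXP : IntegrableOn (fun z => along (dx d.Φ) π z (int₁₂ k z) +
    along (dp d.Φ) π z (int₂ k z)) d.c.G := jX.add jP
  refine ⟨jXP.add jQ, b1.add bη, ?_⟩
  have eF : ∫ z in d.c.G, d.F π z (int₁₂ k z) = (∫ z in d.c.G, along (dx d.Φ) π z (int₁₂ k z)) -
      (∫ z in d.c.G, deriv (fun σ => along (dp d.Φ) π (σ, z.2)) z.1 (int₁₂ k z)) -
      ∫ z in d.c.G, deriv (fun τ => along (dq d.Φ) π (z.1, τ)) z.2 (int₁₂ k z) := by
    have e := integral_sub (jX.sub jS) jT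
    simp only [Pi.sub_apply] at e
    rw [integral_sub jX jS] at e
    exact e
  have eF₁ : ∫ μ in d.c.smooth, d.F₁ π μ (int₁₂ k (d.c.pt μ)) =
      (∫ μ in d.c.smooth, deriv d.c.L₂ μ • along (dp d.Φ) π (d.c.pt μ) (int₁₂ k (d.c.pt μ))) +
      (∫ μ in d.c.smooth, (-deriv d.c.L₁ μ) • along (dq d.Φ) π (d.c.pt μ) (int₁₂ k (d.c.pt μ))) +
      (∫ μ in d.c.smooth, d.Φ₁x π μ (int₁₂ k (d.c.pt μ))) -
      ∫ μ in d.c.smooth, deriv (d.Φ₁η π) μ (int₁₂ k (d.c.pt μ)) := by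
    have e := integral_sub ((bP.add bQ).add b1) bη'
    have e' := integral_add (bP.add bQ) b1
    simp only [Pi.add_apply] at e e'
    rw [e', integral_add bP bQ] at e
    exact e
  have e0 : d.c.P (Fin.castSucc 0) = (d.c.a, 0) := by
    rw [Fin.castSucc_zero, Curve.P, Curve.pt, d.c.vert_zero, d.c.start_eq.1, d.c.start_eq.2]
  have el : d.c.P (Fin.last (N + 1)) = (0, d.c.b) := by
    rw [Curve.P, Curve.pt, d.c.vert_last, d.c.end_eq.1, d.c.end_eq.2]
  have eV : ∑ r, fderiv ℝ (d.Φ₀ (d.c.P r)) (π.x (d.c.P r)) (int₁₂ k (d.c.P r)) =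
      ∑ r : Fin N, fderiv ℝ (d.Φ₀ (d.c.P r.succ.castSucc)) (π.x (d.c.P r.succ.castSucc))
        (int₁₂ k (d.c.P r.succ.castSucc)) := by
    rw [Fin.sum_univ_castSucc, Fin.sum_univ_succ]
    simp only [el, e0, int₁₂_zero_left, int₁₂_zero_right, map_zero, add_zero, zero_add]
  rw [integral_add jXP jQ, integral_add jX jP, integral_add b1 bη, eP, eQ, eη, eF, eF₁, eV]
  simp only [F₀, sub_apply, Finset.sum_sub_distrib]
  ring

namespace IsTrajectory

variable (h : d.IsTrajectory π) (hd : d.Regular) (hπ : d.IsState π)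

include h hd hπ

theorem x_eq_int₁₂ {z : ℝ × ℝ} (hz : z ∈ d.c.G) : π.x z =
    d.x₁ z.1 + d.x₂ z.2 - d.x₁ 0 + int₁₂ (d.c.G.indicator (along d.f π)) z := by
  rw [h.x_eq z hz]
  congr 1
  exact setIntegral_congr_fun (measurableSet_W z) fun w hw =>
    (indicator_of_mem (d.c.isStaircase_G.lower z hz hw) _).symm

theorem p_eq_int₂ {z : ℝ × ℝ} (hz : z ∈ d.c.G) : π.p z =
    derivWithin d.x₁ (Icc 0 d.c.a) z.1 + int₂ (d.c.G.indicator (along d.f π)) z := by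
  rw [h.p_eq z hz, intervalIntegral.integral_of_le (d.c.isStaircase_G.nonneg z hz).2,
    ← integral_Icc_eq_integral_Ioc]
  congr 1
  exact setIntegral_congr_fun measurableSet_Icc fun τ hτ =>
    (indicator_of_mem (d.c.isStaircase_G.vert_mem hz hτ) _).symm

theorem q_eq_int₁ {z : ℝ × ℝ} (hz : z ∈ d.c.G) : π.q z =
    derivWithin d.x₂ (Icc 0 d.c.b) z.2 + int₁ (d.c.G.indicator (along d.f π)) z := by
  rw [h.q_eq z hz, intervalIntegral.integral_of_le (d.c.isStaircase_G.nonneg z hz).1,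
    ← integral_Icc_eq_integral_Ioc]
  congr 1
  exact setIntegral_congr_fun measurableSet_Icc fun σ hσ =>
    (indicator_of_mem (d.c.isStaircase_G.horiz_mem hz hσ) _).symm

end IsTrajectory

/-- `ρ` arises from `π` by switching the control to `v` on the rectangle `S × T` of side `ε`, with
`k` the variation of the mixed derivative of the state; the variations have size `O(ε)`
uniformly and `O(ε²)` in the mean. -/
structure IsNeedle (d : Data n m N) (π ρ : ControlledState n m) (S T : Set ℝ) (v : Vec m)
    (k : ℝ × ℝ → Vec n) (C ε : ℝ) : Prop where
  eps_pos : 0 < ε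
  measurable_S : MeasurableSet S
  measurable_T : MeasurableSet T
  volume_S : volume S ≤ ENNReal.ofReal ε
  volume_T : volume T ≤ ENNReal.ofReal ε
  subset : S ×ˢ T ⊆ d.c.G
  state : d.IsState ρ
  mem_U : v ∈ d.U
  u_in : ∀ z ∈ S ×ˢ T, ρ.u z = v
  u_out : ∀ z ∈ d.c.G, z ∉ S ×ˢ T → ρ.u z = π.u z
  density : IsDensity d.c.G k
  k_eq : ∀ z ∈ d.c.G, k z = along d.f ρ z - along d.f π z
  x_eq : ∀ z ∈ d.c.G, ρ.x z = π.x z + int₁₂ k z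
  p_eq : ∀ z ∈ d.c.G, ρ.p z = π.p z + int₂ k z
  q_eq : ∀ z ∈ d.c.G, ρ.q z = π.q z + int₁ k z
  small : ∀ z ∈ d.c.G, ‖int₁₂ k z‖ ≤ C * ε ∧ ‖int₂ k z‖ ≤ C * ε ∧ ‖int₁ k z‖ ≤ C * ε
  mean : ∫ z, ‖k z‖ ≤ C * ε ^ 2

/-- Off the square only the state changes, and the Lipschitz condition bounds k by the three
integrals of k. On the square the jump of f in the control adds a bounded source. This is the
inequality of the needle estimate, whose constant does not depend on the position of the square. -/
theorem exists_isNeedle (hd : d.Regular) (hπ : d.IsState π) (h : d.IsTrajectory π) {v : Vec m}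
    (hv : v ∈ d.U) : ∃ C, 0 ≤ C ∧ ∀ ε, 0 < ε → ε ≤ 1 → ∀ S T : Set ℝ, MeasurableSet S →
      MeasurableSet T → volume S ≤ ENNReal.ofReal ε → volume T ≤ ENNReal.ofReal ε →
      S ×ˢ T ⊆ d.c.G → ∀ ρ : ControlledState n m, d.IsState ρ → d.IsTrajectory ρ →
      (∀ z ∈ S ×ˢ T, ρ.u z = v) → (∀ z ∈ d.c.G, z ∉ S ×ˢ T → ρ.u z = π.u z) →
      ∃ k, d.IsNeedle π ρ S T v k C ε := by
  have hG := d.c.isStaircase_G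
  obtain ⟨K, hK⟩ := hd.f_lipschitz
  obtain ⟨M, hM0, hM⟩ := (hd.f_C1.along_density hπ).bdd
  obtain ⟨M', hM0', hM'⟩ := (hd.f_C1.along_density (hπ.const_control hv)).bdd
  -- The Lipschitz constant comes without a sign, hence the maximum with 0. The source bound M' + M
  -- dominates f at the old state with the new control and with the old one.
  obtain ⟨C, hC0, hC⟩ := exists_needle_estimate (V := Vec n) d.c.a_pos.le d.c.b_pos.le hG
    (K := max K 0) (C := M' + M) (le_max_right _ _) (by positivity)
  refine ⟨C, hC0, fun ε hε hε1 S T hS hT hSε hTε hQ ρ hρ hρt hin hout => ?_⟩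
  have dρ := hd.f_C1.along_density hρ
  have dπ := hd.f_C1.along_density hπ
  set k : ℝ × ℝ → Vec n := fun z =>
    d.c.G.indicator (along d.f ρ) z - d.c.G.indicator (along d.f π) z with hkdef
  have hk : IsDensity d.c.G k := dρ.sub dπ
  have hx : ∀ z ∈ d.c.G, ρ.x z = π.x z + int₁₂ k z := fun z hz => by
    rw [hρt.x_eq_int₁₂ hd hρ hz, h.x_eq_int₁₂ hd hπ hz, int₁₂_sub hG dρ dπ]; abel
  have hp : ∀ z ∈ d.c.G, ρ.p z = π.p z + int₂ k z := fun z hz => by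
    rw [hρt.p_eq_int₂ hd hρ hz, h.p_eq_int₂ hd hπ hz, int₂_sub hG dρ dπ]; abel
  have hq : ∀ z ∈ d.c.G, ρ.q z = π.q z + int₁ k z := fun z hz => by
    rw [hρt.q_eq_int₁ hd hρ hz, h.q_eq_int₁ hd hπ hz, int₁_sub hG dρ dπ]; abel
  have hkz : ∀ z ∈ d.c.G, k z = along d.f ρ z - along d.f π z := fun z hz => by
    simp only [hkdef, indicator_of_mem hz]
  have hlip : ∀ z ∈ d.c.G, ∀ u ∈ d.U, ‖d.f z (ρ.x z) (ρ.p z) (ρ.q z) u -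
      d.f z (π.x z) (π.p z) (π.q z) u‖ ≤
      max K 0 * (‖int₁₂ k z‖ + ‖int₂ k z‖ + ‖int₁ k z‖) := fun z hz u hu => by
    have := hK z hz u hu (ρ.x z) (ρ.p z) (ρ.q z) (π.x z) (π.p z) (π.q z)
    rw [hx z hz, hp z hz, hq z hz, add_sub_cancel_left, add_sub_cancel_left,
      add_sub_cancel_left, ← hx z hz, ← hp z hz, ← hq z hz] at this
    exact this.trans (by gcongr; exact le_max_left _ _)
  have hle : ∀ z ∈ d.c.G, ‖k z‖ ≤ max K 0 * (‖int₁₂ k z‖ + ‖int₂ k z‖ + ‖int₁ k z‖) +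
      (S ×ˢ T).indicator (fun _ => M' + M) z := by
    intro z hz
    rw [hkz z hz, along, along]
    by_cases hzQ : z ∈ S ×ˢ T
    · rw [indicator_of_mem hzQ, hin z hzQ]
      have h1 := hM z
      have h2 := hM' z
      rw [indicator_of_mem hz, along] at h1 h2
      have h3 := norm_sub_le_norm_sub_add_norm_sub (d.f z (ρ.x z) (ρ.p z) (ρ.q z) v)
        (d.f z (π.x z) (π.p z) (π.q z) v) (d.f z (π.x z) (π.p z) (π.q z) (π.u z))
      exact h3.trans (add_le_add (hlip z hz v hv) ((norm_sub_le _ _).trans (add_le_add h2 h1)))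
    · rw [indicator_of_notMem hzQ, hout z hz hzQ, add_zero]
      exact hlip z hz _ (hπ.mem_U z hz)
  obtain ⟨h1, h2⟩ := hC ε hε.le hε1 S T hS hT hSε hTε k hk hle
  exact ⟨k, hε, hS, hT, hSε, hTε, hQ, hρ, hv, hin, hout, hk, hkz, hx, hp, hq, h1, h2⟩

end Data

end
end GoursatControl

namespace GoursatControl
noncomputable section
open Filter Topology

/-! ### Expansion of the cost under a needle variation -/

theorem eventually_mul_le (C : ℝ) {δ : ℝ} (hδ : 0 < δ) : ∀ᶠ ε in 𝓝[>] (0 : ℝ), C * ε ≤ δ := by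
  have h : Tendsto (fun ε : ℝ => C * ε) (𝓝[>] 0) (𝓝 (C * 0)) :=
    (tendsto_id.const_mul C).mono_left nhdsWithin_le_nhds
  rw [mul_zero] at h
  exact (h.eventually (gt_mem_nhds hδ)).mono fun _ h => h.le

theorem IsDensity.clm_apply {V F : Type*} [NormedAddCommGroup V] [NormedSpace ℝ V]
    [NormedAddCommGroup F] [NormedSpace ℝ F] {G : Set (ℝ × ℝ)} {A : ℝ × ℝ → V →L[ℝ] F}
    (hA : IsDensity G A) {φ : ℝ × ℝ → V} (hφ : StronglyMeasurable φ) {C : ℝ}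
    (hC : ∀ z ∈ G, ‖φ z‖ ≤ C) : IsDensity G (fun z => A z (φ z)) := by
  obtain ⟨M, h0, hM⟩ := hA.bdd
  refine ⟨stronglyMeasurable_clm_apply hA.sm hφ, fun z hz => by rw [hA.zero z hz]; rfl,
    max (M * C) 0, le_max_right _ _, fun z => ?_⟩
  by_cases hz : z ∈ G
  · exact ((A z).le_opNorm _).trans ((mul_le_mul (hM z) (hC z hz) (norm_nonneg _) h0).trans
      (le_max_left _ _))
  · rw [hA.zero z hz, _root_.zero_apply, norm_zero]; exact le_max_right _ _

namespace Data

variable {n m N : ℕ} {d : Data n m N} {π ρ : ControlledState n m}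
  {R Rs Rt : ℝ × ℝ → ℝ × ℝ → Mat n} {v : Vec m} {C : ℝ}

section area

variable {F : Type*} [NormedAddCommGroup F] [NormedSpace ℝ F]
  {g : ℝ × ℝ → Vec n → Vec n → Vec n → Vec m → F}

/-- The differential of `g` along `π` in the direction of the variation with density `k`. -/
def linPart (g : ℝ × ℝ → Vec n → Vec n → Vec n → Vec m → F) (π : ControlledState n m)
    (k : ℝ × ℝ → Vec n) (z : ℝ × ℝ) : F :=
  along (dx g) π z (int₁₂ k z) + along (dp g) π z (int₂ k z) + along (dq g) π z (int₁ k z)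

/-- The change of `g` along `π` when only the control is switched to `v`. -/
def jump (g : ℝ × ℝ → Vec n → Vec n → Vec n → Vec m → F) (π : ControlledState n m) (v : Vec m)
    (z : ℝ × ℝ) : F := along g { π with u := fun _ => v } z - along g π z

/-- The remainder of the first order expansion of `g`. -/
def remainder (g : ℝ × ℝ → Vec n → Vec n → Vec n → Vec m → F) (π ρ : ControlledState n m)
    (Q : Set (ℝ × ℝ)) (v : Vec m) (k : ℝ × ℝ → Vec n) (z : ℝ × ℝ) : F :=
  along g ρ z - along g π z - linPart g π k z - Q.indicator (jump g π v) z

theorem IsC1.integrableOn_along (hg : d.IsC1 g) (hπ : d.IsState π) :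
    IntegrableOn (along g π) d.c.G :=
  IsDensity.integrableOn_of_indicator d.c.isStaircase_G (hg.along_density hπ)

theorem IsC1.integrableOn_jump (hg : d.IsC1 g) (hπ : d.IsState π) (hv : v ∈ d.U) :
    IntegrableOn (jump g π v) d.c.G :=
  (hg.integrableOn_along (hπ.const_control hv)).sub (hg.integrableOn_along hπ)

theorem IsC1.integrableOn_linPart (hg : d.IsC1 g) (hπ : d.IsState π) {k : ℝ × ℝ → Vec n}
    (hk : IsDensity d.c.G k) : IntegrableOn (linPart g π k) d.c.G := by
  have hG := d.c.isStaircase_G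
  obtain ⟨C, _, hC⟩ := hk.bdd_ops hG
  refine (Integrable.add ?_ ?_).add ?_
  · exact integrableOn_clm_apply_density
      (IsDensity.integrableOn_of_indicator hG (hg.dx_density hπ)) hk.sm_int₁₂.aestronglyMeasurable
      (IsDensity.bdd_ae hG fun z hz => (hC z hz).1)
  · exact integrableOn_clm_apply_density
      (IsDensity.integrableOn_of_indicator hG (hg.dp_density hπ)) hk.sm_int₂.aestronglyMeasurable
      (IsDensity.bdd_ae hG fun z hz => (hC z hz).2.1)
  · exact integrableOn_clm_apply_density
      (IsDensity.integrableOn_of_indicator hG (hg.dq_density hπ)) hk.sm_int₁.aestronglyMeasurable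
      (IsDensity.bdd_ae hG fun z hz => (hC z hz).2.2)

theorem IsC1.integrableOn_remainder (hg : d.IsC1 g) (hπ : d.IsState π) (hρ : d.IsState ρ)
    (hv : v ∈ d.U) {k : ℝ × ℝ → Vec n} (hk : IsDensity d.c.G k) {Q : Set (ℝ × ℝ)}
    (hQ : MeasurableSet Q) : IntegrableOn (remainder g π ρ Q v k) d.c.G :=
  (((hg.integrableOn_along hρ).sub (hg.integrableOn_along hπ)).sub
    (hg.integrableOn_linPart hπ hk)).sub ((hg.integrableOn_jump hπ hv).indicator hQ)

/-- The variations are uniformly O(ε), so Taylor's formula bounds the remainder by a small multiple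
of their sum, whose integral is O(ε²). On the square the additional error is O(ε) on an area at most
ε², hence O(ε³). -/
theorem IsC1.eventually_integral_remainder_le (hg : d.IsC1 g) (hπ : d.IsState π) (hC : 0 ≤ C)
    {η : ℝ} (hη : 0 < η) : ∀ᶠ ε in 𝓝[>] (0 : ℝ), ∀ ρ S T k, d.IsNeedle π ρ S T v k C ε →
      ∫ z in d.c.G, ‖remainder g π ρ (S ×ˢ T) v k z‖ ≤ η * ε ^ 2 := by
  have hG := d.c.isStaircase_G
  obtain ⟨Cy, hCy⟩ := hπ.bounded'
  obtain ⟨M, hM0, hM⟩ := hg.exists_remainder_bound Cy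
  have ha := d.c.a_pos
  have hb := d.c.b_pos
  set B := d.c.a * d.c.b + d.c.b + d.c.a with hB
  have hB0 : 0 < B := by positivity
  -- Half of η is reserved for the square. B bounds the norms of the three integral operators in the
  -- mean, ∫‖k‖ ≤ Cε², and the added 1 avoids division by zero.
  obtain ⟨δ, hδ, hrem⟩ := hM (η / (2 * (B * C + 1))) (by positivity)
  filter_upwards [eventually_mul_le C hδ, eventually_mul_le (M * C) (half_pos hη)]
    with ε hε1 hε2 ρ S T k h
  have hε := h.eps_pos
  set η' := η / (2 * (B * C + 1)) with hη'
  have hη'0 : 0 < η' := by positivity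
  have hQm : MeasurableSet (S ×ˢ T) := h.measurable_S.prod h.measurable_T
  have hQv : volume.real (S ×ˢ T) ≤ ε ^ 2 := by
    rw [Measure.volume_eq_prod, measureReal_prod_prod, pow_two]
    exact mul_le_mul (ENNReal.toReal_le_of_le_ofReal hε.le h.volume_S)
      (ENNReal.toReal_le_of_le_ofReal hε.le h.volume_T) ENNReal.toReal_nonneg hε.le
  have hQfin : volume (S ×ˢ T) ≠ ⊤ := ((measure_mono h.subset).trans_lt hG.volume_lt_top).ne
  obtain ⟨i1, i2, i3⟩ := h.density.integrableOn_ops hG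
  have isum : IntegrableOn (fun z => η' * (‖int₁₂ k z‖ + ‖int₂ k z‖ + ‖int₁ k z‖)) d.c.G :=
    ((i1.norm.add i2.norm).add i3.norm).const_mul η'
  have iind : Integrable ((S ×ˢ T).indicator fun _ => M * (C * ε)) :=
    (integrable_indicator_iff hQm).2 (integrableOn_const hQfin)
  have hpt : ∀ z ∈ d.c.G, ‖remainder g π ρ (S ×ˢ T) v k z‖ ≤
      η' * (‖int₁₂ k z‖ + ‖int₂ k z‖ + ‖int₁ k z‖) + (S ×ˢ T).indicator (fun _ => M * (C * ε)) z := by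
    intro z hz
    obtain ⟨s1, s2, s3⟩ := h.small z hz
    set y : Vec n × Vec n × Vec n := (π.x z, π.p z, π.q z) with hy
    set δz : Vec n × Vec n × Vec n := (int₁₂ k z, int₂ k z, int₁ k z) with hδz
    have hδn : ‖δz‖ ≤ C * ε := norm_prod_le_iff.2 ⟨s1, norm_prod_le_iff.2 ⟨s2, s3⟩⟩
    have hδs : ‖δz‖ ≤ ‖int₁₂ k z‖ + ‖int₂ k z‖ + ‖int₁ k z‖ := by
      have n1 := norm_nonneg (int₁₂ k z)
      have n2 := norm_nonneg (int₂ k z)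
      have n3 := norm_nonneg (int₁ k z)
      exact norm_prod_le_iff.2 ⟨by simp only [hδz]; linarith,
        norm_prod_le_iff.2 ⟨by simp only [hδz]; linarith, by simp only [hδz]; linarith⟩⟩
    obtain ⟨r1, r2⟩ := hrem z hz (π.u z) (hπ.mem_U z hz) v h.mem_U y δz (hCy z hz)
      (hδn.trans hε1)
    have hD : D g (z, y, π.u z) δz = linPart g π k z := hg.D_apply hπ hz _ _ _
    have hax : ρ.x z = (y + δz).1 := h.x_eq z hz
    have hap : ρ.p z = (y + δz).2.1 := h.p_eq z hz
    have haq : ρ.q z = (y + δz).2.2 := h.q_eq z hz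
    rw [hD] at r1 r2
    by_cases hzQ : z ∈ S ×ˢ T
    · have e : remainder g π ρ (S ×ˢ T) v k z = g z (y + δz).1 (y + δz).2.1 (y + δz).2.2 v -
          g z y.1 y.2.1 y.2.2 v - linPart g π k z := by
        rw [remainder, indicator_of_mem hzQ, jump, along, along, along, hax, hap, haq,
          h.u_in z hzQ]
        simp only [hy]
        abel
      rw [e, indicator_of_mem hzQ]
      refine r2.trans ?_
      rw [add_mul]
      gcongr
    · have e : remainder g π ρ (S ×ˢ T) v k z =
          g z (y + δz).1 (y + δz).2.1 (y + δz).2.2 (π.u z) - g z y.1 y.2.1 y.2.2 (π.u z) -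
          linPart g π k z := by
        rw [remainder, indicator_of_notMem hzQ, along, along, hax, hap, haq, h.u_out z hz hzQ,
          sub_zero]
      rw [e, indicator_of_notMem hzQ, add_zero]
      exact r1.trans (by gcongr)
  have h1 := setIntegral_mono_on
    (hg.integrableOn_remainder hπ h.state h.mem_U h.density hQm).norm
    (isum.add iind.integrableOn) hG.measurableSet hpt
  have h2 : ∫ z in d.c.G, (η' * (‖int₁₂ k z‖ + ‖int₂ k z‖ + ‖int₁ k z‖) +
      (S ×ˢ T).indicator (fun _ => M * (C * ε)) z) =
      η' * ((∫ z in d.c.G, ‖int₁₂ k z‖) + (∫ z in d.c.G, ‖int₂ k z‖) +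
        ∫ z in d.c.G, ‖int₁ k z‖) + volume.real (S ×ˢ T) * (M * (C * ε)) := by
    have i12 : IntegrableOn (fun z => ‖int₁₂ k z‖ + ‖int₂ k z‖) d.c.G := i1.norm.add i2.norm
    rw [integral_add isum iind.integrableOn, integral_const_mul, integral_add i12 i3.norm,
      integral_add i1.norm i2.norm, setIntegral_indicator hQm,
      inter_eq_self_of_subset_right h.subset, setIntegral_const, smul_eq_mul]
  have h3 := h.density.integral_norm_int₁₂_le hG ha.le hb.le
  have h4 := h.density.integral_norm_int₂_le hG ha.le hb.le
  have h5 := h.density.integral_norm_int₁_le hG ha.le hb.le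
  have hk0 : 0 ≤ ∫ z, ‖k z‖ := integral_nonneg fun _ => norm_nonneg _
  have h6 : (∫ z in d.c.G, ‖int₁₂ k z‖) + (∫ z in d.c.G, ‖int₂ k z‖) +
      (∫ z in d.c.G, ‖int₁ k z‖) ≤ B * (C * ε ^ 2) := by
    calc _ ≤ B * ∫ z, ‖k z‖ := by rw [hB]; linarith
      _ ≤ _ := by gcongr; exact h.mean
  have h7 : η' * (B * (C * ε ^ 2)) ≤ η / 2 * ε ^ 2 := by
    have : η' * (B * C) ≤ η / 2 := by
      rw [hη', div_mul_eq_mul_div, div_le_iff₀ (by positivity)]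
      nlinarith [mul_nonneg hB0.le hC]
    calc η' * (B * (C * ε ^ 2)) = η' * (B * C) * ε ^ 2 := by ring
      _ ≤ _ := by gcongr
  have h8 : volume.real (S ×ˢ T) * (M * (C * ε)) ≤ η / 2 * ε ^ 2 := by
    calc volume.real (S ×ˢ T) * (M * (C * ε)) ≤ ε ^ 2 * (M * (C * ε)) := by gcongr
      _ = M * C * ε * ε ^ 2 := by ring
      _ ≤ _ := by gcongr
  have h9 : η' * ((∫ z in d.c.G, ‖int₁₂ k z‖) + (∫ z in d.c.G, ‖int₂ k z‖) +
      ∫ z in d.c.G, ‖int₁ k z‖) ≤ η' * (B * (C * ε ^ 2)) := by gcongr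
  have h1' := h1.trans_eq h2
  linarith

end area

/-- The remainder of the first order expansion of the curve cost. -/
def curveRemainder (d : Data n m N) (π ρ : ControlledState n m) (k : ℝ × ℝ → Vec n) (μ : ℝ) : ℝ :=
  d.Φ₁ (d.c.pt μ) (ρ.x (d.c.pt μ)) (d.c.tangential ρ.p ρ.q μ) -
    d.Φ₁ (d.c.pt μ) (π.x (d.c.pt μ)) (d.c.tangential π.p π.q μ) -
    (d.Φ₁x π μ (int₁₂ k (d.c.pt μ)) + d.Φ₁η π μ (d.c.traceDeriv k μ))

theorem integrableOn_Φ₁ (hd : d.Regular) (hπ : d.IsState π) : IntegrableOn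
    (fun μ => d.Φ₁ (d.c.pt μ) (π.x (d.c.pt μ)) (d.c.tangential π.p π.q μ)) d.c.smooth :=
  integrableOn_curve hπ hd.Φ₁_continuousOn

/-- Along the curve the state varies by O(ε²) uniformly. Its tangential derivative varies by O(ε)
uniformly, so that Taylor's formula applies, and by O(ε²) in the mean. -/
theorem eventually_integral_curveRemainder_le (hd : d.Regular) (hπ : d.IsState π)
    (hreg : d.CostateRegular π) (hC : 0 ≤ C) {η : ℝ} (hη : 0 < η) :
    ∀ᶠ ε in 𝓝[>] (0 : ℝ), ∀ ρ S T k, d.IsNeedle π ρ S T v k C ε →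
      ∫ μ in d.c.smooth, ‖d.curveRemainder π ρ k μ‖ ≤ η * ε ^ 2 := by
  have hG := d.c.isStaircase_G
  obtain ⟨Cy, hCy⟩ := curveArg_bounded hπ
  have hℓ := d.c.ℓ_pos
  obtain ⟨δ, hδ, hrem⟩ := exists_uniform_taylor (isCompact_range d.c)
    (φ := fun p (y : Vec n × Vec n) => d.Φ₁ p y.1 y.2) (fun p hp => hd.Φ₁_differentiable p hp)
    hd.Φ₁_continuousOn_fderiv Cy (η := η / ((d.c.ℓ + 2) * C + 1)) (by positivity)
  filter_upwards [eventually_mul_le (2 * C) hδ] with ε hε1 ρ S T k h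
  have hε := h.eps_pos
  set η' := η / ((d.c.ℓ + 2) * C + 1) with hη'
  have hη'0 : 0 < η' := by positivity
  have hs := d.c.measurableSet_smooth
  have hCε : 0 ≤ C * ε := by positivity
  have itr := d.c.integrableOn_traceDeriv h.density
  have hX : ∀ μ ∈ d.c.smooth, ‖int₁₂ k (d.c.pt μ)‖ ≤ C * ε ^ 2 := fun μ hμ =>
    (norm_int₁₂_le hG h.density _).trans h.mean
  have isum : IntegrableOn (fun μ => η' * (C * ε ^ 2 + ‖d.c.traceDeriv k μ‖)) d.c.smooth :=
    ((integrable_const _).add itr.norm).const_mul η'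
  have hpt : ∀ μ ∈ d.c.smooth, ‖d.curveRemainder π ρ k μ‖ ≤
      η' * (C * ε ^ 2 + ‖d.c.traceDeriv k μ‖) := by
    intro μ hμ
    have hz := d.c.pt_mem_G hμ.1
    obtain ⟨s1, s2, s3⟩ := h.small _ hz
    have habs := d.c.abs_deriv_le hμ
    have htr : ‖d.c.traceDeriv k μ‖ ≤ 2 * C * ε := by
      rw [Curve.traceDeriv]
      refine (norm_add_le _ _).trans ?_
      rw [norm_smul, norm_smul]
      have t1 := mul_le_mul habs.1 s2 (norm_nonneg _) zero_le_one
      have t2 := mul_le_mul habs.2 s3 (norm_nonneg _) zero_le_one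
      rw [Real.norm_eq_abs, Real.norm_eq_abs]
      linarith
    set y := (d.curveArg π μ).2 with hy
    set δz : Vec n × Vec n := (int₁₂ k (d.c.pt μ), d.c.traceDeriv k μ) with hδz
    have hδn : ‖δz‖ ≤ 2 * C * ε := norm_prod_le_iff.2 ⟨s1.trans (by linarith), htr⟩
    have hδs : ‖δz‖ ≤ C * ε ^ 2 + ‖d.c.traceDeriv k μ‖ :=
      norm_prod_le_iff.2 ⟨(hX μ hμ).trans (le_add_of_nonneg_right (norm_nonneg _)),
        le_add_of_nonneg_left (by positivity)⟩
    have r := hrem (d.c.pt μ) (mem_image_of_mem _ hμ.1) y (hCy μ hμ) δz (hδn.trans hε1)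
    have hD : fderiv ℝ (fun y : Vec n × Vec n => d.Φ₁ (d.c.pt μ) y.1 y.2) y δz =
        d.Φ₁x π μ (int₁₂ k (d.c.pt μ)) + d.Φ₁η π μ (d.c.traceDeriv k μ) := D₁_apply hd hμ _ _
    have ht : d.c.tangential ρ.p ρ.q μ = d.c.tangential π.p π.q μ + d.c.traceDeriv k μ := by
      rw [Curve.tangential, Curve.tangential, Curve.traceDeriv, Curve.n₁, Curve.n₂, neg_neg,
        h.p_eq _ hz, h.q_eq _ hz, smul_add, smul_add]
      abel
    have hax : ρ.x (d.c.pt μ) = (y + δz).1 := h.x_eq _ hz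
    have haη : d.c.tangential ρ.p ρ.q μ = (y + δz).2 := ht
    rw [hD] at r
    rw [curveRemainder, hax, haη]
    exact r.trans (by gcongr)
  have hint : IntegrableOn (d.curveRemainder π ρ k) d.c.smooth :=
    ((integrableOn_Φ₁ hd h.state).sub (integrableOn_Φ₁ hd hπ)).sub
      (linearized_cost hd hπ hreg h.density).2.1
  have h1 := setIntegral_mono_on hint.norm isum hs hpt
  have hvol : volume.real d.c.smooth = d.c.ℓ := by
    rw [measureReal_congr d.c.smooth_ae_eq, Real.volume_real_Icc_of_le hℓ.le, sub_zero]
  have ic : IntegrableOn (fun _ : ℝ => C * ε ^ 2) d.c.smooth := integrable_const _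
  rw [integral_const_mul, integral_add ic itr.norm, setIntegral_const, hvol, smul_eq_mul] at h1
  have h2 := d.c.integral_norm_traceDeriv_le h.density
  have h3 := h.mean
  have h4 : η' * ((d.c.ℓ + 2) * C) ≤ η := by
    rw [hη', div_mul_eq_mul_div, div_le_iff₀ (by positivity)]
    linarith
  calc _ ≤ _ := h1
    _ ≤ η' * (d.c.ℓ * (C * ε ^ 2) + 2 * (C * ε ^ 2)) := by gcongr; linarith
    _ = η' * ((d.c.ℓ + 2) * C) * ε ^ 2 := by ring
    _ ≤ _ := by gcongr

/-- At a vertex the state varies by at most ∫‖k‖ = O(ε²), so differentiability of `Φ₀` at this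
single point is enough. -/
theorem eventually_vertexRemainder_le (hd : d.Regular) (hC : 0 ≤ C) (r : Fin (N + 2))
    {η : ℝ} (hη : 0 < η) : ∀ᶠ ε in 𝓝[>] (0 : ℝ), ∀ ρ S T k, d.IsNeedle π ρ S T v k C ε →
      ‖d.Φ₀ (d.c.P r) (ρ.x (d.c.P r)) - d.Φ₀ (d.c.P r) (π.x (d.c.P r)) -
        fderiv ℝ (d.Φ₀ (d.c.P r)) (π.x (d.c.P r)) (int₁₂ k (d.c.P r))‖ ≤ η * ε ^ 2 := by
  have hdiff : HasFDerivAt (d.Φ₀ (d.c.P r)) _ (π.x (d.c.P r)) :=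
    ((hd.Φ₀_C1 r).differentiable one_ne_zero _).hasFDerivAt
  have hη' : 0 < η / (C + 1) := by positivity
  obtain ⟨δ, hδ, h0⟩ := Metric.eventually_nhds_iff.1 (hdiff.isLittleO.def hη')
  filter_upwards [eventually_mul_le C (half_pos hδ)] with ε hε ρ S T k h
  have hz := d.c.P_mem_G r
  have hx := h.x_eq _ hz
  have hs := (h.small _ hz).1
  have := @h0 (ρ.x (d.c.P r)) (by
    rw [dist_eq_norm, hx, add_sub_cancel_left]; linarith)
  rw [hx, add_sub_cancel_left] at this
  rw [hx]
  refine this.trans ?_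
  have h2 := (norm_int₁₂_le d.c.isStaircase_G h.density (d.c.P r)).trans h.mean
  calc η / (C + 1) * ‖int₁₂ k (d.c.P r)‖ ≤ η / (C + 1) * ((C + 1) * ε ^ 2) := by
        gcongr
        nlinarith [sq_nonneg ε]
    _ = _ := by field_simp

/-- First order expansion of the cost under needle variations. -/
theorem eventually_cost_expansion (hd : d.Regular) (hπ : d.IsState π)
    (hreg : d.CostateRegular π) (hR : d.IsRiemann π R Rs Rt) (hC : 0 ≤ C) {η : ℝ} (hη : 0 < η) :
    ∀ᶠ ε in 𝓝[>] (0 : ℝ), ∀ ρ S T k, d.IsNeedle π ρ S T v k C ε →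
      IntegrableOn (fun z => jump d.Φ π v z + d.costate π R z (jump d.f π v z)) (S ×ˢ T) ∧
      d.J ρ - d.J π ≤ (∫ z in S ×ˢ T, (jump d.Φ π v z + d.costate π R z (jump d.f π v z))) +
        η * ε ^ 2 := by
  have hG := d.c.isStaircase_G
  obtain ⟨Cψ, hψ0, hψ⟩ := exists_costate_bound hd hπ hreg hR
  -- The error budget: Cψ for the remainder of f, which is multiplied by the co-state, one share
  -- each for Φ and for the curve, and N + 2 for the vertices.
  set η' := η / (Cψ + N + 4) with hη'
  have hη'0 : 0 < η' := by positivity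
  filter_upwards [hd.Φ_C1.eventually_integral_remainder_le (v := v) hπ hC hη'0,
    hd.f_C1.eventually_integral_remainder_le (v := v) hπ hC hη'0,
    eventually_integral_curveRemainder_le (v := v) hd hπ hreg hC hη'0,
    eventually_all.2 fun r => eventually_vertexRemainder_le (π := π) (v := v) hd hC r hη'0]
    with ε e1 e2 e3 e4 ρ S T k h
  have hρ := h.state
  have hk := h.density
  have hQm : MeasurableSet (S ×ˢ T) := h.measurable_S.prod h.measurable_T
  set Q := S ×ˢ T with hQ
  obtain ⟨Ck, _, hCk⟩ := hk.bdd_ops hG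
  -- The source is defined as what k leaves over from its linearization, so k solves the linear
  -- Goursat problem exactly and no linearized state has to be compared with the true one.
  set src : ℝ × ℝ → Vec n := fun z => k z - (d.c.G.indicator (along (dx d.f) π) z (int₁₂ k z) +
    d.c.G.indicator (along (dp d.f) π) z (int₂ k z) +
    d.c.G.indicator (along (dq d.f) π) z (int₁ k z)) with hsrc
  have hsrcd : IsDensity d.c.G src := hk.sub
    ((((hd.f_C1.dx_density hπ).clm_apply hk.sm_int₁₂ fun z hz => (hCk z hz).1).add
      ((hd.f_C1.dp_density hπ).clm_apply hk.sm_int₂ fun z hz => (hCk z hz).2.1)).add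
      ((hd.f_C1.dq_density hπ).clm_apply hk.sm_int₁ fun z hz => (hCk z hz).2.2))
  have hX : ∀ z ∈ d.c.G, int₁₂ k z =
      ∫ w in W (d.c.a, d.c.b), zeroExt d.c.G R (z, w) (src w) := fun z hz =>
    IsRiemann.int₁₂_eq hd.f_C1 hπ hR hsrcd hk (fun z hz => by
      simp only [hsrc, indicator_of_mem hz]; abel) hz
  obtain ⟨iψ, edual⟩ := integral_costate hd hπ hreg hR hsrcd hX
  obtain ⟨_, il₁, elin⟩ := linearized_cost hd hπ hreg hk
  have il := hd.Φ_C1.integrableOn_linPart hπ hk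
  -- The source is the jump of f on the square plus the Taylor remainder of f. The first gives the ψ
  -- f part of the Hamiltonian, the second is small in the mean and is tested against a bounded
  -- co-state.
  have esrc : ∀ z ∈ d.c.G, src z = remainder d.f π ρ Q v k z + Q.indicator (jump d.f π v) z :=
    fun z hz => by
      simp only [hsrc, indicator_of_mem hz, remainder, linPart, h.k_eq z hz]
      abel
  have iψs : IntegrableOn (fun z => d.costate π R z (src z)) d.c.G := by
    obtain ⟨M, _, hM⟩ := hsrcd.bdd
    exact integrableOn_clm_apply_density iψ hsrcd.sm.aestronglyMeasurable (ae_of_all _ hM)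
  have iψj : IntegrableOn (fun z => d.costate π R z (jump d.f π v z)) d.c.G := by
    have dj := (hd.f_C1.along_density (hπ.const_control h.mem_U)).sub (hd.f_C1.along_density hπ)
    obtain ⟨M, _, hM⟩ := dj.bdd
    have := integrableOn_clm_apply_density iψ dj.sm.aestronglyMeasurable (ae_of_all _ hM)
    refine IntegrableOn.congr_fun this (fun z hz => ?_) hG.measurableSet
    simp only [jump, indicator_of_mem hz]
  have iΦj := hd.Φ_C1.integrableOn_jump hπ h.mem_U
  refine ⟨(iΦj.add iψj).mono_set h.subset, ?_⟩
  have iψjQ : IntegrableOn (Q.indicator fun z => d.costate π R z (jump d.f π v z)) d.c.G :=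
    iψj.indicator hQm
  have eψ : ∫ z in d.c.G, d.costate π R z (src z) =
      (∫ z in d.c.G, d.costate π R z (remainder d.f π ρ Q v k z)) +
      ∫ z in Q, d.costate π R z (jump d.f π v z) := by
    have e : ∀ z ∈ d.c.G, d.costate π R z (remainder d.f π ρ Q v k z) =
        d.costate π R z (src z) - Q.indicator (fun z => d.costate π R z (jump d.f π v z)) z := by
      intro z hz
      rw [esrc z hz, map_add]
      by_cases hzQ : z ∈ Q
      · rw [indicator_of_mem hzQ, indicator_of_mem hzQ]; ring
      · rw [indicator_of_notMem hzQ, indicator_of_notMem hzQ, map_zero]; ring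
    rw [setIntegral_congr_fun hG.measurableSet e, integral_sub iψs iψjQ,
      setIntegral_indicator hQm, inter_eq_self_of_subset_right h.subset]
    ring
  have bψ : ∫ z in d.c.G, d.costate π R z (remainder d.f π ρ Q v k z) ≤ Cψ * (η' * ε ^ 2) := by
    refine (le_abs_self _).trans ?_
    rw [← Real.norm_eq_abs]
    have ir := (hd.f_C1.integrableOn_remainder hπ hρ h.mem_U hk hQm).norm
    have ir : Integrable (fun z => Cψ * ‖remainder d.f π ρ Q v k z‖) (volume.restrict d.c.G) :=
      ir.const_mul Cψ
    refine (norm_integral_le_of_norm_le ir (ae_of_all _ fun z => ?_)).trans ?_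
    · exact (ContinuousLinearMap.le_opNorm (d.costate π R z) _).trans
        (mul_le_mul_of_nonneg_right (hψ z) (norm_nonneg _))
    · rw [integral_const_mul]
      gcongr
      exact e2 ρ S T k h
  have iΦρ := hd.Φ_C1.integrableOn_along hρ
  have iΦπ := hd.Φ_C1.integrableOn_along hπ
  have irΦ := hd.Φ_C1.integrableOn_remainder hπ hρ h.mem_U hk hQm
  have eΦ : (∫ z in d.c.G, along d.Φ ρ z) - ∫ z in d.c.G, along d.Φ π z =
      (∫ z in d.c.G, remainder d.Φ π ρ Q v k z) + (∫ z in d.c.G, linPart d.Φ π k z) +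
      ∫ z in Q, jump d.Φ π v z := by
    have iΦjQ : IntegrableOn (Q.indicator (jump d.Φ π v)) d.c.G := iΦj.indicator hQm
    have irl : IntegrableOn (fun z => remainder d.Φ π ρ Q v k z + linPart d.Φ π k z) d.c.G :=
      irΦ.add il
    have eQ : ∫ z in Q, jump d.Φ π v z = ∫ z in d.c.G, Q.indicator (jump d.Φ π v) z := by
      rw [setIntegral_indicator hQm, inter_eq_self_of_subset_right h.subset]
    rw [eQ, ← integral_sub iΦρ iΦπ, ← integral_add irΦ il, ← integral_add irl iΦjQ]
    refine integral_congr_ae (ae_of_all _ fun z => ?_)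
    simp only [remainder]
    ring
  have bΦ : ∫ z in d.c.G, remainder d.Φ π ρ Q v k z ≤ η' * ε ^ 2 :=
    (le_abs_self _).trans ((norm_integral_le_integral_norm _).trans (e1 ρ S T k h))
  have i₁ρ := integrableOn_Φ₁ hd hρ
  have i₁π := integrableOn_Φ₁ hd hπ
  have e₁ : (∫ μ in (0 : ℝ)..d.c.ℓ,
        d.Φ₁ (d.c.pt μ) (ρ.x (d.c.pt μ)) (d.c.tangential ρ.p ρ.q μ)) -
      (∫ μ in (0 : ℝ)..d.c.ℓ, d.Φ₁ (d.c.pt μ) (π.x (d.c.pt μ)) (d.c.tangential π.p π.q μ)) =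
      (∫ μ in d.c.smooth, d.curveRemainder π ρ k μ) +
      ∫ μ in d.c.smooth, (d.Φ₁x π μ (int₁₂ k (d.c.pt μ)) + d.Φ₁η π μ (d.c.traceDeriv k μ)) := by
    have ir : IntegrableOn (d.curveRemainder π ρ k) d.c.smooth := (i₁ρ.sub i₁π).sub il₁
    rw [← d.c.setIntegral_smooth, ← d.c.setIntegral_smooth, ← integral_sub i₁ρ i₁π,
      ← integral_add ir il₁]
    refine integral_congr_ae (ae_of_all _ fun z => ?_)
    simp only [curveRemainder]
    ring
  have b₁ : ∫ μ in d.c.smooth, d.curveRemainder π ρ k μ ≤ η' * ε ^ 2 :=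
    (le_abs_self _).trans ((norm_integral_le_integral_norm _).trans (e3 ρ S T k h))
  have b₀ : ∑ r, d.Φ₀ (d.c.P r) (ρ.x (d.c.P r)) - ∑ r, d.Φ₀ (d.c.P r) (π.x (d.c.P r)) -
      ∑ r, fderiv ℝ (d.Φ₀ (d.c.P r)) (π.x (d.c.P r)) (int₁₂ k (d.c.P r)) ≤
      (N + 2) * (η' * ε ^ 2) := by
    rw [← Finset.sum_sub_distrib, ← Finset.sum_sub_distrib]
    have : ∀ r ∈ (Finset.univ : Finset (Fin (N + 2))), d.Φ₀ (d.c.P r) (ρ.x (d.c.P r)) -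
        d.Φ₀ (d.c.P r) (π.x (d.c.P r)) -
        fderiv ℝ (d.Φ₀ (d.c.P r)) (π.x (d.c.P r)) (int₁₂ k (d.c.P r)) ≤ η' * ε ^ 2 :=
      fun r _ => (le_abs_self _).trans (e4 r ρ S T k h)
    refine (Finset.sum_le_card_nsmul _ _ _ this).trans (le_of_eq ?_)
    rw [Finset.card_univ, Fintype.card_fin, nsmul_eq_mul]
    push_cast
    ring
  have eη : (Cψ + N + 4) * (η' * ε ^ 2) = η * ε ^ 2 := by rw [hη']; field_simp
  have esplit : ∫ z in Q, (jump d.Φ π v z + d.costate π R z (jump d.f π v z)) =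
      (∫ z in Q, jump d.Φ π v z) + ∫ z in Q, d.costate π R z (jump d.f π v z) :=
    integral_add (iΦj.mono_set h.subset) (iψj.mono_set h.subset)
  rw [J, J, esplit]
  simp only [linPart] at eΦ
  have final : (Cψ + N + 4) * (η' * ε ^ 2) = Cψ * (η' * ε ^ 2) + η' * ε ^ 2 + η' * ε ^ 2 +
    (N + 2) * (η' * ε ^ 2) := by ring
  linarith

end Data

end
end GoursatControl

namespace GoursatControl
noncomputable section
open Filter Topology

/-! ### Trajectories and needle controls -/

namespace Data

variable {n m N : ℕ} {d : Data n m N} {π : ControlledState n m}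
  {R Rs Rt : ℝ × ℝ → ℝ × ℝ → Mat n}

/-- The controlled state with control `u` and mixed derivative `k`. -/
def stateOf (d : Data n m N) (u : ℝ × ℝ → Vec m) (k : ℝ × ℝ → Vec n) : ControlledState n m where
  u := u
  x z := d.x₁ z.1 + d.x₂ z.2 - d.x₁ 0 + int₁₂ k z
  p z := derivWithin d.x₁ (Icc 0 d.c.a) z.1 + int₂ k z
  q z := derivWithin d.x₂ (Icc 0 d.c.b) z.2 + int₁ k z

theorem isState_stateOf (hd : d.Regular) {u : ℝ × ℝ → Vec m}
    (hu : Measurable fun z : d.c.G => u z) (hU : ∀ z ∈ d.c.G, u z ∈ d.U) {k : ℝ × ℝ → Vec n}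
    (hk : IsDensity d.c.G k) : d.IsState (d.stateOf u k) := by
  have hG := d.c.isStaircase_G
  have m1 : MapsTo Prod.fst d.c.G (Icc 0 d.c.a) := fun z hz => (hG.subset hz).1
  have m2 : MapsTo Prod.snd d.c.G (Icc 0 d.c.b) := fun z hz => (hG.subset hz).2
  have cx : ContinuousOn (fun z : ℝ × ℝ => d.x₁ z.1 + d.x₂ z.2 - d.x₁ 0) d.c.G :=
    ((hd.x₁_C1.continuousOn.comp continuousOn_fst m1).add
      (hd.x₂_C1.continuousOn.comp continuousOn_snd m2)).sub continuousOn_const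
  have cp : ContinuousOn (fun z : ℝ × ℝ => derivWithin d.x₁ (Icc 0 d.c.a) z.1) d.c.G :=
    (hd.x₁_C1.continuousOn_derivWithin (uniqueDiffOn_Icc d.c.a_pos) le_rfl).comp
      continuousOn_fst m1
  have cq : ContinuousOn (fun z : ℝ × ℝ => derivWithin d.x₂ (Icc 0 d.c.b) z.2) d.c.G :=
    (hd.x₂_C1.continuousOn_derivWithin (uniqueDiffOn_Icc d.c.b_pos) le_rfl).comp
      continuousOn_snd m2
  obtain ⟨Cx, hx⟩ := d.c.isCompact_G.exists_bound_of_continuousOn cx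
  obtain ⟨Cp, hp⟩ := d.c.isCompact_G.exists_bound_of_continuousOn cp
  obtain ⟨Cq, hq⟩ := d.c.isCompact_G.exists_bound_of_continuousOn cq
  obtain ⟨C, h0, hC⟩ := hk.bdd_ops hG
  refine ⟨hu, ?_, ?_, ?_, hU, max Cx (max Cp Cq) + C, fun z hz => ⟨?_, ?_, ?_⟩⟩
  · exact cx.domRestrict.measurable.add (hk.sm_int₁₂.measurable.comp measurable_subtype_coe)
  · exact cp.domRestrict.measurable.add (hk.sm_int₂.measurable.comp measurable_subtype_coe)
  · exact cq.domRestrict.measurable.add (hk.sm_int₁.measurable.comp measurable_subtype_coe)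
  · exact (norm_add_le _ _).trans (add_le_add ((hx z hz).trans (le_max_left _ _)) (hC z hz).1)
  · exact (norm_add_le _ _).trans (add_le_add
      ((hp z hz).trans ((le_max_left _ _).trans (le_max_right _ _))) (hC z hz).2.1)
  · exact (norm_add_le _ _).trans (add_le_add
      ((hq z hz).trans ((le_max_right _ _).trans (le_max_right _ _))) (hC z hz).2.2)

/-- Every admissible control has a state trajectory. -/
theorem exists_isTrajectory (hd : d.Regular) {u : ℝ × ℝ → Vec m}
    (hu : Measurable fun z : d.c.G => u z) (hU : ∀ z ∈ d.c.G, u z ∈ d.U) :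
    ∃ ρ : ControlledState n m, ρ.u = u ∧ d.IsTrajectory ρ := by
  have hG := d.c.isStaircase_G
  obtain ⟨K, hK⟩ := hd.f_lipschitz
  set K' := max K 0 with hK'
  have hK0 : 0 ≤ K' := le_max_right _ _
  set c := max 1 (6 * K') with hc
  have hc1 : 1 ≤ c := le_max_left _ _
  have hc0 : 0 < c := by linarith
  have hcK : 6 * K' ≤ c := le_max_right _ _
  -- The unknown is the mixed derivative: it is sent to f evaluated along the state that it
  -- generates.
  obtain ⟨k, hk, hfix⟩ := exists_fixed_density (V := Vec n) hG hc0.le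
    (fun k => d.c.G.indicator (along d.f (d.stateOf u k)))
    (fun k hk => hd.f_C1.along_density (isState_stateOf hd hu hU hk))
    (fun k k' hk hk' M hM hkk z hz => by
      have hkd := hk.sub hk'
      have b1 := norm_int₁₂_le_of_wt hG hkd hc1 hM hkk hz
      have b2 := norm_int₂_le_of_wt hG hc0 hM hkk hz
      have b3 := norm_int₁_le_of_wt hG hc0 hM hkk hz
      rw [int₁₂_sub hG hk hk'] at b1
      rw [int₂_sub hG hk hk'] at b2
      rw [int₁_sub hG hk hk'] at b3
      rw [indicator_of_mem hz, indicator_of_mem hz]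
      have h1 := hK z hz (u z) (hU z hz) ((d.stateOf u k).x z) ((d.stateOf u k).p z)
        ((d.stateOf u k).q z) ((d.stateOf u k').x z) ((d.stateOf u k').p z)
        ((d.stateOf u k').q z)
      have e1 : (d.stateOf u k).x z - (d.stateOf u k').x z = int₁₂ k z - int₁₂ k' z := by
        simp only [stateOf]; abel
      have e2 : (d.stateOf u k).p z - (d.stateOf u k').p z = int₂ k z - int₂ k' z := by
        simp only [stateOf]; abel
      have e3 : (d.stateOf u k).q z - (d.stateOf u k').q z = int₁ k z - int₁ k' z := by
        simp only [stateOf]; abel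
      rw [e1, e2, e3] at h1
      refine h1.trans ?_
      have hw := wt_pos c z
      calc K * (‖int₁₂ k z - int₁₂ k' z‖ + ‖int₂ k z - int₂ k' z‖ + ‖int₁ k z - int₁ k' z‖)
          ≤ K' * (M / c * wt c z + M / c * wt c z + M / c * wt c z) := by
            gcongr
            exact le_max_left _ _
        -- Three operators with gain 1/c give 3K'M/c, written as 6K'/c times M/2 to match the
        -- contraction factor 1/2.
        _ = (6 * K' / c) * (M / 2 * wt c z) := by field_simp; ring
        _ ≤ 1 * (M / 2 * wt c z) := by
            gcongr
            rw [div_le_iff₀ hc0, one_mul]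
            exact hcK
        _ = _ := one_mul _)
  have hs := isState_stateOf hd hu hU hk
  refine ⟨d.stateOf u k, rfl, hs.measurable_x, hs.measurable_p, hs.measurable_q, hs.bounded,
    fun z hz => ?_, fun z hz => ?_, fun z hz => ?_⟩
  · change _ + int₁₂ k z = _
    congr 1
    rw [int₁₂]
    refine setIntegral_congr_fun (measurableSet_W z) fun w hw => ?_
    have := congrFun hfix w
    simp only [indicator_of_mem (hG.lower z hz hw)] at this
    exact this.symm
  · change _ + int₂ k z = _
    rw [intervalIntegral.integral_of_le (hG.nonneg z hz).2, ← integral_Icc_eq_integral_Ioc]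
    congr 1
    rw [int₂]
    refine setIntegral_congr_fun measurableSet_Icc fun τ hτ => ?_
    have := congrFun hfix (z.1, τ)
    simp only [indicator_of_mem (hG.vert_mem hz hτ)] at this
    exact this.symm
  · change _ + int₁ k z = _
    rw [intervalIntegral.integral_of_le (hG.nonneg z hz).1, ← integral_Icc_eq_integral_Ioc]
    congr 1
    rw [int₁]
    refine setIntegral_congr_fun measurableSet_Icc fun σ hσ => ?_
    have := congrFun hfix (σ, z.2)
    simp only [indicator_of_mem (hG.horiz_mem hz hσ)] at this
    exact this.symm

open Classical in
/-- Switching the value of an admissible control on an open subset of `G`. -/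
theorem Admissible.piecewise_const {u : ℝ × ℝ → Vec m} (hu : d.Admissible u) {Q : Set (ℝ × ℝ)}
    (hQ : IsOpen Q) (hQG : Q ⊆ d.c.G) {v : Vec m} (hv : v ∈ d.U) :
    d.Admissible (Q.piecewise (fun _ => v) u) := by
  obtain ⟨S, hfin, hS, hcover⟩ := hu.piecewise
  have hclG : closure Q ⊆ d.c.G := closure_minimal hQG d.c.isCompact_G.isClosed
  -- The new pieces are Q and the old pieces minus the closure of Q, since the control may jump
  -- across the boundary of Q. Their closures still cover: a point outside the closure of Q has a
  -- neighbourhood in which the old pieces are unchanged.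
  refine ⟨?_, fun z hz => ?_, insert Q ((fun O => O ∩ (closure Q)ᶜ) '' S),
    (hfin.image _).insert _, ?_, ?_⟩
  · exact Measurable.ite (measurable_subtype_coe hQ.measurableSet) measurable_const hu.measurable
  · by_cases h : z ∈ Q
    · rw [piecewise_eq_of_mem _ _ _ h]; exact hv
    · rw [piecewise_eq_of_notMem _ _ _ h]; exact hu.mem_U z hz
  · rintro O (rfl | ⟨O, hO, rfl⟩)
    · exact ⟨hQ, continuousOn_const.congr fun z hz => piecewise_eq_of_mem _ _ _ hz⟩
    · refine ⟨(hS O hO).1.inter isClosed_closure.isOpen_compl,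
        ((hS O hO).2.mono inter_subset_left).congr fun z hz => ?_⟩
      exact piecewise_eq_of_notMem _ _ _ fun h => hz.2 (subset_closure h)
  · refine Subset.antisymm (iUnion₂_subset ?_) fun z hz => ?_
    · rintro O (rfl | ⟨O, hO, rfl⟩)
      · exact hclG
      · rw [← hcover]
        exact (closure_mono inter_subset_left).trans (subset_biUnion_of_mem (u := closure) hO)
    · by_cases h : z ∈ closure Q
      · exact mem_biUnion (mem_insert _ _) h
      · rw [← hcover] at hz
        obtain ⟨O, hO, hzO⟩ := mem_iUnion₂.1 hz
        exact mem_biUnion (mem_insert_of_mem _ (mem_image_of_mem _ hO))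
          (isClosed_closure.isOpen_compl.closure_inter ⟨hzO, h⟩)

/-- Differences of a uniformly differentiable function are continuous in all the variables. -/
theorem UniformlyDifferentiable.continuousOn_sub {A : Set (ℝ × ℝ)} {h : ℝ × ℝ → Vec m → ℝ}
    (hh : d.UniformlyDifferentiable A h) {v : Vec m} (hv : v ∈ d.U) :
    ContinuousOn (fun y : (ℝ × ℝ) × Vec m => h y.1 v - h y.1 y.2) (A ×ˢ d.U) := by
  obtain ⟨Dh, hdiff, hcont, _⟩ := hh
  obtain ⟨B, hB⟩ := (isCompact_U (d := d)).isBounded.exists_norm_le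
  have hB0 : 0 ≤ B := (norm_nonneg v).trans (hB v hv)
  refine continuousOn_of_uniform_approx_of_continuousOn fun V hV => ?_
  obtain ⟨e, he, heV⟩ := Metric.mem_uniformity_dist.1 hV
  obtain ⟨δ, hδ, hD⟩ := hdiff (e / (2 * B + 1)) (by positivity)
  -- The segment from w to v has length at most 2B, so j equal steps are each shorter than δ,
  -- uniformly in w.
  obtain ⟨j, hj⟩ := exists_nat_gt (2 * B / δ)
  have hj0 : (0 : ℝ) < j := lt_of_le_of_lt (by positivity) hj
  set pt : Vec m → ℕ → Vec m := fun w i => w + ((i : ℝ) / j) • (v - w) with hpt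
  have hstep : ∀ w i, pt w (i + 1) - pt w i = ((1 : ℝ) / j) • (v - w) := fun w i => by
    simp only [hpt, add_sub_add_left_eq_sub, ← sub_smul]
    congr 1
    push_cast
    ring
  have hptU : ∀ w ∈ d.U, ∀ i ≤ j, pt w i ∈ d.U := fun w hw i hi =>
    convex_U.add_smul_sub_mem hw hv
      ⟨by positivity, by rw [div_le_one hj0]; exact_mod_cast hi⟩
  -- h itself is not assumed continuous in z, only its derivative is. The telescoping sum for the
  -- difference is therefore compared with a Riemann sum of the derivative, which is jointly
  -- continuous; convexity of U keeps the nodes admissible.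
  refine ⟨fun y => ∑ i ∈ Finset.range j, Dh y.1 (pt y.2 i) (((1 : ℝ) / j) • (v - y.2)), ?_, ?_⟩
  · refine continuousOn_finsetSum _ fun i hi => ContinuousOn.clm_apply ?_ (by fun_prop)
    exact hcont.comp (f := fun y : (ℝ × ℝ) × Vec m => (y.1, pt y.2 i)) (by fun_prop)
      fun y hy => ⟨hy.1, hptU _ hy.2 i (Finset.mem_range.1 hi).le⟩
  · rintro ⟨z, w⟩ ⟨hz, hw⟩
    refine heV ?_
    have hn : ‖v - w‖ ≤ 2 * B := (norm_sub_le _ _).trans (by linarith [hB v hv, hB w hw])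
    have hsn : ‖((1 : ℝ) / j) • (v - w)‖ = ‖v - w‖ / j := by
      rw [norm_smul, Real.norm_of_nonneg (by positivity)]; ring
    have hlt : ‖v - w‖ / j < δ := by
      rw [div_lt_iff₀ hj0]
      rw [div_lt_iff₀ hδ] at hj
      linarith
    have htel : h z v - h z w = ∑ i ∈ Finset.range j, (h z (pt w (i + 1)) - h z (pt w i)) := by
      rw [Finset.sum_range_sub (fun i => h z (pt w i))]
      simp only [hpt, div_self hj0.ne', one_smul, add_sub_cancel, Nat.cast_zero, zero_div,
        zero_smul, add_zero]
    have hterm : ∀ i ∈ Finset.range j, |h z (pt w (i + 1)) - h z (pt w i) -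
        Dh z (pt w i) (((1 : ℝ) / j) • (v - w))| ≤ e / (2 * B + 1) * (‖v - w‖ / j) := by
      intro i hi
      have hi' := Finset.mem_range.1 hi
      have := hD z hz (pt w i) (hptU w hw i hi'.le) (pt w (i + 1)) (hptU w hw (i + 1) hi')
        (by rw [hstep, hsn]; exact hlt)
      rwa [hstep, hsn] at this
    rw [Real.dist_eq, htel, ← Finset.sum_sub_distrib]
    calc _ ≤ ∑ i ∈ Finset.range j, e / (2 * B + 1) * (‖v - w‖ / j) :=
          (Finset.abs_sum_le_sum_abs _ _).trans (Finset.sum_le_sum hterm)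
      _ = e / (2 * B + 1) * ‖v - w‖ := by
          rw [Finset.sum_const, Finset.card_range, nsmul_eq_mul]; field_simp
      _ ≤ e / (2 * B + 1) * (2 * B) := by gcongr
      _ < e := by
          rw [div_mul_eq_mul_div, div_lt_iff₀ (by positivity)]
          nlinarith

/-- A point of the regular part has a neighbourhood in which all points of `G` are regular. -/
theorem eventually_mem_GR {z : ℝ × ℝ} (hz : z ∈ d.c.GR) :
    ∀ᶠ w in 𝓝 z, w ∈ d.c.G → w ∈ d.c.GR := by
  have : ∀ᶠ w : ℝ × ℝ in 𝓝 z, ∀ r, w.1 ≠ (d.c.P r).1 ∧ w.2 ≠ (d.c.P r).2 :=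
    eventually_all.2 fun r => (continuousAt_fst.eventually_ne (hz.2 r).1).and
      (continuousAt_snd.eventually_ne (hz.2 r).2)
  exact this.mono fun w hw hwG => ⟨hwG, hw⟩

/-- The end vertices (a,0) and (0,b) have the coordinate 0, which a regular point must avoid. There
is thus room for a square below and to the left of it. -/
theorem pos_of_mem_GR {z : ℝ × ℝ} (hz : z ∈ d.c.GR) : 0 < z.1 ∧ 0 < z.2 := by
  have e0 : d.c.P 0 = (d.c.a, 0) := by
    rw [Curve.P, Curve.pt, d.c.vert_zero, d.c.start_eq.1, d.c.start_eq.2]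
  have el : d.c.P (Fin.last (N + 1)) = (0, d.c.b) := by
    rw [Curve.P, Curve.pt, d.c.vert_last, d.c.end_eq.1, d.c.end_eq.2]
  have h0 := (hz.2 0).2
  have hl := (hz.2 (Fin.last (N + 1))).1
  rw [e0] at h0
  rw [el] at hl
  have := d.c.isStaircase_G.nonneg z hz.1
  exact ⟨lt_of_le_of_ne this.1 (Ne.symm hl), lt_of_le_of_ne this.2 (Ne.symm h0)⟩

end Data

end
end GoursatControl

/-! ### The minimum principle -/

theorem theorem5p1 {n m N : ℕ} (d : GoursatControl.Data n m N) (hd : d.Regular)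
    (π : GoursatControl.Data.ControlledState n m) (hopt : d.IsOptimal π)
    (R Rs Rt : ℝ × ℝ → ℝ × ℝ → GoursatControl.Mat n) (hR : d.IsRiemann π R Rs Rt)
    (hreg : d.CostateRegular π)
    (hH : d.UniformlyDifferentiable d.c.GR
      (fun z u => d.H z (π.x z) (π.p z) (π.q z) (d.costate π R z) u))
    (z : ℝ × ℝ) (hz : z ∈ d.c.GR) (hu : ContinuousWithinAt π.u d.c.G z)
    (u₁ : GoursatControl.Vec m) (hu₁ : u₁ ∈ d.U) :
    d.H z (π.x z) (π.p z) (π.q z) (d.costate π R z) (π.u z) ≤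
      d.H z (π.x z) (π.p z) (π.q z) (d.costate π R z) u₁ := by
  classical
  open GoursatControl GoursatControl.Data Filter Topology in
  have hG := d.c.isStaircase_G
  have hπ : d.IsState π := hopt.trajectory.isState hopt.admissible.measurable hopt.admissible.mem_U
  by_contra hlt
  rw [not_le] at hlt
  set g : ℝ × ℝ → ℝ := fun w => jump d.Φ π u₁ w + d.costate π R w (jump d.f π u₁ w) with hg
  have hgH : ∀ w, g w = d.H w (π.x w) (π.p w) (π.q w) (d.costate π R w) u₁ -
      d.H w (π.x w) (π.p w) (π.q w) (d.costate π R w) (π.u w) := fun w => by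
    simp only [hg, jump, along, H, map_sub]; ring
  -- g is the gain in the Hamiltonian from switching to u₁, negative at z by assumption. Half of its
  -- size remains available nearby.
  set c := -g z / 2 with hc
  have hc0 : 0 < c := by rw [hc, hgH]; linarith
  have hcont : ContinuousWithinAt g d.c.GR z := by
    have h1 := (hH.continuousOn_sub hu₁) (z, π.u z) ⟨hz, hπ.mem_U z hz.1⟩
    have h2 : ContinuousWithinAt (fun w => (w, π.u w)) d.c.GR z :=
      continuousWithinAt_id.prodMk (hu.mono fun w hw => hw.1)
    have h3 := ContinuousWithinAt.comp (f := fun w => (w, π.u w)) h1 h2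
      fun w hw => ⟨hw, hπ.mem_U w hw.1⟩
    exact h3.congr (fun w _ => hgH w) (hgH z)
  -- Continuity holds only within the regular part, but near a regular point every point of G is
  -- regular.
  have hev : ∀ᶠ w in 𝓝 z, w ∈ d.c.G → g w ≤ -c := by
    have h1 : ∀ᶠ w in 𝓝[d.c.GR] z, g w < -c := hcont.eventually_lt_const (by rw [hc]; linarith)
    filter_upwards [eventually_nhdsWithin_iff.1 h1, eventually_mem_GR hz] with w hw hw' hwG
    exact (hw (hw' hwG)).le
  obtain ⟨r, hr, hball⟩ := Metric.eventually_nhds_iff.1 hev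
  obtain ⟨hz1, hz2⟩ := pos_of_mem_GR hz
  obtain ⟨C, hC, hneedle⟩ := exists_isNeedle hd hπ hopt.trajectory hu₁
  have hsmall : ∀ᶠ ε in 𝓝[>] (0 : ℝ), ε < min (min 1 r) (min z.1 z.2) :=
    eventually_nhdsWithin_of_eventually_nhds
      (gt_mem_nhds (lt_min (lt_min one_pos hr) (lt_min hz1 hz2)))
  obtain ⟨ε, ⟨hexp, hε⟩, hε0⟩ := (((eventually_cost_expansion (v := u₁) hd hπ hreg hR hC
    (half_pos hc0)).and hsmall).and self_mem_nhdsWithin).exists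
  have hε0 : 0 < ε := hε0
  obtain ⟨⟨hε1, hεr⟩, hεz1, hεz2⟩ : (ε < 1 ∧ ε < r) ∧ ε < z.1 ∧ ε < z.2 := by
    simpa only [lt_min_iff] using hε
  -- The square has z as its upper right corner rather than as its centre: it then lies in W z and
  -- hence in G, even when z is on the curve.
  set S := Set.Ioo (z.1 - ε) z.1 with hS
  set T := Set.Ioo (z.2 - ε) z.2 with hT
  have hQG : S ×ˢ T ⊆ d.c.G := fun w hw => hG.lower z hz.1
    ⟨⟨by linarith [hw.1.1], hw.1.2.le⟩, ⟨by linarith [hw.2.1], hw.2.2.le⟩⟩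
  have hQg : ∀ w ∈ S ×ˢ T, g w ≤ -c := fun w hw => by
    refine hball ?_ (hQG hw)
    rw [Prod.dist_eq, Real.dist_eq, Real.dist_eq]
    exact max_lt (abs_lt.2 ⟨by linarith [hw.1.1], by linarith [hw.1.2]⟩)
      (abs_lt.2 ⟨by linarith [hw.2.1], by linarith [hw.2.2]⟩)
  have hadm := hopt.admissible.piecewise_const (isOpen_Ioo.prod isOpen_Ioo) hQG hu₁
  obtain ⟨ρ, hρu, hρ⟩ := exists_isTrajectory hd hadm.measurable hadm.mem_U
  rw [← hρu] at hadm
  obtain ⟨k, hk⟩ := hneedle ε hε0 hε1.le S T measurableSet_Ioo measurableSet_Ioo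
    (by rw [hS, Real.volume_Ioo, sub_sub_cancel]) (by rw [hT, Real.volume_Ioo, sub_sub_cancel])
    hQG ρ (hρ.isState hadm.measurable hadm.mem_U) hρ
    (fun w hw => by rw [hρu]; exact if_pos hw)
    (fun w _ hw => by rw [hρu]; exact if_neg hw)
  obtain ⟨hint, hJ⟩ := hexp ρ S T k hk
  have hmin := hopt.minimal ρ hadm hρ
  have hvol : volume.real (S ×ˢ T) = ε ^ 2 := by
    rw [Measure.volume_eq_prod, measureReal_prod_prod, hS, hT,
      Real.volume_real_Ioo_of_le (by linarith), Real.volume_real_Ioo_of_le (by linarith)]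
    ring
  have hfin : volume (S ×ˢ T) ≠ ⊤ := ((measure_mono hQG).trans_lt hG.volume_lt_top).ne
  have hle : ∫ w in S ×ˢ T, g w ≤ ∫ w in S ×ˢ T, -c :=
    setIntegral_mono_on hint (integrableOn_const hfin)
      (measurableSet_Ioo.prod measurableSet_Ioo) hQg
  rw [setIntegral_const, hvol, smul_eq_mul] at hle
  -- The square contributes at most -cε² and the error at most cε²/2, so the new control would have
  -- strictly smaller cost.
  have : 0 < ε ^ 2 * c := by positivity
  linarith
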